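/- **Hecke–Kiselman monoids.** For $n\ge 0$ let $\mathsf L_n$ be the monoid with generators $x_1,\dots,x_n$ and relations $x_i^2=x_i$ for all $i$; $x_ix_j=x_jx_i$ for $i-j>1$; and $x_ix_{i+1}x_i=x_{i+1}x_ix_{i+1}=x_ix_{i+1}$ for $1\le i<n$. For $n\ge 3$ let $\mathsf C_n$ be the monoid with generators $x_1,\dots,x_n$ (subscripts modulo $n$) and relations $x_i^2=x_i$ for all $i$; $x_ix_j=x_jx_i$ for $1<i-j<n-1$; and $x_ix_{i+1}x_i=x_{i+1}x_ix_{i+1}=x_ix_{i+1}$ for $1\le i\le n$. **Diagrams.** Let $I=[0,1]$. An *$n$-diagram* consists of $n+1$ curves (strands) in the strip $\mathbb R\times I$, each of them the graph of a continuous function of the height $y\in I$, which connect the points $(1,0),\dots,(n+1,0)$ to the points $(1,1),\dots,(n+1,1)$, both endpoint sets being used bijectively; the strands have finitely many intersection points, each of them is a double point in the interior of the strip, and at each of them the two strands cross (exchange their left-to-right order). *Extended $\tilde n$-diagrams* are defined in the same way, with $n$ strands, on the cylinder $\mathbb S^1\times I$, where $\mathbb S^1=\mathbb R/n\mathbb Z$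 is the interval $[1,n+1]$ with its endpoints glued, and with endpoints over $1,\dots,n$. An *isotopy* is a continuous family of diagrams (with the same endpoints) along which the double points move continuously, without being created, destroyed or merged. Diagrams up to isotopy form a monoid: the product $dd'$ is obtained by putting $d$ on top of $d'$ and shrinking the result vertically. The *elementary diagram* $d_i$ (resp. $\tilde d_i$) has straight strands and a single crossing, between the strands starting over $i$ and $i+1$, which exchange these two points (for $\tilde d_n$, the points $n$ and $n+1\equiv 1$); its other strands are vertical. The submonoid generated by $\tilde d_1,\dots,\tilde d_n$ is the monoid of *$\tilde n$-diagrams*. **Moves.** A *2-move* or *3-move* changes a diagram only inside a box (the image of some rectangle $[l,r]\times[a,b]$, embedded in the strip or cylinder), which two, resp. three, strands traverse from the bottom side to the top side, and which no other strand meets. Number the arcs in the box by $1,2(,3)$ from left to right at the bottom of the box, and record which pairs of arcs cross, from bottom to top. A 2-move replaces the crossings $(12),(12)$ by the single crossing $(12)$, or conversely. The 3-moves replace, in either direction, one of the three pictures $$(12),(13),(23)\qquad\longleftrightarrow\qquad (23),(13),(12)\qquad\longleftrightarrow\qquad (23),(13)$$ by another one. Let $\mathsf{DL}_n$ be the quotient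 of the monoid of $n$-diagrams up to isotopy by the congruence generated by the 2- and 3-moves, and let $\mathsf{DC}_n$ be the quotient of the monoid of $\tilde n$-diagrams up to isotopy by the congruence generated by the 2- and 3-moves. **Statement.** For every $n\ge 0$ there is a monoid isomorphism $\varepsilon_n\colon\mathsf L_n\to\mathsf{DL}_n$ sending each $x_i$ to the class of $d_i$. For every $n\ge 3$ there is a monoid isomorphism $\tilde\varepsilon_n\colon\mathsf C_n\to\mathsf{DC}_n$ sending each $x_i$ to the class of $\tilde d_i$. -/

import Mathlib

namespace HKDiagram

open Set Topology
open scoped unitInterval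

/-! ### The Hecke-Kiselman monoids

The generators `x_1, …, x_n` are indexed by `Fin n`: the index `i` stands for `x_{i+1}`. -/

/-- Defining relations of the linear Hecke-Kiselman monoid on `x_1, …, x_n`. -/
inductive LRel (n : ℕ) : FreeMonoid (Fin n) → FreeMonoid (Fin n) → Prop
  | idem (i : Fin n) : LRel n (.of i * .of i) (.of i)
  | comm (i j : Fin n) (h : (j : ℕ) + 1 < i) : LRel n (.of i * .of j) (.of j * .of i)
  | braid (i j : Fin n) (h : (j : ℕ) = i + 1) :
      LRel n (.of i * .of j * .of i) (.of j * .of i * .of j)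
  | kiselman (i j : Fin n) (h : (j : ℕ) = i + 1) :
      LRel n (.of j * .of i * .of j) (.of i * .of j)

/-- Defining relations of the circular Hecke-Kiselman monoid on `x_1, …, x_n`,
subscripts being read modulo `n`. -/
inductive CRel (n : ℕ) : FreeMonoid (Fin n) → FreeMonoid (Fin n) → Prop
  | idem (i : Fin n) : CRel n (.of i * .of i) (.of i)
  | comm (i j : Fin n) (h : (j : ℕ) + 1 < i) (h' : (i : ℕ) + 1 < j + n) :
      CRel n (.of i * .of j) (.of j * .of i)
  | braid (i j : Fin n) (h : (j : ℕ) = (i + 1) % n) :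
      CRel n (.of i * .of j * .of i) (.of j * .of i * .of j)
  | kiselman (i j : Fin n) (h : (j : ℕ) = (i + 1) % n) :
      CRel n (.of j * .of i * .of j) (.of i * .of j)

/-- The linear Hecke-Kiselman monoid `L_n`. -/
abbrev LinearHK (n : ℕ) : Type := PresentedMonoid (LRel n)

/-- The circular Hecke-Kiselman monoid `C_n`. -/
abbrev CircularHK (n : ℕ) : Type := PresentedMonoid (CRel n)

/-! ### Strips

The line and the circle are treated together: the surface is `X × [0,1]`, where `X` is the
quotient of the real line by `p ℤ` through `proj` (with `p = 0` for the line itself), and the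
diagrams have `m` strands, with endpoints over `proj 1, …, proj m`.  Only the two instances
`plane` and `cylinder` below are used. -/

structure Strip where
  X : Type
  [top : TopologicalSpace X]
  proj : ℝ → X
  continuous_proj : Continuous proj
  m : ℕ
  p : ℕ
  proj_eq : ∀ x y : ℝ, proj x = proj y ↔ ∃ k : ℤ, x - y = k * p
  pt_inj : ∀ i j : Fin m, proj ((i : ℝ) + 1) = proj ((j : ℝ) + 1) → i = j

attribute [instance] Strip.top

/-- The planar strip `ℝ × [0,1]`, with the `n + 1` marked abscissas `1, …, n + 1`. -/
def plane (n : ℕ) : Strip where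
  X := ℝ
  proj := fun x => x
  continuous_proj := continuous_id
  m := n + 1
  p := 0
  proj_eq := by intro x y; simp [sub_eq_zero]
  pt_inj := by
    intro i j h
    have h' : ((i : ℕ) : ℝ) = ((j : ℕ) : ℝ) := by linarith
    exact Fin.ext (by exact_mod_cast h')

/-- The cylinder `𝕊¹ × [0,1]`, where `𝕊¹ = ℝ / nℤ` is the interval `[1, n + 1]` with its endpoints
glued, with the `n` marked abscissas `1, …, n`. -/
def cylinder (n : ℕ) : Strip where
  X := AddCircle (n : ℝ)
  proj := fun x => (x : AddCircle (n : ℝ))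
  continuous_proj := AddCircle.continuous_mk' _
  m := n
  p := n
  proj_eq := by
    intro x y
    rw [← sub_eq_zero, ← AddCircle.coe_sub, AddCircle.coe_eq_zero_iff]
    simp [eq_comm]
  pt_inj := by
    intro i j h
    rw [← sub_eq_zero, ← AddCircle.coe_sub, AddCircle.coe_eq_zero_iff] at h
    obtain ⟨k, hk⟩ := h
    have hk' : (k * n : ℤ) = (i : ℤ) - j := by
      have : ((k * n : ℤ) : ℝ) = (((i : ℤ) - j : ℤ) : ℝ) := by
        push_cast
        rw [zsmul_eq_mul] at hk
        linarith
      exact_mod_cast this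
    have hi := i.2
    have hj := j.2
    have hk0 : k = 0 := by
      have h1 : k < 1 := by
        by_contra hc
        have : (n : ℤ) ≤ k * n := by nlinarith
        omega
      have h2 : -1 < k := by
        by_contra hc
        have : k * n ≤ -(n : ℤ) := by nlinarith
        omega
      omega
    subst hk0
    exact Fin.ext (by omega)

/-- The `i`-th marked point of the strip (numbered from `0`). -/
def Strip.pt (S : Strip) (i : Fin S.m) : S.X := S.proj ((i : ℝ) + 1)

/-- The strands `f` and `g` (the abscissa being given as a function of the height) cross
at height `y`: they meet there, and they exchange their left-to-right order.
The functions `F` and `G` are the strands read in a chart, i.e. lifted to the line. -/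
def Crosses (S : Strip) (f g : I → S.X) (y : I) : Prop :=
  ∃ F G : I → ℝ, ContinuousAt F y ∧ ContinuousAt G y ∧ F y = G y ∧
    (∀ᶠ z in 𝓝 y, S.proj (F z) = f z ∧ S.proj (G z) = g z) ∧
    (((∀ᶠ z in 𝓝[<] y, F z < G z) ∧ (∀ᶠ z in 𝓝[>] y, G z < F z)) ∨
     ((∀ᶠ z in 𝓝[<] y, G z < F z) ∧ (∀ᶠ z in 𝓝[>] y, F z < G z)))

/-- Diagrams on a strip.  A strand which projects bijectively onto the vertical interval is the
graph of a continuous function of the height, and it is given here by that function; strands are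
numbered by their lower endpoints.  So the strand `i` is the curve `y ↦ (strand i y, y)`, going
from the `i`-th lower marked point to the `perm i`-th upper marked point.  There are finitely many
intersections, all of them are double points, and at each of them two strands cross
(double points lie at heights `0 < y < 1`, since the marked points are distinct). -/
structure Diagram (S : Strip) where
  perm : Equiv.Perm (Fin S.m)
  strand : ∀ i, Path (S.pt i) (S.pt (perm i))
  finite_double : ∀ i j, i ≠ j → {y | strand i y = strand j y}.Finite
  no_triple : ∀ i j k, i ≠ j → j ≠ k → i ≠ k → ∀ y,
    ¬ (strand i y = strand j y ∧ strand j y = strand k y)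
  crosses : ∀ i j, i ≠ j → ∀ y, strand i y = strand j y → Crosses S (strand i) (strand j) y

/-- Isotopy of diagrams: a continuous family of diagrams with the same endpoints, along which the
double points move continuously and stay distinct (none is created, destroyed or merged).  The last
clause says that the heights of the intersections of the strands `i` and `j` are described, without
repetition, by finitely many continuous functions `h a` of the time. -/
def Isotopic {S : Strip} (d d' : Diagram S) : Prop :=
  ∃ D : I → Diagram S,
    (∀ t, (D t).perm = d.perm) ∧
    (∀ i, Continuous fun q : I × I => (D q.1).strand i q.2) ∧
    (∀ i y, (D 0).strand i y = d.strand i y) ∧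
    (∀ i y, (D 1).strand i y = d'.strand i y) ∧
    ∀ i j, i ≠ j → ∃ (A : Type) (_ : Finite A) (h : A → I → I), (∀ a, Continuous (h a)) ∧
      ∀ t, Function.Injective (fun a => h a t) ∧
        range (fun a => h a t) = {y | (D t).strand i y = (D t).strand j y}

/-! ### Stacking -/

theorem pt_injective (S : Strip) : Function.Injective S.pt := fun i j h => S.pt_inj i j h

theorem Crosses.comp {S : Strip} {f g f' g' : I → S.X} {φ : I → I} {y : I}
    (h : Crosses S f g (φ y)) (hφ : ContinuousAt φ y)
    (hl : ∀ᶠ z in 𝓝[<] y, φ z < φ y) (hr : ∀ᶠ z in 𝓝[>] y, φ y < φ z)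
    (hf : ∀ᶠ z in 𝓝 y, f' z = f (φ z)) (hg : ∀ᶠ z in 𝓝 y, g' z = g (φ z)) :
    Crosses S f' g' y := by
  obtain ⟨F, G, hF, hG, he, hlift, hc⟩ := h
  have hφl : Filter.Tendsto φ (𝓝[<] y) (𝓝[<] (φ y)) :=
    tendsto_nhdsWithin_iff.2 ⟨hφ.tendsto.mono_left nhdsWithin_le_nhds, hl⟩
  have hφr : Filter.Tendsto φ (𝓝[>] y) (𝓝[>] (φ y)) :=
    tendsto_nhdsWithin_iff.2 ⟨hφ.tendsto.mono_left nhdsWithin_le_nhds, hr⟩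
  refine ⟨F ∘ φ, G ∘ φ, hF.comp hφ, hG.comp hφ, he, ?_, ?_⟩
  · filter_upwards [hφ.tendsto.eventually hlift, hf, hg] with z hz h1 h2
    exact ⟨by rw [h1]; exact hz.1, by rw [h2]; exact hz.2⟩
  · rcases hc with ⟨h1, h2⟩ | ⟨h1, h2⟩
    · exact Or.inl ⟨hφl.eventually h1, hφr.eventually h2⟩
    · exact Or.inr ⟨hφl.eventually h1, hφr.eventually h2⟩

theorem Crosses.symm {S : Strip} {f g : I → S.X} {y : I} (h : Crosses S f g y) :
    Crosses S g f y := by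
  obtain ⟨F, G, hF, hG, he, hlift, hc⟩ := h
  exact ⟨G, F, hG, hF, he.symm, hlift.mono fun _ hz => ⟨hz.2, hz.1⟩, hc.symm⟩

/-- The trivial diagram, all of whose strands are vertical. -/
def Diagram.one (S : Strip) : Diagram S where
  perm := 1
  strand := fun i => Path.refl (S.pt i)
  finite_double := fun _ _ h => finite_empty.subset fun _ e => h (pt_injective S e)
  no_triple := fun _ _ _ h _ _ _ e => h (pt_injective S e.1)
  crosses := fun _ _ h _ e => absurd (pt_injective S e) h

/-- `y ↦ 2y` and `y ↦ 2y - 1`, truncated to the unit interval. -/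
noncomputable def dbl (y : I) : I := projIcc 0 1 zero_le_one (2 * (y : ℝ))

noncomputable def dblSub (y : I) : I := projIcc 0 1 zero_le_one (2 * (y : ℝ) - 1)

theorem continuous_dbl : Continuous dbl := by unfold dbl; fun_prop

theorem continuous_dblSub : Continuous dblSub := by unfold dblSub; fun_prop

theorem dbl_val {y : I} (h : (y : ℝ) ≤ 1 / 2) : (dbl y : ℝ) = 2 * y := by
  have := y.2.1
  simp only [dbl, coe_projIcc]
  rw [min_eq_right (by linarith), max_eq_right (by linarith)]

theorem dblSub_val {y : I} (h : 1 / 2 ≤ (y : ℝ)) : (dblSub y : ℝ) = 2 * y - 1 := by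
  have := y.2.2
  simp only [dblSub, coe_projIcc]
  rw [min_eq_right (by linarith), max_eq_right (by linarith)]

theorem trans_low {X : Type} [TopologicalSpace X] {x y z : X} (γ : Path x y) (γ' : Path y z)
    {t : I} (h : (t : ℝ) ≤ 1 / 2) : (γ.trans γ') t = γ (dbl t) := by
  rw [Path.trans_apply, dif_pos h]
  congr 1
  exact Subtype.ext (dbl_val h).symm

theorem trans_high {X : Type} [TopologicalSpace X] {x y z : X} (γ : Path x y) (γ' : Path y z)
    {t : I} (h : 1 / 2 ≤ (t : ℝ)) : (γ.trans γ') t = γ' (dblSub t) := by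
  rcases h.lt_or_eq with h' | h'
  · rw [Path.trans_apply, dif_neg (not_le.2 h')]
    congr 1
    exact Subtype.ext (dblSub_val h).symm
  · rw [trans_low _ _ h'.symm.le]
    have h1 : dbl t = 1 := Subtype.ext (by rw [dbl_val h'.symm.le]; simp [← h'])
    have h2 : dblSub t = 0 := Subtype.ext (by rw [dblSub_val h]; simp [← h'])
    rw [h1, h2]
    simp

theorem half_of_trans {S : Strip} {d d' : Diagram S} {i j : Fin S.m} (hij : i ≠ j) {y : I}
    (h : ((d'.strand i).trans (d.strand (d'.perm i))) y =
      ((d'.strand j).trans (d.strand (d'.perm j))) y) :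
    ((y : ℝ) < 1 / 2 ∧ d'.strand i (dbl y) = d'.strand j (dbl y)) ∨
    (1 / 2 < (y : ℝ) ∧ d.strand (d'.perm i) (dblSub y) = d.strand (d'.perm j) (dblSub y)) := by
  rcases lt_trichotomy (y : ℝ) (1 / 2) with hy | hy | hy
  · rw [trans_low _ _ hy.le, trans_low _ _ hy.le] at h
    exact Or.inl ⟨hy, h⟩
  · rw [trans_low _ _ hy.le, trans_low _ _ hy.le] at h
    have h1 : dbl y = 1 := Subtype.ext (by rw [dbl_val hy.le]; simp [hy])
    rw [h1] at h
    simp only [Path.target] at h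
    exact absurd (d'.perm.injective (pt_injective S h)) hij
  · rw [trans_high _ _ hy.le, trans_high _ _ hy.le] at h
    exact Or.inr ⟨hy, h⟩

/-- The composition `d d'` of diagrams: `d` is put on top of `d'`, and the result is shrunk. -/
noncomputable def Diagram.comp {S : Strip} (d d' : Diagram S) : Diagram S where
  perm := d.perm * d'.perm
  strand := fun i => (d'.strand i).trans (d.strand (d'.perm i))
  finite_double := by
    intro i j hij
    have h1 := d'.finite_double i j hij
    have h2 := d.finite_double _ _ (d'.perm.injective.ne hij)
    have inj1 : InjOn dbl {y : I | (y : ℝ) ≤ 1 / 2} := by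
      intro a ha b hb e
      have := congrArg Subtype.val e
      rw [dbl_val ha, dbl_val hb] at this
      exact Subtype.ext (by linarith)
    have inj2 : InjOn dblSub {y : I | 1 / 2 ≤ (y : ℝ)} := by
      intro a ha b hb e
      have := congrArg Subtype.val e
      rw [dblSub_val ha, dblSub_val hb] at this
      exact Subtype.ext (by linarith)
    have f1 : ({y : I | (y : ℝ) ≤ 1 / 2} ∩ dbl ⁻¹' {y | d'.strand i y = d'.strand j y}).Finite :=
      Finite.of_finite_image (h1.subset (by rintro _ ⟨a, ha, rfl⟩; exact ha.2))
        (inj1.mono inter_subset_left)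
    have f2 : ({y : I | 1 / 2 ≤ (y : ℝ)} ∩
        dblSub ⁻¹' {y | d.strand (d'.perm i) y = d.strand (d'.perm j) y}).Finite :=
      Finite.of_finite_image (h2.subset (by rintro _ ⟨a, ha, rfl⟩; exact ha.2))
        (inj2.mono inter_subset_left)
    refine (f1.union f2).subset fun y hy => ?_
    rcases half_of_trans hij hy with ⟨a, b⟩ | ⟨a, b⟩
    · exact Or.inl ⟨a.le, b⟩
    · exact Or.inr ⟨a.le, b⟩
  no_triple := by
    rintro i j k hij hjk hik y ⟨e1, e2⟩
    rcases half_of_trans hij e1 with ⟨a, b⟩ | ⟨a, b⟩ <;>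
      rcases half_of_trans hjk e2 with ⟨a', b'⟩ | ⟨a', b'⟩
    · exact d'.no_triple i j k hij hjk hik _ ⟨b, b'⟩
    · linarith
    · linarith
    · exact d.no_triple _ _ _ (d'.perm.injective.ne hij) (d'.perm.injective.ne hjk)
        (d'.perm.injective.ne hik) _ ⟨b, b'⟩
  crosses := by
    intro i j hij y e
    rcases half_of_trans hij e with ⟨a, b⟩ | ⟨a, b⟩
    · have hn : ∀ᶠ z : I in 𝓝 y, (z : ℝ) < 1 / 2 :=
        continuous_subtype_val.continuousAt.eventually_lt continuousAt_const a
      refine (d'.crosses i j hij _ b).comp continuous_dbl.continuousAt ?_ ?_ ?_ ?_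
      · filter_upwards [self_mem_nhdsWithin, nhdsWithin_le_nhds hn] with z (hz : z < y) hz'
        have hz2 : (z : ℝ) < y := hz
        refine Subtype.coe_lt_coe.1 ?_
        rw [dbl_val hz'.le, dbl_val a.le]; linarith
      · filter_upwards [self_mem_nhdsWithin, nhdsWithin_le_nhds hn] with z (hz : y < z) hz'
        have hz2 : (y : ℝ) < z := hz
        refine Subtype.coe_lt_coe.1 ?_
        rw [dbl_val hz'.le, dbl_val a.le]; linarith
      · filter_upwards [hn] with z hz using trans_low _ _ hz.le
      · filter_upwards [hn] with z hz using trans_low _ _ hz.le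
    · have hn : ∀ᶠ z : I in 𝓝 y, 1 / 2 < (z : ℝ) :=
        continuousAt_const.eventually_lt continuous_subtype_val.continuousAt a
      refine (d.crosses _ _ (d'.perm.injective.ne hij) _ b).comp
        continuous_dblSub.continuousAt ?_ ?_ ?_ ?_
      · filter_upwards [self_mem_nhdsWithin, nhdsWithin_le_nhds hn] with z (hz : z < y) hz'
        have hz2 : (z : ℝ) < y := hz
        refine Subtype.coe_lt_coe.1 ?_
        rw [dblSub_val hz'.le, dblSub_val a.le]; linarith
      · filter_upwards [self_mem_nhdsWithin, nhdsWithin_le_nhds hn] with z (hz : y < z) hz'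
        have hz2 : (y : ℝ) < z := hz
        refine Subtype.coe_lt_coe.1 ?_
        rw [dblSub_val hz'.le, dblSub_val a.le]; linarith
      · filter_upwards [hn] with z hz using trans_high _ _ hz.le
      · filter_upwards [hn] with z hz using trans_high _ _ hz.le

theorem comp_low {S : Strip} (d e : Diagram S) (i : Fin S.m) {y : I} (h : (y : ℝ) ≤ 1 / 2) :
    (d.comp e).strand i y = e.strand i (dbl y) := trans_low _ _ h

theorem comp_high {S : Strip} (d e : Diagram S) (i : Fin S.m) {y : I} (h : 1 / 2 ≤ (y : ℝ)) :
    (d.comp e).strand i y = d.strand (e.perm i) (dblSub y) := trans_high _ _ h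

theorem Isotopic.refl {S : Strip} (d : Diagram S) : Isotopic d d := by
  refine ⟨fun _ => d, fun _ => rfl, fun i => (d.strand i).continuous.comp continuous_snd,
    fun _ _ => rfl, fun _ _ => rfl, fun i j hij => ?_⟩
  refine ⟨{y : I // d.strand i y = d.strand j y}, (d.finite_double i j hij).to_subtype,
    fun a _ => a.1, fun _ => continuous_const, fun _ => ⟨Subtype.val_injective, ?_⟩⟩
  exact Subtype.range_val

/-- `y ↦ y / 2` and `y ↦ (y + 1) / 2`. -/
noncomputable def halfLow (y : I) : I := ⟨(y : ℝ) / 2, by constructor <;> linarith [y.2.1, y.2.2]⟩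

noncomputable def halfHigh (y : I) : I :=
  ⟨((y : ℝ) + 1) / 2, by constructor <;> linarith [y.2.1, y.2.2]⟩

theorem Isotopic.comp {S : Strip} {d d' e e' : Diagram S} (h : Isotopic d d')
    (h' : Isotopic e e') : Isotopic (d.comp e) (d'.comp e') := by
  obtain ⟨D, hp, hc, h0, h1, hh⟩ := h
  obtain ⟨E, hp', hc', h0', h1', hh'⟩ := h'
  have hpe : e'.perm = e.perm := by
    ext i
    have a1 := h1' i 1
    rw [Path.target, Path.target] at a1
    rw [← pt_injective S a1, hp' 1]
  refine ⟨fun t => (D t).comp (E t), fun t => ?_, fun i => ?_, fun i y => ?_, fun i y => ?_, ?_⟩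
  · change (D t).perm * (E t).perm = d.perm * e.perm
    rw [hp, hp']
  · have key : Continuous fun q : I × I => if (q.2 : ℝ) ≤ 1 / 2 then (E q.1).strand i (dbl q.2)
        else (D q.1).strand (e.perm i) (dblSub q.2) := by
      refine Continuous.if_le ?_ ?_ (by fun_prop) (by fun_prop) ?_
      · exact (hc' i).comp (continuous_fst.prodMk (continuous_dbl.comp continuous_snd))
      · exact (hc (e.perm i)).comp
          (continuous_fst.prodMk (continuous_dblSub.comp continuous_snd))
      · intro q hq
        rw [← comp_low (D q.1) (E q.1) i hq.le, comp_high _ _ _ hq.ge, hp']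
    refine key.congr fun q => ?_
    split_ifs with hq
    · exact (comp_low _ _ _ hq).symm
    · rw [comp_high _ _ _ (not_le.1 hq).le, hp']
  · rcases le_total (y : ℝ) (1 / 2) with hy | hy
    · rw [comp_low _ _ _ hy, comp_low _ _ _ hy, h0']
    · rw [comp_high _ _ _ hy, comp_high _ _ _ hy, hp', h0]
  · rcases le_total (y : ℝ) (1 / 2) with hy | hy
    · rw [comp_low _ _ _ hy, comp_low _ _ _ hy, h1']
    · rw [comp_high _ _ _ hy, comp_high _ _ _ hy, hp', hpe, h1]
  · intro i j hij
    obtain ⟨A, hA, f, hf, hf'⟩ := hh' i j hij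
    obtain ⟨B, hB, g, hg, hg'⟩ := hh _ _ (e.perm.injective.ne hij)
    have bd : ∀ t (z : I), (D t).strand (e.perm i) z = (D t).strand (e.perm j) z → 0 < (z : ℝ) := by
      intro t z hz
      rcases z.2.1.lt_or_eq with h | h
      · exact h
      · have hz0 : z = 0 := Subtype.ext h.symm
        rw [hz0, Path.source, Path.source] at hz
        exact absurd (e.perm.injective (pt_injective S hz)) hij
    refine ⟨A ⊕ B, inferInstance, Sum.elim (fun a t => halfLow (f a t))
      (fun b t => halfHigh (g b t)), ?_, fun t => ⟨?_, ?_⟩⟩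
    · rintro (a | b)
      · exact Continuous.subtype_mk ((continuous_subtype_val.comp (hf a)).div_const 2) _
      · exact Continuous.subtype_mk
          (((continuous_subtype_val.comp (hg b)).add continuous_const).div_const 2) _
    · have pos : ∀ b, 0 < (g b t : ℝ) := fun b => bd t _ (by
        have : g b t ∈ range (fun b => g b t) := ⟨b, rfl⟩
        rw [(hg' t).2] at this
        exact this)
      rintro (a | a) (b | b) he
      · have he' : (f a t : ℝ) / 2 = f b t / 2 := congrArg Subtype.val he
        exact congrArg Sum.inl ((hf' t).1 (Subtype.ext (by linarith : (f a t : ℝ) = f b t)))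
      · have he' : (f a t : ℝ) / 2 = (g b t + 1) / 2 := congrArg Subtype.val he
        linarith [pos b, (f a t).2.2]
      · have he' : ((g a t : ℝ) + 1) / 2 = f b t / 2 := congrArg Subtype.val he
        linarith [pos a, (f b t).2.2]
      · have he' : ((g a t : ℝ) + 1) / 2 = (g b t + 1) / 2 := congrArg Subtype.val he
        exact congrArg Sum.inr ((hg' t).1 (Subtype.ext (by linarith : (g a t : ℝ) = g b t)))
    · ext y
      have hA' := Set.ext_iff.1 (hf' t).2
      have hB' := Set.ext_iff.1 (hg' t).2
      constructor
      · rintro ⟨a | b, rfl⟩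
        · have hm := (hA' (f a t)).1 ⟨a, rfl⟩
          have hl : ((halfLow (f a t) : I) : ℝ) ≤ 1 / 2 := by
            change (f a t : ℝ) / 2 ≤ 1 / 2
            linarith [(f a t).2.2]
          have hd : dbl (halfLow (f a t)) = f a t := Subtype.ext (by
            rw [dbl_val hl]; change 2 * ((f a t : ℝ) / 2) = _; ring)
          change ((D t).comp (E t)).strand i (halfLow (f a t)) =
            ((D t).comp (E t)).strand j (halfLow (f a t))
          rw [comp_low _ _ _ hl, comp_low _ _ _ hl, hd]
          exact hm
        · have hm := (hB' (g b t)).1 ⟨b, rfl⟩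
          have hl : 1 / 2 ≤ ((halfHigh (g b t) : I) : ℝ) := by
            change 1 / 2 ≤ ((g b t : ℝ) + 1) / 2
            linarith [(g b t).2.1]
          have hd : dblSub (halfHigh (g b t)) = g b t := Subtype.ext (by
            rw [dblSub_val hl]; change 2 * (((g b t : ℝ) + 1) / 2) - 1 = _; ring)
          change ((D t).comp (E t)).strand i (halfHigh (g b t)) =
            ((D t).comp (E t)).strand j (halfHigh (g b t))
          rw [comp_high _ _ _ hl, comp_high _ _ _ hl, hd, hp']
          exact hm
      · intro hy
        rcases half_of_trans hij hy with ⟨a, b⟩ | ⟨a, b⟩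
        · obtain ⟨c, hc⟩ := (hA' (dbl y)).2 b
          refine ⟨Sum.inl c, Subtype.ext ?_⟩
          have := congrArg Subtype.val hc
          simp only [dbl_val a.le] at this
          change (f c t : ℝ) / 2 = y
          linarith
        · rw [hp'] at b
          obtain ⟨c, hc⟩ := (hB' (dblSub y)).2 b
          refine ⟨Sum.inr c, Subtype.ext ?_⟩
          have := congrArg Subtype.val hc
          simp only [dblSub_val a.le] at this
          change ((g c t : ℝ) + 1) / 2 = y
          linarith

/-- A change of the height scale, possibly collapsing initial and final intervals. -/
structure IsScale (φ : I → I) : Prop where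
  cont : Continuous φ
  zero : φ 0 = 0
  one : φ 1 = 1
  mono : Monotone φ
  inj : ∀ y z, φ y = φ z → 0 < φ y → φ y < 1 → y = z

theorem Diagram.pos_of_eq {S : Strip} (d : Diagram S) {i j : Fin S.m} (hij : i ≠ j) {y : I}
    (h : d.strand i y = d.strand j y) : 0 < y ∧ y < 1 := by
  constructor
  · refine lt_of_le_of_ne y.2.1 fun h0 => ?_
    have : y = 0 := h0.symm
    rw [this, Path.source, Path.source] at h
    exact hij (pt_injective S h)
  · refine lt_of_le_of_ne y.2.2 fun h0 => ?_
    have : y = 1 := h0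
    rw [this, Path.target, Path.target] at h
    exact hij (d.perm.injective (pt_injective S h))

noncomputable def Diagram.rescale {S : Strip} (d : Diagram S) (φ : I → I) (h : IsScale φ) :
    Diagram S where
  perm := d.perm
  strand := fun i => (d.strand i).reparam φ h.cont h.zero h.one
  finite_double := by
    intro i j hij
    refine Finite.of_finite_image (f := φ) ((d.finite_double i j hij).subset ?_) ?_
    · rintro _ ⟨a, ha, rfl⟩
      exact ha
    · intro a ha b _ he
      have := d.pos_of_eq hij ha
      exact h.inj _ _ he this.1 this.2
  no_triple := fun i j k hij hjk hik y e => d.no_triple i j k hij hjk hik (φ y) e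
  crosses := by
    intro i j hij y e
    have hy := d.pos_of_eq hij (y := φ y) e
    refine (d.crosses i j hij (φ y) e).comp h.cont.continuousAt ?_ ?_
      (Filter.Eventually.of_forall fun _ => rfl) (Filter.Eventually.of_forall fun _ => rfl)
    · filter_upwards [self_mem_nhdsWithin] with z (hz : z < y)
      exact lt_of_le_of_ne (h.mono hz.le) fun he => hz.ne' (h.inj _ _ he.symm hy.1 hy.2)
    · filter_upwards [self_mem_nhdsWithin] with z (hz : y < z)
      exact lt_of_le_of_ne (h.mono hz.le) fun he => hz.ne (h.inj _ _ he hy.1 hy.2)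

theorem IsScale.surj {φ : I → I} (h : IsScale φ) : Function.Surjective φ := by
  intro c
  have := intermediate_value_univ (0 : I) 1 h.cont
  rw [h.zero, h.one] at this
  exact this ⟨c.2.1, c.2.2⟩

/-- Linear interpolation between the identity and `φ`. -/
noncomputable def interp (φ : I → I) (t y : I) : I :=
  ⟨(1 - (t : ℝ)) * y + t * φ y, by
    have h1 := t.2.1
    have h2 := t.2.2
    have h3 := y.2.1
    have h4 := y.2.2
    have h5 := (φ y).2.1
    have h6 := (φ y).2.2
    constructor
    · have := mul_nonneg (sub_nonneg.2 h2) h3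
      have := mul_nonneg h1 h5
      linarith
    · nlinarith⟩

theorem continuous_interp {φ : I → I} (h : Continuous φ) :
    Continuous fun q : I × I => interp φ q.1 q.2 := by
  unfold interp
  fun_prop

theorem IsScale.interp {φ : I → I} (h : IsScale φ) (t : I) : IsScale (interp φ t) where
  cont := (continuous_interp h.cont).comp (continuous_const.prodMk continuous_id)
  zero := Subtype.ext (by simp [HKDiagram.interp, h.zero])
  one := Subtype.ext (by simp [HKDiagram.interp, h.one])
  mono := by
    intro y z hyz
    have h1 : (y : ℝ) ≤ z := hyz
    have h2 : (φ y : ℝ) ≤ φ z := h.mono hyz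
    change (1 - (t : ℝ)) * y + t * φ y ≤ (1 - (t : ℝ)) * z + t * φ z
    have h3 := t.2.1
    have h4 : 0 ≤ 1 - (t : ℝ) := sub_nonneg.2 t.2.2
    have := mul_le_mul_of_nonneg_left h1 h4
    have := mul_le_mul_of_nonneg_left h2 h3
    linarith
  inj := by
    intro y z he h0 h1
    rcases t.2.2.lt_or_eq with ht | ht
    · have he' : (1 - (t : ℝ)) * y + t * φ y = (1 - (t : ℝ)) * z + t * φ z :=
        congrArg Subtype.val he
      have h4 : 0 < 1 - (t : ℝ) := sub_pos.2 ht
      have key : ∀ a b : I, a < b →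
          (1 - (t : ℝ)) * a + t * φ a < (1 - (t : ℝ)) * b + t * φ b := by
        intro a b hab
        have h1 : (a : ℝ) < b := hab
        have h2 : (φ a : ℝ) ≤ φ b := h.mono hab.le
        have := mul_lt_mul_of_pos_left h1 h4
        have := mul_le_mul_of_nonneg_left h2 t.2.1
        linarith
      rcases lt_trichotomy y z with hyz | hyz | hyz
      · exact absurd he' (key _ _ hyz).ne
      · exact hyz
      · exact absurd he' (key _ _ hyz).ne'
    · have hv : ∀ a, HKDiagram.interp φ t a = φ a := fun a => Subtype.ext (by
        change (1 - (t : ℝ)) * a + t * φ a = φ a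
        rw [ht]; ring)
      rw [hv, hv] at he
      rw [hv] at h0 h1
      exact h.inj _ _ he h0 h1

theorem isotopic_rescale {S : Strip} (d d' : Diagram S) (φ : I → I) (h : IsScale φ)
    (hd : ∀ i y, d'.strand i y = d.strand i (φ y)) : Isotopic d d' := by
  refine ⟨fun t => d.rescale _ (h.interp t), fun _ => rfl, fun i => ?_, fun i y => ?_,
    fun i y => ?_, fun i j hij => ?_⟩
  · exact (d.strand i).continuous.comp (continuous_interp h.cont)
  · change d.strand i (interp φ 0 y) = _
    congr 1
    exact Subtype.ext (by simp [interp])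
  · change d.strand i (interp φ 1 y) = _
    rw [hd]
    congr 1
    exact Subtype.ext (by simp [interp])
  · choose inv hinv using fun t => (h.interp t).surj
    refine ⟨{y : I // d.strand i y = d.strand j y}, (d.finite_double i j hij).to_subtype,
      fun c t => inv t c.1, fun c => ?_, fun t => ⟨fun c c' he => ?_, ?_⟩⟩
    · have hc := d.pos_of_eq hij c.2
      refine continuous_iff_isClosed.2 fun C hC => ?_
      have hcl : IsClosed {q : I × I | interp φ q.1 q.2 = c.1 ∧ q.2 ∈ C} :=
        (isClosed_singleton.preimage (continuous_interp h.cont)).inter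
          (hC.preimage continuous_snd)
      have := isClosedMap_fst_of_compactSpace _ hcl
      convert this using 1
      ext t
      constructor
      · intro ht
        exact ⟨(t, inv t c.1), ⟨hinv t c.1, ht⟩, rfl⟩
      · rintro ⟨⟨t', y⟩, ⟨h1, h2⟩, rfl⟩
        simp only at h1 h2 ⊢
        have : inv t' c.1 = y := (h.interp t').inj _ _ ((hinv t' c.1).trans h1.symm)
          (by rw [hinv]; exact hc.1) (by rw [hinv]; exact hc.2)
        rw [mem_preimage, this]
        exact h2
    · have := congrArg (interp φ t) he
      simp only [hinv] at this
      exact Subtype.ext this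
    · ext y
      constructor
      · rintro ⟨c, rfl⟩
        change d.strand i (interp φ t (inv t c.1)) = d.strand j (interp φ t (inv t c.1))
        rw [hinv]
        exact c.2
      · intro hy
        refine ⟨⟨interp φ t y, hy⟩, ?_⟩
        have hc := d.pos_of_eq hij (y := interp φ t y) hy
        exact (h.interp t).inj _ _ (hinv t _) (by rw [hinv]; exact hc.1) (by rw [hinv]; exact hc.2)

open Path.Homotopy in
theorem isotopic_assoc {S : Strip} (a b c : Diagram S) :
    Isotopic ((a.comp b).comp c) (a.comp (b.comp c)) := by
  refine isotopic_rescale _ _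
    (fun t => ⟨transAssocReparamAux t, transAssocReparamAux_mem_I t⟩)
    ⟨by fun_prop, Subtype.ext transAssocReparamAux_zero, Subtype.ext transAssocReparamAux_one,
      ?_, ?_⟩ ?_
  · intro y z hyz
    have h1 : (y : ℝ) ≤ z := hyz
    refine Subtype.coe_le_coe.1 ?_
    change transAssocReparamAux y ≤ transAssocReparamAux z
    unfold transAssocReparamAux
    split_ifs <;> linarith
  · intro y z he _ _
    have he' : transAssocReparamAux y = transAssocReparamAux z := congrArg Subtype.val he
    unfold transAssocReparamAux at he'
    refine Subtype.ext ?_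
    split_ifs at he' <;> linarith
  · intro i y
    exact congrArg (fun γ => γ y) (trans_assoc_reparam (c.strand i) (b.strand (c.perm i))
      (a.strand (b.perm (c.perm i))))

open Path.Homotopy in
theorem isScale_trans_refl :
    IsScale (fun t => ⟨transReflReparamAux t, transReflReparamAux_mem_I t⟩) where
  cont := by fun_prop
  zero := Subtype.ext transReflReparamAux_zero
  one := Subtype.ext transReflReparamAux_one
  mono := by
    intro y z hyz
    have h1 : (y : ℝ) ≤ z := hyz
    refine Subtype.coe_le_coe.1 ?_
    change transReflReparamAux y ≤ transReflReparamAux z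
    unfold transReflReparamAux
    split_ifs <;> linarith
  inj := by
    intro y z he _ h1
    have he' : transReflReparamAux y = transReflReparamAux z := congrArg Subtype.val he
    have h1' : transReflReparamAux y < 1 := h1
    unfold transReflReparamAux at he' h1'
    refine Subtype.ext ?_
    split_ifs at he' h1' <;> linarith

theorem IsScale.flip {φ : I → I} (h : IsScale φ) :
    IsScale (fun t => unitInterval.symm (φ (unitInterval.symm t))) where
  cont := by have := h.cont; fun_prop
  zero := by simp [h.one]
  one := by simp [h.zero]
  mono := by
    intro y z hyz
    have h1 : unitInterval.symm z ≤ unitInterval.symm y := unitInterval.symm_le_symm.2 hyz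
    exact unitInterval.symm_le_symm.2 (h.mono h1)
  inj := by
    intro y z he h0 h1
    have he' := unitInterval.symm_bijective.injective he
    refine unitInterval.symm_bijective.injective (h.inj _ _ he' ?_ ?_)
    · have := unitInterval.symm_lt_symm.2 h1
      simpa using this
    · have := unitInterval.symm_lt_symm.2 h0
      simpa using this

theorem isotopic_one_comp {S : Strip} (d : Diagram S) : Isotopic d ((Diagram.one S).comp d) :=
  isotopic_rescale _ _ _ isScale_trans_refl fun i y =>
    congrArg (fun γ => γ y) (Path.Homotopy.trans_refl_reparam (d.strand i))

theorem isotopic_comp_one {S : Strip} (d : Diagram S) : Isotopic d (d.comp (Diagram.one S)) := by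
  refine isotopic_rescale _ _ _ isScale_trans_refl.flip fun i y => ?_
  have h1 := congrArg (fun γ => γ (unitInterval.symm y))
    (Path.Homotopy.trans_refl_reparam (d.strand i).symm)
  have h2 : ((Path.refl (S.pt i)).trans (d.strand i)) y =
      ((d.strand i).symm.trans (Path.refl (S.pt i))) (unitInterval.symm y) := by
    have := Path.trans_symm (Path.refl (S.pt i)) (d.strand i)
    rw [Path.refl_symm] at this
    rw [← this]
    exact congrArg ((Path.refl (S.pt i)).trans (d.strand i)) (unitInterval.symm_symm y).symm
  exact h2.trans h1

/-- Diagrams on a strip up to isotopy. -/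
def DiagramClass (S : Strip) : Type := Quot (Isotopic (S := S))

def Diagram.cls {S : Strip} (d : Diagram S) : DiagramClass S := Quot.mk _ d

/-- The monoid of diagrams up to isotopy, under stacking. -/
noncomputable instance (S : Strip) : Monoid (DiagramClass S) where
  mul := Quot.map₂ Diagram.comp (fun _ _ _ h => (Isotopic.refl _).comp h)
    (fun _ _ _ h => h.comp (Isotopic.refl _))
  one := (Diagram.one S).cls
  mul_assoc := by
    rintro ⟨a⟩ ⟨b⟩ ⟨c⟩
    exact Quot.sound (isotopic_assoc a b c)
  one_mul := by
    rintro ⟨d⟩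
    exact (Quot.sound (isotopic_one_comp d)).symm
  mul_one := by
    rintro ⟨d⟩
    exact (Quot.sound (isotopic_comp_one d)).symm

/-! ### Elementary diagrams -/

/-- The abscissa, read on the line, of the strand `c` of the elementary diagram exchanging the
neighbours `i` and `j`: the strand `i` goes straight one step to the right, the strand `j` goes
straight one step to the left, and the other strands are vertical. -/
noncomputable def elemLift {m : ℕ} (i j c : Fin m) (y : ℝ) : ℝ :=
  if c = i then (i : ℝ) + 1 + y else if c = j then (j : ℝ) + 1 - y else (c : ℝ) + 1

theorem elemLift_target (S : Strip) {i j : Fin S.m} (h : S.proj ((j : ℝ) + 1) = S.proj ((i : ℝ) + 2))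
    (c : Fin S.m) : S.proj (elemLift i j c 1) = S.pt (Equiv.swap i j c) := by
  unfold elemLift
  split_ifs with h1 h2
  · rw [h1, Equiv.swap_apply_left, Strip.pt, h]
    congr 1
    ring
  · rw [h2, Equiv.swap_apply_right, Strip.pt, S.proj_eq]
    obtain ⟨k, hk⟩ := (S.proj_eq _ _).1 h
    exact ⟨k, by linarith⟩
  · rw [Equiv.swap_apply_of_ne_of_ne h1 h2, Strip.pt]

theorem elemLift_zero {m : ℕ} (i j c : Fin m) : elemLift i j c 0 = (c : ℝ) + 1 := by
  unfold elemLift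
  split_ifs with h1 h2
  · rw [h1]; ring
  · rw [h2]; ring
  · rfl

theorem elemLift_eq (S : Strip) {i j : Fin S.m} (h : S.proj ((j : ℝ) + 1) = S.proj ((i : ℝ) + 2))
    {c c' : Fin S.m} (hc : c ≠ c') {y : ℝ} (hy0 : 0 ≤ y) (hy1 : y ≤ 1)
    (he : S.proj (elemLift i j c y) = S.proj (elemLift i j c' y)) :
    y = 1 / 2 ∧ ((c = i ∧ c' = j) ∨ (c = j ∧ c' = i)) := by
  have y0 : y ≠ 0 := by
    rintro rfl
    rw [elemLift_zero, elemLift_zero] at he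
    exact hc (S.pt_inj _ _ he)
  have y1 : y ≠ 1 := by
    rintro rfl
    rw [elemLift_target S h, elemLift_target S h] at he
    exact hc ((Equiv.swap i j).injective (pt_injective S he))
  have hy0' : 0 < y := lt_of_le_of_ne hy0 y0.symm
  have hy1' : y < 1 := lt_of_le_of_ne hy1 y1
  obtain ⟨q, hq⟩ := (S.proj_eq _ _).1 h
  obtain ⟨k, hk⟩ := (S.proj_eq _ _).1 he
  have nonint : ∀ z : ℤ, y ≠ z := by
    intro z hz
    rw [hz] at hy0' hy1'
    have h1 : (0 : ℤ) < z := by exact_mod_cast hy0'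
    have h2 : z < (1 : ℤ) := by exact_mod_cast hy1'
    omega
  have half : ∀ z : ℤ, 2 * y = z → y = 1 / 2 := by
    intro z hz
    have h1 : (0 : ℤ) < z := by
      have : (0 : ℝ) < z := by linarith
      exact_mod_cast this
    have h2 : z < (2 : ℤ) := by
      have : (z : ℝ) < 2 := by linarith
      exact_mod_cast this
    have : z = 1 := by omega
    rw [this] at hz
    push_cast at hz
    linarith
  unfold elemLift at hk
  split_ifs at hk with h1 h2 h3 h4 h5 h6 h7
  · exact absurd (h1.trans h2.symm) hc
  · exact ⟨half (j - i + k * S.p) (by push_cast; linarith), Or.inl ⟨h1, h3⟩⟩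
  · exact absurd (by push_cast; linarith) (nonint (c' - i + k * S.p))
  · exact ⟨half (j - i - k * S.p) (by push_cast; linarith), Or.inr ⟨h4, h5⟩⟩
  · exact absurd (h4.trans h6.symm) hc
  · exact absurd (by push_cast; linarith) (nonint (j - c' - k * S.p))
  · exact absurd (by push_cast; linarith) (nonint (c - i - k * S.p))
  · exact absurd (by push_cast; linarith) (nonint (j - c + k * S.p))
  · refine absurd (S.pt_inj c c' ((S.proj_eq _ _).2 ⟨k, hk⟩)) hc

/-- The elementary diagram with a single crossing, exchanging the neighbours `i` and `j`, where
`j` is the marked point next to `i` on the right. -/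
noncomputable def Diagram.elem (S : Strip) (i j : Fin S.m) (hij : i ≠ j)
    (h : S.proj ((j : ℝ) + 1) = S.proj ((i : ℝ) + 2)) : Diagram S where
  perm := Equiv.swap i j
  strand := fun c =>
    { toFun := fun y => S.proj (elemLift i j c y)
      continuous_toFun := S.continuous_proj.comp (by
        unfold elemLift
        split_ifs <;> fun_prop)
      source' := by
        change S.proj (elemLift i j c 0) = _
        rw [elemLift_zero, Strip.pt]
      target' := elemLift_target S h c }
  finite_double := by
    intro c c' hc
    refine (finite_singleton (⟨1 / 2, by norm_num, by norm_num⟩ : I)).subset fun y hy => ?_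
    exact Subtype.ext (elemLift_eq S h hc y.2.1 y.2.2 hy).1
  no_triple := by
    rintro c c' c'' h1 h2 h3 y ⟨e1, e2⟩
    obtain ⟨-, h4⟩ := elemLift_eq S h h1 y.2.1 y.2.2 e1
    obtain ⟨-, h5⟩ := elemLift_eq S h h2 y.2.1 y.2.2 e2
    rcases h4 with ⟨a, b⟩ | ⟨a, b⟩ <;> rcases h5 with ⟨a', b'⟩ | ⟨a', b'⟩
    · exact h1 (a.trans a'.symm)
    · exact h3 (a.trans b'.symm)
    · exact h3 (a.trans b'.symm)
    · exact h1 (a.trans a'.symm)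
  crosses := by
    have key : ∀ y : I, (y : ℝ) = 1 / 2 → Crosses S (fun y => S.proj (elemLift i j i y))
        (fun y => S.proj (elemLift i j j y)) y := by
      intro y hy
      obtain ⟨q, hq⟩ := (S.proj_eq _ _).1 h
      refine ⟨fun z => (i : ℝ) + 1 + z, fun z => (i : ℝ) + 2 - z, by fun_prop, by fun_prop,
        by simp only [hy]; ring, Filter.Eventually.of_forall fun z => ⟨?_, ?_⟩, Or.inl ⟨?_, ?_⟩⟩
      · simp [elemLift]
      · rw [S.proj_eq]
        refine ⟨-q, ?_⟩
        simp only [elemLift, if_neg hij.symm, if_true]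
        push_cast
        linarith
      · filter_upwards [self_mem_nhdsWithin] with z (hz : z < y)
        have hz' : (z : ℝ) < y := hz
        linarith
      · filter_upwards [self_mem_nhdsWithin] with z (hz : y < z)
        have hz' : (y : ℝ) < z := hz
        linarith
    intro c c' hc y e
    obtain ⟨hy, ⟨rfl, rfl⟩ | ⟨rfl, rfl⟩⟩ := elemLift_eq S h hc y.2.1 y.2.2 e
    · exact key y hy
    · exact (key y hy).symm

/-- The elementary planar diagram `d_{i+1}`. -/
noncomputable def planeElem (n : ℕ) (i : Fin n) : Diagram (plane n) :=
  Diagram.elem (plane n) (Fin.castSucc i : Fin (n + 1)) (Fin.succ i : Fin (n + 1))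
    (Fin.castSucc_lt_succ (i := i)).ne (by
      change (((Fin.succ i : Fin (n + 1)) : ℕ) : ℝ) + 1 = ((Fin.castSucc i : Fin (n + 1)) : ℕ) + 2
      simp only [Fin.val_succ, Fin.val_castSucc]
      push_cast
      ring)

/-- The elementary cylindrical diagram `d̃_{i+1}`, for at least two strands; the last one exchanges
the marked points `n` and `n + 1 = 1`. -/
noncomputable def cylinderElem (n : ℕ) (hn : 2 ≤ n) (i : Fin n) : Diagram (cylinder n) :=
  Diagram.elem (cylinder n) i (⟨((i : ℕ) + 1) % n, Nat.mod_lt _ (by omega)⟩ : Fin n)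
    (by
      intro h
      have h' : (i : ℕ) = ((i : ℕ) + 1) % n := congrArg Fin.val h
      have hi : (i : ℕ) < n := i.2
      rcases Nat.lt_or_ge ((i : ℕ) + 1) n with hl | hl
      · rw [Nat.mod_eq_of_lt hl] at h'
        omega
      · have : (i : ℕ) + 1 = n := by omega
        rw [this, Nat.mod_self] at h'
        omega)
    (by
      rw [(cylinder n).proj_eq]
      refine ⟨-((((i : ℕ) + 1) / n : ℕ) : ℤ), ?_⟩
      have h := Nat.mod_add_div ((i : ℕ) + 1) n
      have h' : (((((i : ℕ) + 1) % n : ℕ) : ℝ) + (n : ℝ) * ((((i : ℕ) + 1) / n : ℕ) : ℝ)) =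
          ((i : ℕ) : ℝ) + 1 := by exact_mod_cast h
      change ((((i : ℕ) + 1) % n : ℕ) : ℝ) + 1 - (((i : ℕ) : ℝ) + 2) =
        ((-((((i : ℕ) + 1) / n : ℕ) : ℤ) : ℤ) : ℝ) * (n : ℝ)
      rw [Int.cast_neg, Int.cast_natCast]
      linarith)

/-! ### Local moves -/

/-- The local pictures of the 2-move and of the 3-moves.  A picture has `k` strands, numbered
from `0` to `k - 1` from left to right at the bottom of the picture, and it is given by the list of
the pairs of strands which cross, from bottom to top. -/
inductive MovePictures : (k : ℕ) → List (Fin k × Fin k) → List (Fin k × Fin k) → Prop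
  | two : MovePictures 2 [(0, 1), (0, 1)] [(0, 1)]
  | three : MovePictures 3 [(0, 1), (0, 2), (1, 2)] [(1, 2), (0, 2), (0, 1)]
  | kiselman : MovePictures 3 [(1, 2), (0, 2), (0, 1)] [(1, 2), (0, 2)]

/-- Inside the box `[l, r] × [a, b]` of the strip, the diagram `d` consists of `k` arcs from the
bottom side to the top side, which avoid the left and right sides; these arcs belong to the strands
`s 0, …, s (k - 1)`, which are numbered from left to right at the bottom of the box, and their
crossings are, from bottom to top, those given by the list `w`. -/
def BoxPicture {S : Strip} (d : Diagram S) (l r : ℝ) (a b : I) {k : ℕ} (s : Fin k ↪ Fin S.m)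
    (w : List (Fin k × Fin k)) : Prop :=
  (∀ i, i ∉ range s → ∀ y ∈ Icc a b, d.strand i y ∉ S.proj '' Icc l r) ∧
  ∃ F : Fin k → I → ℝ,
    (∀ c, ContinuousOn (F c) (Icc a b)) ∧
    (∀ c, ∀ y ∈ Icc a b, F c y ∈ Ioo l r ∧ S.proj (F c y) = d.strand (s c) y) ∧
    StrictMono (fun c => F c a) ∧
    ∃ h : Fin w.length → I, StrictMono h ∧ (∀ q, h q ∈ Ioo a b) ∧
      ∀ c c', c < c' → ∀ y ∈ Icc a b, (F c y = F c' y ↔ ∃ q, w.get q = (c, c') ∧ h q = y)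

/-- `d'` is obtained from `d` by a 2-move or a 3-move, performed (in the direction given by
`MovePictures`) inside a box `[l, r] × [a, b]` embedded in the strip: the diagrams coincide outside
the box.  Above the box they coincide up to a permutation `τ` of the numbers of the strands
which go through the box. -/
def LocalMove {S : Strip} (d d' : Diagram S) : Prop :=
  ∃ (k : ℕ) (w w' : List (Fin k × Fin k)), MovePictures k w w' ∧
    ∃ (l r : ℝ) (a b : I) (s : Fin k ↪ Fin S.m) (τ : Equiv.Perm (Fin k)),
      l < r ∧ a < b ∧ InjOn S.proj (Icc l r) ∧
      BoxPicture d l r a b s w ∧ BoxPicture d' l r a b s w' ∧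
      (∀ i, i ∉ range s → ∀ y, d'.strand i y = d.strand i y) ∧
      (∀ i, ∀ y ≤ a, d'.strand i y = d.strand i y) ∧
      (∀ c, ∀ y, b ≤ y → d'.strand (s c) y = d.strand (s (τ c)) y)

/-! ### The diagrammatic monoids -/

/-- The congruence on isotopy classes of planar diagrams generated by the 2- and 3-moves. -/
noncomputable def linearMoves (n : ℕ) : Con (DiagramClass (plane n)) :=
  conGen fun x y => ∃ d d' : Diagram (plane n), d.cls = x ∧ d'.cls = y ∧ LocalMove d d'

/-- The diagrammatic linear Hecke-Kiselman monoid `DL_n`. -/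
abbrev LinearDiagHK (n : ℕ) : Type := (linearMoves n).Quotient

/-- The class of the elementary diagram `d_{i+1}` in `DL_n`. -/
noncomputable def linearGen (n : ℕ) (i : Fin n) : LinearDiagHK n :=
  ((planeElem n i).cls : DiagramClass (plane n))

/-- The monoid of (non-extended) cylindrical diagrams up to isotopy: the submonoid generated by the
elementary diagrams. -/
noncomputable def cylinderMonoid (n : ℕ) (hn : 2 ≤ n) : Submonoid (DiagramClass (cylinder n)) :=
  Submonoid.closure (range fun i => (cylinderElem n hn i).cls)

/-- The congruence on `cylinderMonoid` generated by the 2- and 3-moves. -/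
noncomputable def circularMoves (n : ℕ) (hn : 2 ≤ n) : Con (cylinderMonoid n hn) :=
  conGen fun x y => ∃ d d' : Diagram (cylinder n),
    d.cls = (x : DiagramClass (cylinder n)) ∧ d'.cls = (y : DiagramClass (cylinder n)) ∧
      LocalMove d d'

/-- The diagrammatic circular Hecke-Kiselman monoid `DC_n`. -/
abbrev CircularDiagHK (n : ℕ) (hn : 2 ≤ n) : Type := (circularMoves n hn).Quotient

/-- The class of the elementary diagram `d̃_{i+1}` in `DC_n`. -/
noncomputable def circularGen (n : ℕ) (hn : 2 ≤ n) (i : Fin n) : CircularDiagHK n hn :=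
  ((⟨(cylinderElem n hn i).cls, Submonoid.subset_closure ⟨i, rfl⟩⟩ : cylinderMonoid n hn))

end HKDiagram

namespace HKDiagram

open Set Topology
open scoped unitInterval

/-! ### A faithful action of the Hecke-Kiselman monoids on the integers -/

/-! The defining relations hold between elementary diagrams. Idempotency and the relations between
neighbours are moves inside a box of full height (`localMove_two`, `localMove_three`,
`localMove_kiselman`), and far commutation is an isotopy (`cls_elem_comm`). So the homomorphisms
exist, and bijectivity remains.

Injectivity comes from an invariant. In a diagram one can walk upwards along the strands, changing
strands at will at double points; `Drop d x` records how far to the left one can end when starting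
from the lower abscissa `x`, everything being lifted to the line. The minimum of two walks is a walk
(`Walk.min`), so being further left is never a handicap, and the invariant is compatible with
stacking (`drop_comp_congr`). In each picture of a move every entrance leads to the leftmost exit,
so moves preserve the invariant (`LocalMove.drop_eq`); an isotopy carries walks along
(`Isotopic.walk`). For an elementary diagram the leftmost exit is given by `lower` (`drop_elem`).
Hence words with equivalent diagrams act in the same way on the integers.

This action is faithful (`HKRelations.faithful`), by pure algebra. A word whose image misses the
place lowered by `x i` absorbs `x i` on its left (`HKRelations.absorb`). A product `x i * u` can be
rewritten `x i * v`, where the action of `v` depends only on that of `x i * u`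
(`HKRelations.exists_raise`). Induction on the length concludes.

Surjectivity holds by definition on the cylinder. In the plane, a diagram up to isotopy is
determined by the order of its strands at each height (`isotopic_of_lt_iff`). It can thus be pinched
to the marked points and cut between two heights of double points. With at most one such height, it
exchanges disjoint pairs of neighbours, and these exchanges can be performed one after the other
(`closure_planeElem`). -/

/-- The map of the integers which lowers by one the numbers congruent to `i + 1`. -/
def lower {p : ℕ} (i : ZMod p) (z : ℤ) : ℤ := if (z : ZMod p) = i + 1 then z - 1 else z

/-- The action of a word: the last letter acts first. -/
def lowerWord {p : ℕ} {ι : Type} (a : ι → ZMod p) (w : List ι) (z : ℤ) : ℤ :=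
  w.foldr (fun i z => lower (a i) z) z

theorem lowerWord_cons {p : ℕ} {ι : Type} (a : ι → ZMod p) (i : ι) (w : List ι) (z : ℤ) :
    lowerWord a (i :: w) z = lower (a i) (lowerWord a w z) := rfl

theorem lowerWord_le {p : ℕ} {ι : Type} (a : ι → ZMod p) (w : List ι) (z : ℤ) :
    lowerWord a w z ≤ z := by
  induction w with
  | nil => exact le_rfl
  | cons i w ih =>
    rw [lowerWord_cons, lower]
    split_ifs <;> omega

/-- The elements `x i` of a monoid, put at the places `a i` of the line (`p = 0`) or of the circle
`ℤ / p`, satisfy the Hecke-Kiselman relations. -/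
structure HKRelations {M ι : Type} [Monoid M] {p : ℕ} (x : ι → M) (a : ι → ZMod p) : Prop where
  inj : Function.Injective a
  idem : ∀ i, x i * x i = x i
  low : ∀ i j, a j = a i + 1 → x i * x j * x i = x i * x j
  high : ∀ i j, a j = a i + 1 → x j * x i * x j = x i * x j
  far : ∀ i j, a i ≠ a j → a j ≠ a i + 1 → a i ≠ a j + 1 → x i * x j = x j * x i

/-- Raise by one the values `i` which are less than their argument. -/
def raise {p : ℕ} (i : ZMod p) (q z : ℤ) : ℤ :=
  if (q : ZMod p) = i ∧ q < z then q + 1 else q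

/-- If `q` was lowered, the result is at the place `i` and less than `q ≤ z`, so it is raised back;
otherwise `q` is not at the place `i` and nothing happens. -/
theorem raise_lower_self {p : ℕ} (i : ZMod p) {q z : ℤ} (h : (q : ZMod p) ≠ i) (hq : q ≤ z) :
    raise i (lower i q) z = q := by
  unfold raise lower
  split_ifs with e1 e2 e2
  · ring
  · refine absurd ⟨?_, by omega⟩ e2
    push_cast
    rw [e1]; ring
  · exact absurd e2.1 h
  · rfl

theorem lower_lower {p : ℕ} (h1 : (1 : ZMod p) ≠ 0) (i : ZMod p) (q : ℤ) :
    lower i (lower i q) = lower i q := by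
  unfold lower
  split_ifs with e1 e2
  · push_cast at e2
    exact absurd (by linear_combination e1 - e2) h1
  · rfl
  · rfl

/-- The computation behind the inductive step of `HKRelations.exists_raise`: a letter `j` passes
through the operation of lowering at `i` and raising back. -/
theorem lower_raise {p : ℕ} {i j : ZMod p}
    (hij : i ≠ j) (hij' : i ≠ j + 1) {q z : ℤ} (hq : q ≤ z) :
    lower j (raise i (lower i q) z) = raise i (lower i (lower j q)) z := by
  have L : ∀ (k : ZMod p) (c : ℤ), (c : ZMod p) = k + 1 → lower k c = c - 1 := fun k c h => if_pos h
  have L' : ∀ (k : ZMod p) (c : ℤ), (c : ZMod p) ≠ k + 1 → lower k c = c := fun k c h => if_neg h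
  by_cases c1 : (q : ZMod p) = i + 1
  · have r1 : raise i (q - 1) z = q := by
      rw [raise, if_pos ⟨by push_cast; rw [c1]; ring, by omega⟩]; ring
    have n1 : (q : ZMod p) ≠ j + 1 := by
      rw [c1]
      exact fun h => hij (add_right_cancel h)
    rw [L i q c1, r1, L' j q n1, L i q c1, r1]
  by_cases c2 : (q : ZMod p) = j + 1
  · have n1 : (q : ZMod p) ≠ i := fun h => hij' (h.symm.trans c2)
    rw [L' i q c1, raise, if_neg (fun h => n1 h.1), L j q c2]
    -- This is the case where `j` sits just above `i`: on the right-hand side `q` is lowered twice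
    -- and raised back once.
    by_cases c3 : ((q - 1 : ℤ) : ZMod p) = i + 1
    · rw [L i _ c3, raise, if_pos ⟨by push_cast at c3 ⊢; rw [c3]; ring, by omega⟩]; ring
    · rw [L' i _ c3, raise, if_neg]
      rintro ⟨h, -⟩
      push_cast at h
      exact hij (by rw [← h, c2]; ring)
  rw [L' i q c1, L' j q c2, L' i q c1, L']
  unfold raise
  split_ifs with h
  · push_cast
    rw [h.1]
    exact fun h' => hij (add_right_cancel h')
  · exact c2

/-! ### Faithfulness of the action -/

section

variable {M ι : Type} [Monoid M] {p : ℕ} {x : ι → M} {a : ι → ZMod p}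

/-- Induction on the word: the missing place is traced back through its first letter `j`, until the
remaining word absorbs `x i` (or `x j`) and a single relation finishes. -/
theorem HKRelations.absorb (h : HKRelations x a) (i : ι) (u : List ι)
    (hu : ∀ z, (lowerWord a u z : ZMod p) ≠ a i + 1) :
    x i * (u.map x).prod = (u.map x).prod := by
  induction u generalizing i with
  | nil =>
    refine absurd ?_ (hu (a i + 1 : ZMod p).cast)
    simp [lowerWord]
  | cons j v ih =>
    rw [List.map_cons, List.prod_cons]
    simp only [lowerWord_cons] at hu
    by_cases e0 : a i = a j
    · rw [h.inj e0, ← mul_assoc, h.idem]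
    -- A value of `v` at the place `a j + 1` would be lowered to `a i + 1`. So `v` misses that place
    -- too, and it absorbs both `x j` and `x i`.
    by_cases e1 : a j = a i + 1
    · have h3 : ∀ z, (lowerWord a v z : ZMod p) ≠ a j + 1 := by
        intro z hz
        refine hu z ?_
        rw [lower, if_pos hz]
        push_cast
        rw [hz, e1]; ring
      have h4 : ∀ z, (lowerWord a v z : ZMod p) ≠ a i + 1 := by
        intro z hz
        refine hu z ?_
        rw [lower, if_neg (h3 z), hz]
      rw [ih j h3, ih i h4]
    have h4 : ∀ z, (lowerWord a v z : ZMod p) ≠ a i + 1 := by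
      intro z hz
      refine hu z ?_
      rw [lower, if_neg, hz]
      rw [hz]
      exact fun e => e0 (add_right_cancel e)
    -- Here `v` absorbs `x i`; the new factor turns `x i * x j` into `x i * x j * x i`, which equals
    -- `x j * x i`.
    by_cases e2 : a i = a j + 1
    · rw [← ih i h4, ← mul_assoc, ← mul_assoc, h.high _ _ e2, mul_assoc]
    · rw [← mul_assoc, h.far i j e0 e1 e2, mul_assoc, ih i h4]

/-- A left factor `x i` hides part of the action of `u`. The word `v` is a canonical choice behind
this factor: raising recovers its action from that of `i :: u` alone. It is obtained by deleting
letters `i` of `u` where possible. -/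
theorem HKRelations.exists_raise (h : HKRelations x a) (h1 : (1 : ZMod p) ≠ 0)
    (i : ι) (u : List ι) :
    ∃ v : List ι, v.length ≤ u.length ∧ x i * (u.map x).prod = x i * (v.map x).prod ∧
      ∀ z, lowerWord a v z = raise (a i) (lowerWord a (i :: u) z) z := by
  induction u with
  | nil =>
    refine ⟨[], le_rfl, rfl, fun z => ?_⟩
    by_cases e : (z : ZMod p) = a i
    · have hz : lower (a i) z = z := by
        rw [lower, if_neg]
        rw [e]
        exact fun h' => h1 (by linear_combination -h')
      change z = raise (a i) (lower (a i) z) z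
      rw [hz, raise, if_neg (by omega)]
    · exact (raise_lower_self _ e le_rfl).symm
  | cons j t ih =>
    obtain ⟨v, hvl, hv, hvz⟩ := ih
    by_cases hi : ∀ z, (lowerWord a (j :: t) z : ZMod p) ≠ a i
    · refine ⟨j :: t, le_rfl, rfl, fun z => ?_⟩
      exact (raise_lower_self _ (hi z) (lowerWord_le _ _ _)).symm
    -- The image of a word which begins with `j` misses `a j + 1`, whereas `a i` is now known to be
    -- attained.
    have e2 : a i ≠ a j + 1 := by
      intro e
      refine hi fun z hz => ?_
      rw [lowerWord_cons, lower] at hz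
      split_ifs at hz with e'
      · push_cast at hz
        rw [e', e] at hz
        exact h1 (by linear_combination -hz)
      · exact e' (hz.trans e)
    by_cases e0 : a i = a j
    · obtain rfl := h.inj e0
      refine ⟨v, hvl.trans (Nat.le_succ _), ?_, fun z => ?_⟩
      · rw [List.map_cons, List.prod_cons, ← mul_assoc, h.idem, hv]
      · rw [hvz, lowerWord_cons, lowerWord_cons, lowerWord_cons, lower_lower h1]
    refine ⟨j :: v, Nat.succ_le_succ hvl, ?_, fun z => ?_⟩
    · rw [List.map_cons, List.prod_cons, List.map_cons, List.prod_cons]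
      -- The relation `low` inserts a copy of `x i` in front of the tail, where the inductive
      -- hypothesis applies, and then removes it again.
      by_cases e1 : a j = a i + 1
      · rw [← mul_assoc, ← h.low i j e1, mul_assoc _ (x i), hv, ← mul_assoc, h.low i j e1,
          mul_assoc]
      · rw [← mul_assoc, h.far i j e0 e1 e2, mul_assoc, hv, ← mul_assoc, ← h.far i j e0 e1 e2,
          mul_assoc]
    · rw [lowerWord_cons, hvz]
      exact lower_raise e0 e2 (lowerWord_le _ _ _)

/-- The action of a Hecke-Kiselman monoid on the integers is faithful. -/
theorem HKRelations.faithful (h : HKRelations x a) (h1 : (1 : ZMod p) ≠ 0)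
    (w w' : List ι) (hw : ∀ z, lowerWord a w z = lowerWord a w' z) :
    (w.map x).prod = (w'.map x).prod := by
  have miss : ∀ i u z, (lowerWord a (i :: u) z : ZMod p) ≠ a i + 1 := by
    intro i u z
    rw [lowerWord_cons, lower]
    split_ifs with e
    · push_cast
      rw [e]
      exact fun h' => h1 (by linear_combination -h')
    · exact e
  -- Only the length of `w` is controlled; `w'` stays arbitrary throughout the induction.
  obtain ⟨n, hn⟩ : ∃ n, w.length ≤ n := ⟨_, le_rfl⟩
  induction n generalizing w w' with
  | zero =>
    obtain rfl := List.length_eq_zero_iff.1 (Nat.le_zero.1 hn)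
    cases w' with
    | nil => rfl
    | cons j t =>
      refine absurd ?_ (miss j t (a j + 1 : ZMod p).cast)
      rw [← hw]
      simp [lowerWord]
  | succ k ih =>
    cases w with
    | nil => exact ih [] w' hw (Nat.zero_le _)
    | cons i u =>
      have hw' : x i * (w'.map x).prod = (w'.map x).prod :=
        h.absorb i w' fun z => by rw [← hw]; exact miss i u z
      obtain ⟨v, hvl, hv, hvz⟩ := h.exists_raise h1 i u
      obtain ⟨v', -, hv', hvz'⟩ := h.exists_raise h1 i w'
      -- Both `v` and `v'` act by raising the common action of `w` and `w'`, since prefixing `i`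
      -- does not change the action of `w'`.
      have hvv : (v.map x).prod = (v'.map x).prod := by
        refine ih v v' (fun z => ?_) (hvl.trans (Nat.le_of_succ_le_succ hn))
        rw [hvz, hvz', hw, lowerWord_cons, lower, if_neg]
        rw [← hw]
        exact miss i u z
      rw [List.map_cons, List.prod_cons, hv, hvv, ← hv', hw']

end

/-! ### Walks along the strands of a diagram -/

theorem continuousOn_glue {P Q : I → ℝ} {a b c : I} (hab : a ≤ b) (hbc : b ≤ c)
    (hP : ContinuousOn P (Icc a b)) (hQ : ContinuousOn Q (Icc b c)) (h : P b = Q b) :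
    ContinuousOn (fun z => if z ≤ b then P z else Q z) (Icc a c) := by
  rw [← Icc_union_Icc_eq_Icc hab hbc]
  refine ContinuousOn.union_of_isClosed (hP.congr fun z hz => if_pos hz.2) (hQ.congr fun z hz => ?_)
    isClosed_Icc isClosed_Icc
  rcases hz.1.lt_or_eq with h' | h'
  · exact if_neg (not_le.2 h')
  · simp only [← h', le_refl, if_true]
    exact h

/-- Squares on the surface can be lifted to the line, and the surface is separated. -/
structure Strip.Covered (S : Strip) : Prop where
  t2 : T2Space S.X
  lift : ∀ (f : C(I × I, S.X)) (x : ℝ), S.proj x = f (0, 0) →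
    ∃ G : C(I × I, ℝ), G (0, 0) = x ∧ ∀ q, S.proj (G q) = f q

theorem plane_covered (n : ℕ) : (plane n).Covered :=
  ⟨inferInstanceAs (T2Space ℝ), fun f _ hx => ⟨f, hx.symm, fun _ => rfl⟩⟩

/-- The real line covers the circle: the edge `{0} × I` of the square is lifted as a path, and then
the square as a homotopy. -/
theorem cylinder_covered (n : ℕ) : (cylinder n).Covered := by
  refine ⟨inferInstanceAs (T2Space (AddCircle (n : ℝ))), fun f x hx => ?_⟩
  have cov : IsCoveringMap (cylinder n).proj := AddCircle.isCoveringMap_coe (n : ℝ)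
  obtain ⟨g, hg, hg0⟩ := cov.exists_path_lifts (f.comp ((ContinuousMap.const I 0).prodMk
    (ContinuousMap.id I))) x hx.symm
  have h0 : ∀ a, f (0, a) = (cylinder n).proj (g a) := fun a => (congrFun hg a).symm
  exact ⟨cov.liftHomotopy f g h0, (cov.liftHomotopy_zero f g h0 0).trans hg0,
    fun q => congrFun (cov.liftHomotopy_lifts f g h0) q⟩

section

variable {S : Strip}

/-- Above the heights between `y` and `y'`, one can go from the abscissa `x` to the abscissa `x'`
(read on the line) along the strands of the diagram, changing strands at some double points. -/
def Walk (d : Diagram S) (y : I) (x : ℝ) (y' : I) (x' : ℝ) : Prop :=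
  ∃ P : I → ℝ, ContinuousOn P (Icc y y') ∧ P y = x ∧ P y' = x' ∧
    ∀ z ∈ Icc y y', ∃ j, S.proj (P z) = d.strand j z

theorem Walk.trans {d : Diagram S} {y y' y'' : I} {x x' x'' : ℝ} (h : Walk d y x y' x')
    (h' : Walk d y' x' y'' x'') (hy : y ≤ y') (hy' : y' ≤ y'') : Walk d y x y'' x'' := by
  obtain ⟨P, hP, hP0, hP1, hPs⟩ := h
  obtain ⟨Q, hQ, hQ0, hQ1, hQs⟩ := h'
  refine ⟨_, continuousOn_glue hy hy' hP hQ (hP1.trans hQ0.symm), ?_, ?_, fun z hz => ?_⟩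
  · rw [if_pos hy, hP0]
  · split_ifs with h
    · obtain rfl := le_antisymm h hy'
      rw [hP1, ← hQ0, hQ1]
    · exact hQ1
  · split_ifs with h
    · exact hPs z ⟨hz.1, h⟩
    · exact hQs z ⟨(not_le.1 h).le, hz.2⟩

/-- At each height the minimum lies on one of the two walks, hence on a strand. This is what makes
`Drop` monotone and lets walks be compared by their abscissas only. -/
theorem Walk.min {d : Diagram S} {y y' : I} {x x' u u' : ℝ} (h : Walk d y x y' x')
    (h' : Walk d y u y' u') : Walk d y (min x u) y' (min x' u') := by
  obtain ⟨P, hP, hP0, hP1, hPs⟩ := h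
  obtain ⟨Q, hQ, hQ0, hQ1, hQs⟩ := h'
  refine ⟨fun z => Min.min (P z) (Q z), ContinuousOn.inf hP hQ, by simp only [hP0, hQ0],
    by simp only [hP1, hQ1], fun z hz => ?_⟩
  rcases min_choice (P z) (Q z) with e | e
  · simp only [e]; exact hPs z hz
  · simp only [e]; exact hQs z hz

theorem Strip.proj_add (S : Strip) (x : ℝ) (k : ℤ) : S.proj (x + k * S.p) = S.proj x :=
  (S.proj_eq _ _).2 ⟨k, by ring⟩

theorem Strip.exists_eq_add (S : Strip) {x u : ℝ} (h : S.proj x = S.proj u) :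
    ∃ k : ℤ, x = u + k * S.p := by
  obtain ⟨k, hk⟩ := (S.proj_eq _ _).1 h
  exact ⟨k, by linarith⟩

/-- A strand is lifted from its lower endpoint, and the lift is then translated by a multiple of the
period so as to pass through the prescribed point. -/
theorem Diagram.exists_lift (d : Diagram S) (hS : S.Covered) (j : Fin S.m) {x : ℝ} {y : I}
    (h : S.proj x = d.strand j y) :
    ∃ G : I → ℝ, Continuous G ∧ G y = x ∧ ∀ z, S.proj (G z) = d.strand j z := by
  obtain ⟨G, -, hG⟩ := hS.lift ((d.strand j).toContinuousMap.comp ContinuousMap.snd) ((j : ℝ) + 1)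
    (d.strand j).source.symm
  have hG' : ∀ z, S.proj (G (0, z)) = d.strand j z := fun z => hG (0, z)
  obtain ⟨k, hk⟩ := S.exists_eq_add (h.trans (hG' y).symm)
  refine ⟨fun z => G (0, z) + k * S.p, by fun_prop, hk.symm, fun z => ?_⟩
  rw [S.proj_add, hG']

theorem Diagram.exists_walk (d : Diagram S) (hS : S.Covered) {j : Fin S.m} {x : ℝ} {y : I}
    (h : S.proj x = d.strand j y) (y' : I) : ∃ x', Walk d y x y' x' := by
  obtain ⟨G, hG, hy, hs⟩ := d.exists_lift hS j h
  exact ⟨G y', G, hG.continuousOn, hy, rfl, fun z _ => ⟨j, hs z⟩⟩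

theorem Walk.target {d : Diagram S} {y y' : I} {x x' : ℝ} (h : Walk d y x y' x') (hy : y ≤ y') :
    ∃ j, S.proj x' = d.strand j y' := by
  obtain ⟨P, hP, hP0, hP1, hPs⟩ := h
  simpa only [hP1] using hPs y' ⟨hy, le_rfl⟩

/-- The abscissas on the right of an upper endpoint which one can reach from `x`. -/
def Drop (d : Diagram S) (x : ℝ) : Set ℝ := {e | ∃ e' ≤ e, Walk d 0 x 1 e'}

/-- A walk from `x` can be replaced by its minimum with any walk from `x'`, which starts at `x'` and
ends no further to the right. -/
theorem drop_subset_of_le (d : Diagram S) (hS : S.Covered) {x x' : ℝ} (h : x' ≤ x)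
    {j : Fin S.m} (hx' : S.proj x' = S.pt j) : Drop d x ⊆ Drop d x' := by
  rintro e ⟨e', he, hw⟩
  obtain ⟨u, hu⟩ := d.exists_walk hS (hx'.trans (d.strand j).source.symm) 1
  refine ⟨min u e', (min_le_right _ _).trans he, ?_⟩
  have := hu.min hw
  rwa [min_eq_left h] at this

/-- Walks in a product are cut, or glued, at the height `1 / 2`. -/
theorem mem_drop_comp (d d' : Diagram S) (x e : ℝ) :
    e ∈ Drop (d.comp d') x ↔ ∃ z, Walk d' 0 x 1 z ∧ e ∈ Drop d z := by
  have v0 : ∀ z : I, ((halfLow z : I) : ℝ) ≤ 1 / 2 := fun z => by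
    change (z : ℝ) / 2 ≤ 1 / 2
    linarith [z.2.2]
  have v1 : ∀ z : I, 1 / 2 ≤ ((halfHigh z : I) : ℝ) := fun z => by
    change 1 / 2 ≤ ((z : ℝ) + 1) / 2
    linarith [z.2.1]
  have d0 : ∀ z : I, dbl (halfLow z) = z := fun z => Subtype.ext (by
    rw [dbl_val (v0 z)]; change 2 * ((z : ℝ) / 2) = z; ring)
  have d1 : ∀ z : I, dblSub (halfHigh z) = z := fun z => Subtype.ext (by
    rw [dblSub_val (v1 z)]; change 2 * (((z : ℝ) + 1) / 2) - 1 = z; ring)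
  have c0 : Continuous halfLow := by unfold halfLow; fun_prop
  have c1 : Continuous halfHigh := by unfold halfHigh; fun_prop
  have e0 : halfLow 0 = 0 := Subtype.ext (by simp [halfLow])
  have e1 : halfHigh 1 = 1 := Subtype.ext (by simp [halfHigh])
  have e01 : halfHigh 0 = halfLow 1 := Subtype.ext (by simp [halfLow, halfHigh])
  have I01 : Icc (0 : I) 1 = univ := eq_univ_of_forall fun z => ⟨z.2.1, z.2.2⟩
  constructor
  · rintro ⟨e', he, P, hP, hP0, hP1, hPs⟩
    rw [I01, continuousOn_univ] at hP
    refine ⟨P (halfLow 1), ⟨P ∘ halfLow, (hP.comp c0).continuousOn, ?_, rfl, fun z _ => ?_⟩,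
      e', he, P ∘ halfHigh, (hP.comp c1).continuousOn, ?_, ?_, fun z _ => ?_⟩
    · rw [Function.comp_apply, e0, hP0]
    · obtain ⟨j, hj⟩ := hPs (halfLow z) (I01 ▸ mem_univ _)
      exact ⟨j, by rw [Function.comp_apply, hj, comp_low _ _ _ (v0 z), d0]⟩
    · rw [Function.comp_apply, e01]
    · rw [Function.comp_apply, e1, hP1]
    · obtain ⟨j, hj⟩ := hPs (halfHigh z) (I01 ▸ mem_univ _)
      exact ⟨_, by rw [Function.comp_apply, hj, comp_high _ _ _ (v1 z), d1]⟩
  · rintro ⟨z, ⟨P, hP, hP0, hP1, hPs⟩, e', he, Q, hQ, hQ0, hQ1, hQs⟩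
    rw [I01, continuousOn_univ] at hP hQ
    have vh : ((halfLow 1 : I) : ℝ) = 1 / 2 := by simp [halfLow]
    have x1 : dbl (halfLow 1) = 1 := d0 1
    have x2 : dblSub (halfLow 1) = 0 := by rw [← e01, d1]
    refine ⟨e', he, Walk.trans (y' := halfLow 1) (x' := z)
      ⟨P ∘ dbl, (hP.comp continuous_dbl).continuousOn, ?_, ?_, fun y hy => ?_⟩
      ⟨Q ∘ dblSub, (hQ.comp continuous_dblSub).continuousOn, ?_, ?_, fun y hy => ?_⟩
      (halfLow 1).2.1 (halfLow 1).2.2⟩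
    · rw [Function.comp_apply, ← e0, d0, hP0]
    · rw [Function.comp_apply, x1, hP1]
    · obtain ⟨j, hj⟩ := hPs (dbl y) (I01 ▸ mem_univ _)
      have h2 : (y : ℝ) ≤ 1 / 2 := by rw [← vh]; exact hy.2
      exact ⟨j, by rw [Function.comp_apply, hj, comp_low _ _ _ h2]⟩
    · rw [Function.comp_apply, x2, hQ0]
    · rw [Function.comp_apply, ← e1, d1, hQ1]
    · obtain ⟨j, hj⟩ := hQs (dblSub y) (I01 ▸ mem_univ _)
      have h2 : 1 / 2 ≤ (y : ℝ) := by rw [← vh]; exact hy.1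
      -- Strands of a product are numbered by their lower endpoints, those of the upper factor by
      -- the middle level.
      refine ⟨d'.perm.symm j, ?_⟩
      rw [Function.comp_apply, hj, comp_high _ _ _ h2, Equiv.apply_symm_apply]

/-- The middle point of a walk may change when the lower factor is replaced, but only to the left,
which is harmless for the upper factor by monotonicity. -/
theorem drop_comp_subset (hS : S.Covered) {d d' e e' : Diagram S} (h : Drop d = Drop e)
    (h' : Drop d' = Drop e') : Drop (d.comp d') ≤ Drop (e.comp e') := by
  intro x u hu
  obtain ⟨z, hz, hu⟩ := (mem_drop_comp _ _ _ _).1 hu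
  have : z ∈ Drop e' x := h' ▸ (⟨z, le_rfl, hz⟩ : z ∈ Drop d' x)
  obtain ⟨z', hz', hw⟩ := this
  obtain ⟨j, hj⟩ := hw.target zero_le_one
  rw [Path.target] at hj
  exact (mem_drop_comp _ _ _ _).2 ⟨z', hw, drop_subset_of_le e hS hz' hj (h ▸ hu)⟩

theorem drop_comp_congr (hS : S.Covered) {d d' e e' : Diagram S} (h : Drop d = Drop e)
    (h' : Drop d' = Drop e') : Drop (d.comp d') = Drop (e.comp e') :=
  le_antisymm (drop_comp_subset hS h h') (drop_comp_subset hS h.symm h'.symm)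

end

/-! ### Local moves and walks -/

section

variable {k : ℕ} {F : Fin k → I → ℝ} {a b : I}

/-- There is a walk along the arcs `F`, starting with the arc `c`, which from the height `z` on
stays weakly on the left of the arcs of `A`. -/
def Undercuts (F : Fin k → I → ℝ) (a b : I) (c : Fin k) (z : I) (A : Set (Fin k)) : Prop :=
  ∃ R : I → ℝ, ContinuousOn R (Icc a b) ∧ R a = F c a ∧ (∀ y ∈ Icc a b, ∃ c', R y = F c' y) ∧
    ∀ c' ∈ A, ∀ y ∈ Icc z b, R y ≤ F c' y

theorem undercuts_self (hF : ∀ c, ContinuousOn (F c) (Icc a b)) (c : Fin k) :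
    Undercuts F a b c a {c} :=
  ⟨F c, hF c, rfl, fun _ _ => ⟨c, rfl⟩, by rintro _ rfl _ _; exact le_rfl⟩

/-- From `z'` on, the walk is replaced by its minimum with the arc `j`. This is continuous because
at `z'` the walk is on the left of `i`, and hence of `j`. -/
theorem Undercuts.insert {c i j : Fin k} {z z' : I} {A : Set (Fin k)} (h : Undercuts F a b c z A)
    (hF : ∀ c, ContinuousOn (F c) (Icc a b)) (hz : z ≤ z') (hz' : z' ∈ Icc a b) (hi : i ∈ A)
    (hij : F i z' ≤ F j z') : Undercuts F a b c z' (insert j A) := by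
  obtain ⟨R, hR, hRa, hRs, hRA⟩ := h
  have h0 : R z' ≤ F j z' := (hRA i hi z' ⟨hz, hz'.2⟩).trans hij
  have hle : ∀ y, (if y ≤ z' then R y else min (R y) (F j y)) ≤ R y := by
    intro y
    split_ifs
    · exact le_rfl
    · exact min_le_left _ _
  refine ⟨fun y => if y ≤ z' then R y else min (R y) (F j y),
    continuousOn_glue hz'.1 hz'.2 (hR.mono (Icc_subset_Icc_right hz'.2))
      (ContinuousOn.inf (hR.mono (Icc_subset_Icc_left hz'.1))
        ((hF j).mono (Icc_subset_Icc_left hz'.1))) (min_eq_left h0).symm, ?_, fun y hy => ?_, ?_⟩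
  · exact (if_pos hz'.1).trans hRa
  · dsimp only
    split_ifs
    · exact hRs y hy
    · rcases min_choice (R y) (F j y) with e | e
      · rw [e]; exact hRs y hy
      · exact ⟨j, e⟩
  · rintro c' (rfl | hc') y hy
    · dsimp only
      rcases hy.1.lt_or_eq with h | h
      · rw [if_neg (not_le.2 h)]
        exact min_le_right _ _
      · rw [← h, if_pos le_rfl]
        exact h0
    · exact (hle y).trans (hRA c' hc' y ⟨hz.trans hy.1, hy.2⟩)

/-- The arc `0` starts leftmost. From the arc `1` one reaches `0` at `t`, and `0` meets `2` at `t'`.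
From the arc `2` one reaches `0` at `t'`, while `2` itself meets `1` at `t''`. -/
theorem undercuts_of_braid {F : Fin 3 → I → ℝ} (hF : ∀ c, ContinuousOn (F c) (Icc a b))
    (hab : a ≤ b) (hmono : StrictMono fun c => F c a) {t t' t'' : I} (ht : t ∈ Icc a b)
    (ht' : t' ∈ Icc a b) (ht'' : t'' ∈ Icc a b) (h : t ≤ t') (h' : t' ≤ t'') (e : F 0 t = F 1 t)
    (e' : F 0 t' = F 2 t') (e'' : F 1 t'' = F 2 t'') (c : Fin 3) :
    ∃ z ∈ Icc a b, ∃ A : Set (Fin 3), (∀ c', c' ∈ A) ∧ Undercuts F a b c z A := by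
  have ha : a ∈ Icc a b := ⟨le_rfl, hab⟩
  have h0 := undercuts_self hF c
  fin_cases c
  · exact ⟨a, ha, _, by decide, (h0.insert (j := 1) hF le_rfl ha rfl
      (hmono.monotone (by decide))).insert (i := 0) (j := 2) hF le_rfl ha (by decide)
      (hmono.monotone (by decide))⟩
  · exact ⟨t', ht', _, by decide, (h0.insert (j := 0) hF ht.1 ht rfl e.ge).insert (i := 0)
      (j := 2) hF h ht' (by decide) e'.le⟩
  · exact ⟨t'', ht'', _, by decide, (h0.insert (j := 0) hF ht'.1 ht' rfl e'.ge).insert (i := 2)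
      (j := 1) hF h' ht'' (by decide) e''.ge⟩

/-- The arc `1` starts on the left of `2`, and `2` meets `0` at `t'`. The arc `2` meets `1` at `t`
and `0` at `t'`. No meeting of `0` and `1` is needed, so the lemma also serves for the picture with
a third crossing. -/
theorem undercuts_of_kiselman {F : Fin 3 → I → ℝ} (hF : ∀ c, ContinuousOn (F c) (Icc a b))
    (hab : a ≤ b) (hmono : StrictMono fun c => F c a) {t t' : I} (ht : t ∈ Icc a b)
    (ht' : t' ∈ Icc a b) (h : t ≤ t') (e : F 1 t = F 2 t) (e' : F 0 t' = F 2 t') (c : Fin 3) :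
    ∃ z ∈ Icc a b, ∃ A : Set (Fin 3), (∀ c', c' ∈ A) ∧ Undercuts F a b c z A := by
  have ha : a ∈ Icc a b := ⟨le_rfl, hab⟩
  have h0 := undercuts_self hF c
  fin_cases c
  · exact ⟨a, ha, _, by decide, (h0.insert (j := 1) hF le_rfl ha rfl
      (hmono.monotone (by decide))).insert (i := 0) (j := 2) hF le_rfl ha (by decide)
      (hmono.monotone (by decide))⟩
  · exact ⟨t', ht', _, by decide, (h0.insert (j := 2) hF le_rfl ha rfl
      (hmono.monotone (by decide))).insert (i := 2) (j := 0) hF ht'.1 ht' (by decide) e'.ge⟩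
  · exact ⟨t', ht', _, by decide, (h0.insert (j := 1) hF ht.1 ht rfl e.ge).insert (i := 2)
      (j := 0) hF h ht' (by decide) e'.ge⟩

/-- The property common to all the pictures: from every entrance there is a walk to the leftmost
exit. This is why a move cannot change the invariant. -/
theorem MovePictures.exists_walk {w w' v : List (Fin k × Fin k)} (hw : MovePictures k w w')
    (hv : v = w ∨ v = w') (hF : ∀ c, ContinuousOn (F c) (Icc a b)) (hab : a ≤ b)
    (hmono : StrictMono fun c => F c a) {h : Fin v.length → I} (hh : StrictMono h)
    (hI : ∀ q, h q ∈ Ioo a b) (hq : ∀ q, F (v.get q).1 (h q) = F (v.get q).2 (h q)) (c : Fin k) :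
    ∃ R : I → ℝ, ContinuousOn R (Icc a b) ∧ R a = F c a ∧ (∀ y ∈ Icc a b, ∃ c', R y = F c' y) ∧
      ∀ c', R b ≤ F c' b := by
  suffices H : ∃ z ∈ Icc a b, ∃ A : Set (Fin k), (∀ c', c' ∈ A) ∧ Undercuts F a b c z A by
    obtain ⟨z, hz, A, hA, R, h1, h2, h3, h4⟩ := H
    exact ⟨R, h1, h2, h3, fun c' => h4 c' (hA c') b ⟨hz.2, le_rfl⟩⟩
  have hI' : ∀ q, h q ∈ Icc a b := fun q => Ioo_subset_Icc_self (hI q)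
  have ha : a ∈ Icc a b := ⟨le_rfl, hab⟩
  have h0 := undercuts_self hF c
  cases hw with
  | two =>
    have hv0 : ∃ q, F 0 (h q) = F 1 (h q) := by
      rcases hv with rfl | rfl <;> exact ⟨⟨0, by simp⟩, hq ⟨0, by simp⟩⟩
    obtain ⟨q, e⟩ := hv0
    fin_cases c
    · exact ⟨a, ha, _, by decide, h0.insert (j := 1) hF le_rfl ha rfl (hmono.monotone (by decide))⟩
    · exact ⟨_, hI' q, _, by decide, h0.insert (j := 0) hF (hI' q).1 (hI' q) rfl e.ge⟩
  | three =>
    have A := fun q q' q'' (l : q ≤ q') (l' : q' ≤ q'') e e' e'' => undercuts_of_braid hF hab hmono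
      (hI' q) (hI' q') (hI' q'') (hh.monotone l) (hh.monotone l') e e' e'' c
    have B := fun q q' (l : q ≤ q') e e' => undercuts_of_kiselman hF hab hmono (hI' q) (hI' q')
      (hh.monotone l) e e' c
    rcases hv with rfl | rfl
    · exact A ⟨0, by simp⟩ ⟨1, by simp⟩ ⟨2, by simp⟩ (by simp) (by simp) (hq ⟨0, by simp⟩)
        (hq ⟨1, by simp⟩) (hq ⟨2, by simp⟩)
    -- The last crossing of this picture is superfluous: its first two are those of the Kiselman
    -- picture.
    · exact B ⟨0, by simp⟩ ⟨1, by simp⟩ (by simp) (hq ⟨0, by simp⟩) (hq ⟨1, by simp⟩)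
  | kiselman =>
    have B := fun q q' (l : q ≤ q') e e' => undercuts_of_kiselman hF hab hmono (hI' q) (hI' q')
      (hh.monotone l) e e' c
    rcases hv with rfl | rfl
    · exact B ⟨0, by simp⟩ ⟨1, by simp⟩ (by simp) (hq ⟨0, by simp⟩) (hq ⟨1, by simp⟩)
    · exact B ⟨0, by simp⟩ ⟨1, by simp⟩ (by simp) (hq ⟨0, by simp⟩) (hq ⟨1, by simp⟩)

end

theorem MovePictures.lt {k : ℕ} {w w' v : List (Fin k × Fin k)} (hw : MovePictures k w w')
    (hv : v = w ∨ v = w') : ∀ x ∈ v, x.1 < x.2 := by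
  cases hw <;> rcases hv with rfl | rfl <;> decide

/-! ### Invariance of `Drop` under local moves -/

section

variable {S : Strip}

/-- A walk of `d` that avoids the box survives in `d'`. One that enters it stays inside up to the
top; in `d'` it is rerouted to the leftmost exit and then continued by the minimum of a strand and
the old walk. -/
theorem drop_subset_of_box {d d' : Diagram S} (hS : S.Covered) {k : ℕ} {v w w' : List (Fin k × Fin k)}
    {u : List (Fin k × Fin k)} (hw : MovePictures k w w') (hv : v = w ∨ v = w') {l r : ℝ} {a b : I}
    {s : Fin k ↪ Fin S.m} {τ : Equiv.Perm (Fin k)} (hab : a < b) (hinj : InjOn S.proj (Icc l r))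
    (hd : BoxPicture d l r a b s u) (hd' : BoxPicture d' l r a b s v)
    (hout : ∀ i, i ∉ range s → ∀ y, d'.strand i y = d.strand i y)
    (hlow : ∀ i, ∀ y ≤ a, d'.strand i y = d.strand i y)
    (hhigh : ∀ c, ∀ y, b ≤ y → d'.strand (s c) y = d.strand (s (τ c)) y) :
    Drop d ≤ Drop d' := by
  rintro x e ⟨e', he, P, hP, hP0, hP1, hPs⟩
  obtain ⟨hbox, F, hF, hFs, -, -⟩ := hd
  obtain ⟨-, F', hF', hFs', hmono, h, hh, hhI, hcr⟩ := hd'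
  have hsub : Icc a b ⊆ Icc 0 1 := Icc_subset_Icc a.2.1 b.2.2
  have hae : a ∈ Icc a b := ⟨le_rfl, hab.le⟩
  have hbe : b ∈ Icc a b := ⟨hab.le, le_rfl⟩
  have hhigh' : ∀ i, ∀ y, b ≤ y → ∃ j, d'.strand j y = d.strand i y := by
    intro i y hy
    by_cases hi : i ∈ range s
    · obtain ⟨c, rfl⟩ := hi
      exact ⟨s (τ.symm c), by rw [hhigh _ _ hy, Equiv.apply_symm_apply]⟩
    · exact ⟨i, hout i hi y⟩
  -- a walk which meets the box follows one of its arcs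
  have harc : ∀ y ∈ Icc a b, ∀ q : ℤ, P y - q * S.p ∈ Icc l r →
      ∃ c, P y - q * S.p = F c y := by
    intro y hy q hq
    obtain ⟨j, hj⟩ := hPs y (hsub hy)
    have hpq : S.proj (P y - q * S.p) = d.strand j y := by
      rw [← hj, ← S.proj_add (P y - q * S.p) q]
      congr 1
      ring
    by_cases hjs : j ∈ range s
    · obtain ⟨c, rfl⟩ := hjs
      exact ⟨c, hinj hq (Ioo_subset_Icc_self (hFs c y hy).1) (hpq.trans (hFs c y hy).2.symm)⟩
    · exact absurd ⟨_, hq, hpq⟩ (hbox j hjs y hy)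
  -- Arcs avoid the vertical sides of the box, so by the intermediate value theorem a walk cannot go
  -- through them.
  have hstay : ∀ q : ℤ, ∀ y ∈ Icc a b, ∀ y' ∈ Icc a b, P y - q * S.p ∈ Icc l r →
      P y' - q * S.p ∈ Icc l r := by
    intro q y hy y' hy' hq
    have hpre : ((fun z => P z - q * S.p) '' Icc a b).OrdConnected :=
      (isPreconnected_Icc.image _ ((hP.mono hsub).sub continuousOn_const)).ordConnected
    have hne : ∀ z ∈ Icc a b, P z - q * S.p ≠ l ∧ P z - q * S.p ≠ r := by
      intro z hz
      by_contra hcon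
      have hz' : P z - q * S.p ∈ Icc l r := by
        have hlr : l ≤ r := hq.1.trans hq.2
        rw [not_and_or, not_not, not_not] at hcon
        rcases hcon with h1 | h1 <;> rw [h1]
        · exact ⟨le_rfl, hlr⟩
        · exact ⟨hlr, le_rfl⟩
      obtain ⟨c, hc⟩ := harc z hz q hz'
      have := (hFs c z hz).1
      rw [← hc] at this
      exact hcon ⟨this.1.ne', this.2.ne⟩
    by_contra hcon
    rw [mem_Icc, not_and_or, not_le, not_le] at hcon
    rcases hcon with h1 | h1
    · obtain ⟨z, hz, hz'⟩ := hpre.out ⟨y', hy', rfl⟩ ⟨y, hy, rfl⟩ ⟨h1.le, hq.1⟩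
      exact (hne z hz).1 hz'
    · obtain ⟨z, hz, hz'⟩ := hpre.out ⟨y, hy, rfl⟩ ⟨y', hy', rfl⟩ ⟨hq.2, h1.le⟩
      exact (hne z hz).2 hz'
  have hlowW : Walk d' 0 x a (P a) := by
    refine ⟨P, hP.mono (Icc_subset_Icc_right a.2.2), hP0, rfl, fun z hz => ?_⟩
    obtain ⟨j, hj⟩ := hPs z ⟨hz.1, hz.2.trans a.2.2⟩
    exact ⟨j, by rw [hj, hlow j z hz.2]⟩
  have hhighW : Walk d' b (P b) 1 e' := by
    refine ⟨P, hP.mono (Icc_subset_Icc_left b.2.1), rfl, hP1, fun z hz => ?_⟩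
    obtain ⟨j, hj⟩ := hPs z ⟨b.2.1.trans hz.1, hz.2⟩
    obtain ⟨j', hj'⟩ := hhigh' j z hz.1
    exact ⟨j', by rw [hj, hj']⟩
  -- The integer `q` selects the translate of the box, on the line, in which the lifted walk lies.
  by_cases hin : ∃ q : ℤ, P a - q * S.p ∈ Icc l r
  · obtain ⟨q, hq⟩ := hin
    obtain ⟨c, hc⟩ := harc a hae q hq
    obtain ⟨c2, hc2⟩ := harc b hbe q (hstay q a hae b hbe hq)
    have hFa : F' c a = F c a := hinj (Ioo_subset_Icc_self (hFs' c a hae).1)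
      (Ioo_subset_Icc_self (hFs c a hae).1)
      (by rw [(hFs' c a hae).2, (hFs c a hae).2, hlow _ _ le_rfl])
    have hFb : F' (τ.symm c2) b = F c2 b := hinj (Ioo_subset_Icc_self (hFs' _ b hbe).1)
      (Ioo_subset_Icc_self (hFs c2 b hbe).1)
      (by rw [(hFs' _ b hbe).2, (hFs c2 b hbe).2, hhigh _ _ le_rfl, Equiv.apply_symm_apply])
    have hq' : ∀ q', F' (v.get q').1 (h q') = F' (v.get q').2 (h q') := fun q' =>
      (hcr _ _ (hw.lt hv _ (v.get_mem q')) _ (Ioo_subset_Icc_self (hhI q'))).2 ⟨q', rfl, rfl⟩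
    obtain ⟨R, hR, hRa, hRs, hRb⟩ := hw.exists_walk hv hF' hab.le hmono hh hhI hq' c
    have hRW : Walk d' a (P a) b (R b + q * S.p) := by
      refine ⟨fun z => R z + q * S.p, hR.add continuousOn_const, ?_, rfl, fun z hz => ?_⟩
      · simp only [hRa, hFa, ← hc]; ring
      · obtain ⟨c', hc'⟩ := hRs z hz
        exact ⟨s c', by rw [S.proj_add, hc', (hFs' c' z hz).2]⟩
    -- At the top of the box the old walk sits on an arc of `d`, which has the same exit as the arc
    -- `τ.symm c2` of `d'`; the new walk is on the left of all exits.
    have hle : R b + q * S.p ≤ P b := by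
      have := hRb (τ.symm c2)
      rw [hFb] at this
      linarith
    obtain ⟨j, hj⟩ := hRW.target hab.le
    obtain ⟨e'', hW⟩ := d'.exists_walk hS hj 1
    have hW' := hW.min hhighW
    rw [min_eq_left hle] at hW'
    exact ⟨_, (min_le_right _ _).trans he, (hlowW.trans hRW a.2.1 hab.le).trans hW' b.2.1 b.2.2⟩
  · have hmid : Walk d' a (P a) b (P b) := by
      refine ⟨P, hP.mono hsub, rfl, rfl, fun z hz => ?_⟩
      obtain ⟨j, hj⟩ := hPs z (hsub hz)
      by_cases hjs : j ∈ range s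
      · obtain ⟨c, rfl⟩ := hjs
        obtain ⟨q, hq⟩ := S.exists_eq_add (hj.trans (hFs c z hz).2.symm)
        -- Being on an arc of the box at some height would place the walk in the box at its bottom
        -- as well.
        refine absurd ⟨q, hstay q z hz a hae ?_⟩ hin
        rw [hq, add_sub_cancel_right]
        exact Ioo_subset_Icc_self (hFs c z hz).1
      · exact ⟨j, by rw [hj, hout j hjs]⟩
    exact ⟨e', he, (hlowW.trans hmid a.2.1 hab.le).trans hhighW b.2.1 b.2.2⟩

theorem LocalMove.drop_eq (hS : S.Covered) {d d' : Diagram S} (h : LocalMove d d') :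
    Drop d = Drop d' := by
  obtain ⟨k, w, w', hw, l, r, a, b, s, τ, -, hab, hinj, hd, hd', hout, hlow, hhigh⟩ := h
  refine le_antisymm (drop_subset_of_box hS hw (.inr rfl) hab hinj hd hd' hout hlow hhigh)
    (drop_subset_of_box (τ := τ.symm) hS hw (.inl rfl) hab hinj hd' hd
      (fun i hi y => (hout i hi y).symm) (fun i y hy => (hlow i y hy).symm) fun c y hy => ?_)
  rw [hhigh _ _ hy, Equiv.apply_symm_apply]

end

/-! ### Isotopies and walks -/

/-- The index of the closed set that contains a point is a continuous function to a finite discrete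
space, hence constant on a preconnected set. -/
theorem mem_of_finite_closed_cover {α A : Type} [TopologicalSpace α] [Finite A] {s : Set α}
    (hs : IsPreconnected s) (C : A → Set α) (hC : ∀ a, IsClosed (C a))
    (hcov : ∀ x ∈ s, ∃ a, x ∈ C a) (hdisj : ∀ x ∈ s, ∀ a b, x ∈ C a → x ∈ C b → a = b)
    {a : A} {x y : α} (hx : x ∈ s) (hxa : x ∈ C a) (hy : y ∈ s) : y ∈ C a := by
  let : TopologicalSpace A := ⊥
  have : DiscreteTopology A := ⟨rfl⟩
  choose f hf using fun x : s => hcov x x.2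
  have hfc : Continuous f := by
    refine continuous_iff_isClosed.2 fun B _ => ?_
    have : f ⁻¹' B = ⋃ b ∈ B, ((↑) : s → α) ⁻¹' C b := by
      ext z
      simp only [mem_preimage, mem_iUnion, exists_prop]
      exact ⟨fun h => ⟨_, h, hf z⟩, fun ⟨b, hb, hz⟩ => hdisj z z.2 _ _ hz (hf z) ▸ hb⟩
    rw [this]
    exact B.toFinite.isClosed_biUnion fun b _ => (hC b).preimage continuous_subtype_val
  have := isPreconnected_iff_preconnectedSpace.1 hs
  have h1 : f ⟨x, hx⟩ = f ⟨y, hy⟩ := PreconnectedSpace.constant inferInstance hfc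
  have h2 : f ⟨x, hx⟩ = a := hdisj x hx _ _ (hf ⟨x, hx⟩) hxa
  rw [← h2, h1]
  exact hf ⟨y, hy⟩

theorem lt_of_continuousOn_ne {α : Type} [TopologicalSpace α] {s : Set α} (hs : IsPreconnected s)
    {f g : α → ℝ} (hf : ContinuousOn f s) (hg : ContinuousOn g s) (hne : ∀ x ∈ s, f x ≠ g x)
    {x y : α} (hx : x ∈ s) (hy : y ∈ s) (hlt : f x < g x) : f y < g y := by
  by_contra hcon
  obtain ⟨z, hz, he⟩ := hs.intermediate_value₂ hx hy hf hg hlt.le (not_lt.1 hcon)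
  exact hne z hz he

/-- The image is preconnected and contained in a countable set of reals, which is totally
disconnected. -/
theorem eq_of_continuousOn_lattice {α : Type} [TopologicalSpace α] {s : Set α}
    (hs : IsPreconnected s) {f : α → ℝ} (hf : ContinuousOn f s) {p : ℕ}
    (h : ∀ x ∈ s, ∃ k : ℤ, f x = k * p) {x y : α} (hx : x ∈ s) (hy : y ∈ s) : f x = f y := by
  refine (countable_range fun k : ℤ => (k * p : ℝ)).isTotallyDisconnected (f '' s) ?_
    (hs.image f hf) ⟨x, hx, rfl⟩ ⟨y, hy, rfl⟩
  rintro _ ⟨z, hz, rfl⟩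
  obtain ⟨k, hk⟩ := h z hz
  exact ⟨k, hk.symm⟩

/-- Real induction: the infimum of the bad heights is good by `left`, and `right` then pushes the
bad heights away from it. -/
theorem unitInterval_induction {good : I → Prop} (left : ∀ y, (∀ z < y, good z) → good y)
    (right : ∀ y < 1, good y → ∃ δ > y, ∀ z, y < z → z < δ → good z) (y : I) : good y := by
  by_contra hy
  set B := {z | ¬ good z} with hB
  have hne : B.Nonempty := ⟨y, hy⟩
  have hβ : good (sInf B) := left _ fun z hz => by
    by_contra h
    exact absurd (csInf_le (OrderBot.bddBelow B) h) (not_le.2 hz)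
  have h1 : sInf B < 1 := by
    refine lt_of_le_of_ne (sInf B).2.2 fun h => hy ?_
    have : sInf B ≤ y := csInf_le (OrderBot.bddBelow B) hy
    rw [← le_antisymm this (h ▸ y.2.2)]
    exact hβ
  obtain ⟨δ, hδ, hgood⟩ := right _ h1 hβ
  obtain ⟨z, hz, hzδ⟩ := (csInf_lt_iff (OrderBot.bddBelow B) hne).1 hδ
  have hle : sInf B ≤ z := csInf_le (OrderBot.bddBelow B) hz
  rcases hle.lt_or_eq with h | h
  · exact hz (hgood z h hzδ)
  · exact hz (h ▸ hβ)

/-! ### Transport of walks along an isotopy -/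

section

variable {S : Strip}

/-- The heights of the double points. -/
def Diagram.heights (d : Diagram S) : Set I :=
  {y | ∃ i j, i ≠ j ∧ d.strand i y = d.strand j y}

theorem Diagram.finite_heights (d : Diagram S) : d.heights.Finite := by
  have : d.heights = ⋃ (i) (j) (_ : i ≠ j), {y | d.strand i y = d.strand j y} := by
    ext y
    simp [Diagram.heights]
  rw [this]
  exact finite_iUnion fun i => finite_iUnion fun j => finite_iUnion fun h => d.finite_double i j h

/-- Between heights of double points the strands are disjoint closed sets, so a walk stays on one of
them; the ends of the interval follow by closure. -/
theorem Diagram.strand_of_walk (d : Diagram S) (hS : S.Covered) {P : I → ℝ} (hP : Continuous P)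
    (hPs : ∀ y, ∃ j, S.proj (P y) = d.strand j y) {l r : I} (hfree : ∀ z ∈ Ioo l r, z ∉ d.heights)
    {z : I} (hz : z ∈ Ioo l r) {j : Fin S.m} (hj : S.proj (P z) = d.strand j z) :
    ∀ u ∈ Icc l r, S.proj (P u) = d.strand j u := by
  have := hS.t2
  have hC : ∀ i, IsClosed {u | S.proj (P u) = d.strand i u} := fun i =>
    isClosed_eq (S.continuous_proj.comp hP) (d.strand i).continuous
  have h : Ioo l r ⊆ {u | S.proj (P u) = d.strand j u} := fun u hu =>
    mem_of_finite_closed_cover isPreconnected_Ioo _ hC (fun x _ => hPs x)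
      (fun x hx a b ha hb => by
        by_contra hab
        exact hfree x hx ⟨a, b, hab, ha.symm.trans hb⟩) hz hj hu
  intro u hu
  have := closure_minimal h (hC j)
  rw [closure_Ioo (hz.1.trans hz.2).ne] at this
  exact this hu

theorem exists_free_left {F : Set I} (hF : F.Finite) {y : I} (hy : 0 < y) :
    ∃ l < y, ∀ z ∈ Ioo l y, z ∉ F := by
  have : (F \ {y})ᶜ ∈ 𝓝 y := (hF.subset sdiff_subset).isClosed.isOpen_compl.mem_nhds (by simp)
  obtain ⟨l, hl, h⟩ := exists_Ioc_subset_of_mem_nhds this ⟨0, hy⟩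
  exact ⟨l, hl, fun z hz hzF => h ⟨hz.1, hz.2.le⟩ ⟨hzF, hz.2.ne⟩⟩

theorem exists_free_right {F : Set I} (hF : F.Finite) {y : I} (hy : y < 1) :
    ∃ r > y, ∀ z ∈ Ioo y r, z ∉ F := by
  have : (F \ {y})ᶜ ∈ 𝓝 y := (hF.subset sdiff_subset).isClosed.isOpen_compl.mem_nhds (by simp)
  obtain ⟨r, hr, h⟩ := exists_Ico_subset_of_mem_nhds this ⟨1, hy⟩
  exact ⟨r, hr, fun z hz hzF => h ⟨hz.1.le, hz.2⟩ ⟨hzF, hz.1.ne'⟩⟩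

/-- The itinerary of a walk (which strands, and at which double points it switches) makes sense all
along the isotopy. Double points move continuously, and successive switches keep their order since
tracks of double points cannot overtake one another. The end points of the walk do not move. -/
theorem Isotopic.walk (hS : S.Covered) {d d' : Diagram S} (h : Isotopic d d') {x e : ℝ}
    (hw : Walk d 0 x 1 e) : Walk d' 0 x 1 e := by
  obtain ⟨D, hp, hc, h0, h1, hh⟩ := h
  obtain ⟨P, hP, hP0, hP1, hPs⟩ := hw
  have I01 : Icc (0 : I) 1 = univ := eq_univ_of_forall fun z => ⟨z.2.1, z.2.2⟩
  rw [I01, continuousOn_univ] at hP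
  replace hPs : ∀ y, ∃ j, S.proj (P y) = (D 0).strand j y := fun y => by
    obtain ⟨j, hj⟩ := hPs y (I01 ▸ mem_univ y)
    exact ⟨j, hj.trans (h0 j y).symm⟩
  choose G hG0 hG using fun j => hS.lift ⟨_, hc j⟩ ((j : ℝ) + 1) ((D 0).strand j).source.symm
  replace hG : ∀ j t y, S.proj (G j (t, y)) = (D t).strand j y := fun j t y => hG j (t, y)
  -- two lifted curves moving over the same point stay at the same distance
  have hconst : ∀ f g : I → ℝ, Continuous f → Continuous g → (∀ t, S.proj (f t) = S.proj (g t)) →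
      ∀ t u, f t - g t = f u - g u := by
    intro f g hf hg hfg t u
    refine eq_of_continuousOn_lattice isPreconnected_univ (hf.sub hg).continuousOn
      (fun z _ => (S.proj_eq _ _).1 (hfg z)) (mem_univ _) (mem_univ _)
  let track : Fin S.m → Fin S.m → (I → I) → Prop := fun i j η =>
    ∀ t, (D t).strand i (η t) = (D t).strand j (η t)
  -- Each track of a double point of `i` and `j` is one of the finitely many functions describing
  -- these double points, and those have distinct values at every time.
  have htrack : ∀ i j, i ≠ j → ∀ η η', Continuous η → Continuous η' → track i j η →
      track i j η' → ∀ t, η t = η' t → ∀ u, η u = η' u := by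
    intro i j hij η η' hη hη' ht ht' t he u
    obtain ⟨A, hA, f, hf, hfr⟩ := hh i j hij
    have key : ∀ η, Continuous η → track i j η → ∃ a, η t = f a t ∧ ∀ u, η u = f a u := by
      intro η hη ht
      have hcov : ∀ u, ∃ a, η u = f a u := fun u => by
        have : η u ∈ range (fun a => f a u) := by rw [(hfr u).2]; exact ht u
        obtain ⟨a, ha⟩ := this
        exact ⟨a, ha.symm⟩
      obtain ⟨a, ha⟩ := hcov t
      refine ⟨a, ha, fun u => ?_⟩
      exact mem_of_finite_closed_cover isPreconnected_univ (fun a => {u | η u = f a u})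
        (fun a => isClosed_eq hη (hf a)) (fun u _ => hcov u)
        (fun u _ a b h1 h2 => (hfr u).1 (h1.symm.trans h2)) (mem_univ t) ha (mem_univ u)
    obtain ⟨a, ha, ha'⟩ := key η hη ht
    obtain ⟨b, hb, hb'⟩ := key η' hη' ht'
    obtain rfl : a = b := (hfr t).1 (ha.symm.trans (he.trans hb))
    rw [ha', hb']
  -- Inductive statement: the walk arrives on the strand `j` at height `y`, having last switched at
  -- the double point tracked by `η` (or never, with `η = 0`). At every time `t` there is a walk
  -- from `x` to the corresponding point of `j` at height `η t`. The integer `k` fixes the lift of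
  -- the strand.
  let T : Fin S.m → I → Prop := fun j y => ∃ η : I → I, Continuous η ∧ η 0 ≤ y ∧
    ((∀ t, η t = 0) ∨ ∃ i, j ≠ i ∧ track j i η) ∧
    ∀ k : ℤ, P y = G j (0, y) + k * S.p → ∀ t, Walk (D t) 0 x (η t) (G j (t, η t) + k * S.p)
  have follow : ∀ j t (k : ℤ) y y', Walk (D t) y (G j (t, y) + k * S.p) y' (G j (t, y') + k * S.p) :=
    fun j t k y y' => ⟨fun z => G j (t, z) + k * S.p, by fun_prop, rfl, rfl,
      fun z _ => ⟨j, by rw [S.proj_add, hG]⟩⟩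
  have extend : ∀ j z y, z ≤ y → (∀ u ∈ Icc z y, S.proj (P u) = (D 0).strand j u) → T j z →
      T j y := by
    rintro j z y hzy hu ⟨η, hη, hη0, hηt, hW⟩
    refine ⟨η, hη, hη0.trans hzy, hηt, fun k hk => hW k ?_⟩
    have := eq_of_continuousOn_lattice (p := S.p) (isPreconnected_Icc (a := z) (b := y))
      (f := fun u => P u - G j (0, u)) (by fun_prop)
      (fun u hu' => (S.proj_eq _ _).1 ((hu u hu').trans (hG j 0 u).symm))
      ⟨le_rfl, hzy⟩ ⟨hzy, le_rfl⟩
    linarith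
  have switch : ∀ i j y, i ≠ j → S.proj (P y) = (D 0).strand i y →
      S.proj (P y) = (D 0).strand j y → T i y → T j y := by
    rintro i j y hij hi hj ⟨η, hη, hη0, hηt, hW⟩
    obtain ⟨A, hA, f, hf, hfr⟩ := hh i j hij
    have : y ∈ range (fun a => f a 0) := by rw [(hfr 0).2]; exact hi.symm.trans hj
    obtain ⟨a, ha⟩ := this
    have htr : track i j (f a) := fun t => by
      have : f a t ∈ range (fun a => f a t) := ⟨a, rfl⟩
      rw [(hfr t).2] at this
      exact this
    refine ⟨f a, hf a, ha.le, .inr ⟨i, hij.symm, fun t => (htr t).symm⟩, fun k hk t => ?_⟩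
    -- The order holds at time `0`. If the two tracks meet, either they belong to the same pair of
    -- strands and coincide, or three strands meet there; if they never meet, the order persists by
    -- connectedness.
    have hle : η t ≤ f a t := by
      rcases hηt with h | ⟨j', hij', htj'⟩
      · rw [h]; exact (f a t).2.1
      · rw [← ha] at hη0
        by_cases hE : ∃ u, η u = f a u
        · obtain ⟨u, hu⟩ := hE
          by_cases hjj : j' = j
          · subst hjj
            exact (htrack i j' hij η (f a) hη (hf a) htj' htr u hu t).le
          · refine absurd ⟨(htr u).symm, ?_⟩
              ((D u).no_triple j i j' hij.symm hij' (Ne.symm hjj) (f a u))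
            rw [← hu]
            exact htj' u
        · push Not at hE
          have := lt_of_continuousOn_ne (isPreconnected_univ (α := I))
            (f := fun u => (η u : ℝ)) (g := fun u => (f a u : ℝ))
            (by fun_prop) (by have := hf a; fun_prop)
            (fun u _ h => hE u (Subtype.ext h)) (mem_univ 0) (mem_univ t)
            (lt_of_le_of_ne hη0 fun h => hE 0 (Subtype.ext h))
          exact this.le
    obtain ⟨k', hk'⟩ := S.exists_eq_add (hi.trans (hG i 0 y).symm)
    have hW' := (hW k' hk' t).trans (follow i t k' (η t) (f a t)) (η t).2.1 hle
    have := hconst (fun u => G i (u, f a u)) (fun u => G j (u, f a u))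
      (by have := hf a; fun_prop) (by have := hf a; fun_prop)
      (fun u => by rw [hG, hG]; exact htr u) t 0
    simp only [] at this ha
    rw [ha] at this
    have e1 : G j (t, f a t) + k * S.p = G i (t, f a t) + k' * S.p := by linarith
    rw [e1]
    exact hW'
  -- Just below any positive height the walk follows a single strand `i`, and a switch from `i` to
  -- `j` is needed only at the height itself. Just above any height it follows a strand on which it
  -- already was.
  have good : ∀ y, ∀ j, S.proj (P y) = (D 0).strand j y → T j y := by
    refine unitInterval_induction (fun y hy j hj => ?_) (fun y hy1 hy => ?_)
    · rcases y.2.1.lt_or_eq with hpos | hzero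
      · obtain ⟨l, hl, hfree⟩ := exists_free_left (D 0).finite_heights hpos
        obtain ⟨z, hz⟩ := exists_between hl
        obtain ⟨i, hi⟩ := hPs z
        have hs := (D 0).strand_of_walk hS hP hPs hfree hz hi
        have hTi := extend i z y hz.2.le (fun u hu => hs u ⟨hz.1.le.trans hu.1, hu.2⟩)
          (hy z hz.2 i hi)
        by_cases hij : i = j
        · exact hij ▸ hTi
        · exact switch i j y hij (hs y ⟨hl.le, le_rfl⟩) hj hTi
      · obtain rfl : y = 0 := Subtype.ext hzero.symm
        refine ⟨fun _ => 0, continuous_const, le_rfl, .inl fun _ => rfl, fun k hk t => ?_⟩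
        have := hconst (fun u => G j (u, 0)) (fun u => G j (0, 0)) (by fun_prop) (by fun_prop)
          (fun u => by rw [hG, hG, Path.source, Path.source]) t 0
        have e1 : G j (t, 0) + k * S.p = x := by
          rw [← hP0, hk]
          simp only [sub_self] at this
          linarith
        rw [e1, ← e1]
        exact follow j t k 0 0
    · obtain ⟨r, hr, hfree⟩ := exists_free_right (D 0).finite_heights hy1
      refine ⟨r, hr, fun z hz hzr j hj => ?_⟩
      have hs := (D 0).strand_of_walk hS hP hPs hfree ⟨hz, hzr⟩ hj
      exact extend j y z hz.le (fun u hu => hs u ⟨hu.1, hu.2.trans hzr.le⟩)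
        (hy j (hs y ⟨le_rfl, hr.le⟩))
  obtain ⟨j, hj⟩ := hPs 1
  obtain ⟨η, -, -, -, hW⟩ := good 1 j hj
  obtain ⟨k, hk⟩ := S.exists_eq_add (hj.trans (hG j 0 1).symm)
  have hend := (hW k hk 1).trans (follow j 1 k (η 1) 1) (η 1).2.1 (η 1).2.2
  -- The upper endpoint of the lifted strand is fixed during the isotopy, because its projection is.
  have := hconst (fun u => G j (u, 1)) (fun u => G j (0, 1)) (by fun_prop) (by fun_prop)
    (fun u => by rw [hG, hG, Path.target, Path.target, hp, hp]) 1 0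
  have e1 : G j (1, 1) + k * S.p = e := by
    rw [← hP1, hk]
    simp only [sub_self] at this
    linarith
  rw [e1] at hend
  obtain ⟨Q, hQ, hQ0, hQ1, hQs⟩ := hend
  refine ⟨Q, hQ, hQ0, hQ1, fun z hz => ?_⟩
  obtain ⟨i, hi⟩ := hQs z hz
  exact ⟨i, hi.trans (h1 i z)⟩

theorem Isotopic.symm {d d' : Diagram S} (h : Isotopic d d') : Isotopic d' d := by
  obtain ⟨D, hp, hc, h0, h1, hh⟩ := h
  have hpe : d'.perm = d.perm := by
    ext i
    have a1 := h1 i 1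
    rw [Path.target, Path.target] at a1
    rw [← pt_injective S a1, hp 1]
  refine ⟨fun t => D (unitInterval.symm t), fun t => by rw [hp, hpe], fun i => ?_, fun i y => ?_,
    fun i y => ?_, fun i j hij => ?_⟩
  · exact (hc i).comp ((unitInterval.continuous_symm.comp continuous_fst).prodMk continuous_snd)
  · have : ∀ t, t = 1 → (D t).strand i y = d'.strand i y := by rintro _ rfl; exact h1 i y
    exact this _ unitInterval.symm_zero
  · have : ∀ t, t = 0 → (D t).strand i y = d.strand i y := by rintro _ rfl; exact h0 i y
    exact this _ unitInterval.symm_one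
  · obtain ⟨A, hA, f, hf, hfr⟩ := hh i j hij
    exact ⟨A, hA, fun a t => f a (unitInterval.symm t),
      fun a => (hf a).comp unitInterval.continuous_symm, fun t => hfr _⟩

theorem Isotopic.drop_eq (hS : S.Covered) {d d' : Diagram S} (h : Isotopic d d') :
    Drop d = Drop d' := by
  ext x e
  exact ⟨fun ⟨e', he, hw⟩ => ⟨e', he, h.walk hS hw⟩, fun ⟨e', he, hw⟩ => ⟨e', he, h.symm.walk hS hw⟩⟩

end

/-! ### Walks in products of elementary diagrams -/

section

variable {S : Strip}

theorem Strip.proj_intCast_eq_iff (S : Strip) (z u : ℤ) :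
    S.proj (z : ℝ) = S.proj (u : ℝ) ↔ (z : ZMod S.p) = (u : ZMod S.p) := by
  rw [S.proj_eq, eq_comm (a := (z : ZMod S.p)), ZMod.intCast_eq_intCast_iff_dvd_sub]
  constructor
  · rintro ⟨k, hk⟩
    exact ⟨k, by rw [mul_comm]; exact_mod_cast hk⟩
  · rintro ⟨k, hk⟩
    exact ⟨k, by rw [mul_comm]; exact_mod_cast hk⟩

theorem Strip.pt_eq (S : Strip) (c : Fin S.m) : S.pt c = S.proj (((c : ℤ) + 1 : ℤ) : ℝ) := by
  simp [Strip.pt]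

/-- Only the two moving strands leave the lattice of marked points, and they stay between `i` and
`j`. So a walk can move left only from the upper right end of the crossing strands, that is,
starting from `j`; from `i` it may go right and come back at the crossing. -/
theorem drop_elem (S : Strip) {i j : Fin S.m} (hij : i ≠ j)
    (h : S.proj ((j : ℝ) + 1) = S.proj ((i : ℝ) + 2)) {z : ℤ} {c : Fin S.m}
    (hz : S.proj (z : ℝ) = S.pt c) :
    Drop (Diagram.elem S i j hij h) z = Ici (((if c = j then z - 1 else z : ℤ)) : ℝ) := by
  obtain ⟨q, hq⟩ := S.exists_eq_add h
  obtain ⟨k, hk⟩ := S.exists_eq_add hz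
  have hs : ∀ c' (y : I), (Diagram.elem S i j hij h).strand c' y = S.proj (elemLift i j c' y) :=
    fun _ _ => rfl
  apply subset_antisymm
  · rintro e ⟨e', he, hw⟩
    obtain ⟨c', hc'⟩ := hw.target zero_le_one
    rw [Path.target] at hc'
    obtain ⟨P, hP, hP0, hP1, hPs⟩ := hw
    generalize hz' : (if c = j then z - 1 else z) = z'
    -- The claimed exit `z'` is never over the marked point `j`: it is over `i` if the start is over
    -- `j`, and over the start otherwise.
    have hz'j : ∀ k : ℤ, (z' : ℝ) ≠ (j : ℝ) + 1 + k * S.p := by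
      intro k' hk'
      have e1 : S.proj z' = S.pt j := by rw [hk', S.proj_add, Strip.pt]
      rw [← hz'] at e1
      split_ifs at e1 with hcj
      · refine hij (pt_injective S (Eq.trans ?_ e1))
        rw [Strip.pt, S.proj_eq]
        subst hcj
        refine ⟨- q - k, ?_⟩
        push_cast
        linarith
      · exact hcj (pt_injective S (hz.symm.trans e1))
    have hz'z : z' ≤ z := by rw [← hz']; split_ifs <;> omega
    refine le_trans ?_ he
    by_contra hlt
    rw [not_le] at hlt
    obtain ⟨k2, hk2⟩ := S.exists_eq_add hc'
    have hle : e' ≤ z' - 1 := by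
      have e1 : e' = ((((Diagram.elem S i j hij h).perm c' : ℕ) : ℤ) + 1 + k2 * S.p : ℤ) := by
        rw [hk2]; push_cast; ring
      rw [e1] at hlt ⊢
      have := Int.le_sub_one_of_lt (Int.cast_lt.1 hlt)
      exact_mod_cast this
    have hzz : (z' : ℝ) ≤ z := by exact_mod_cast hz'z
    -- A walk ending further left would pass through the abscissa `z' - 1 / 4`. It is not an
    -- integer, so only strands `i` and `j` could be there, and only when `z'` is over `j`.
    obtain ⟨y, hy, hPy⟩ := isPreconnected_Icc.intermediate_value (s := Icc (0 : I) 1)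
      (a := 1) (b := 0) ⟨zero_le_one, le_rfl⟩ ⟨le_rfl, zero_le_one⟩ hP
      (show (z' : ℝ) - 1 / 4 ∈ Icc (P 1) (P 0) by rw [hP0, hP1]; constructor <;> linarith)
    obtain ⟨c'', hc''⟩ := hPs y hy
    rw [hPy, hs] at hc''
    obtain ⟨k3, hk3⟩ := S.exists_eq_add hc''
    have hy0 := y.2.1
    have hy1 := y.2.2
    have bound : ∀ N : ℤ, ((N : ℝ) < 2 → -1 < (N : ℝ) → N = 0 ∨ N = 1) := by
      intro N h1 h2
      have h1' : N < 2 := by exact_mod_cast h1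
      have h2' : -1 < N := by exact_mod_cast h2
      omega
    unfold elemLift at hk3
    split_ifs at hk3 with h1 h2
    · have e1 : (((z' - i - 1 - k3 * S.p : ℤ)) : ℝ) = y + 1 / 4 := by push_cast; linarith
      rcases bound (z' - i - 1 - k3 * S.p) (by rw [e1]; linarith) (by rw [e1]; linarith) with h0 | h0
      · rw [h0] at e1; push_cast at e1; linarith
      · refine hz'j (k3 - q) ?_
        rw [h0] at e1
        push_cast at e1 ⊢
        linarith
    · have e1 : (((z' - j - 1 - k3 * S.p : ℤ)) : ℝ) = 1 / 4 - y := by push_cast; linarith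
      rcases bound (z' - j - 1 - k3 * S.p) (by rw [e1]; linarith) (by rw [e1]; linarith) with h0 | h0
      · refine hz'j k3 ?_
        have : (((z' - j - 1 - k3 * S.p : ℤ)) : ℝ) = 0 := by rw [h0]; simp
        push_cast at this
        linarith
      · rw [h0] at e1; push_cast at e1; linarith
    · have e1 : (((z' - c'' - 1 - k3 * S.p : ℤ)) : ℝ) = 1 / 4 := by push_cast; linarith
      rcases bound (z' - c'' - 1 - k3 * S.p) (by rw [e1]; linarith) (by rw [e1]; linarith)
        with h0 | h0 <;> rw [h0] at e1 <;> norm_num at e1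
  · intro e he
    refine ⟨_, he, ?_⟩
    have wj : ∀ u : ℝ, S.proj u = S.pt j → Walk (Diagram.elem S i j hij h) 0 u 1 (u - 1) := by
      intro u hu
      obtain ⟨k', hk'⟩ := S.exists_eq_add hu
      refine ⟨fun y => u - y, by fun_prop, by simp, by simp, fun y _ => ⟨j, ?_⟩⟩
      rw [hs, elemLift, if_neg hij.symm, if_pos rfl, S.proj_eq]
      exact ⟨k', by linarith⟩
    split_ifs with hcj
    · subst hcj
      push_cast
      exact wj z hz
    · by_cases hci : c = i
      · subst hci
        -- The walk starting over `i` is the minimum of the two crossing strands: one step right and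
        -- one step left, hence a return to `z`.
        have w1 := wj (z + 1) (by
          rw [Strip.pt, h, S.proj_eq]
          exact ⟨k, by linarith⟩)
        have w2 : Walk (Diagram.elem S c j hij h) 0 z 1 (z + 1) := by
          refine ⟨fun y => z + y, by fun_prop, by simp, by simp, fun y _ => ⟨c, ?_⟩⟩
          rw [hs, elemLift, if_pos rfl, S.proj_eq]
          exact ⟨k, by linarith⟩
        have := w2.min w1
        rwa [min_eq_left (by linarith), min_eq_right (by linarith), add_sub_cancel_right] at this
      · refine ⟨fun _ => z, continuousOn_const, rfl, rfl, fun y _ => ⟨c, ?_⟩⟩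
        rw [hs, elemLift, if_neg hci, if_neg hcj, hz, Strip.pt]

/-- Marked points have abscissas starting from `1`: the right one of the exchanged pair has abscissa
`i + 2`, which is the place lowered by the index `i + 1`. -/
theorem lower_eq (S : Strip) {i j c : Fin S.m} (h : S.proj ((j : ℝ) + 1) = S.proj ((i : ℝ) + 2))
    {z : ℤ} (hz : S.proj (z : ℝ) = S.pt c) :
    lower ((i : ZMod S.p) + 1) z = if c = j then z - 1 else z := by
  have h' : S.pt j = S.proj (((i : ℤ) + 2 : ℤ) : ℝ) := by
    rw [Strip.pt, h]; simp
  have key : c = j ↔ (z : ZMod S.p) = (i : ZMod S.p) + 1 + 1 := by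
    have : c = j ↔ S.proj (z : ℝ) = S.proj (((i : ℤ) + 2 : ℤ) : ℝ) := by
      rw [hz, ← h']
      exact (pt_injective S).eq_iff.symm
    rw [this, S.proj_intCast_eq_iff, add_assoc, one_add_one_eq_two]
    push_cast
    rfl
  unfold lower
  by_cases hc : c = j
  · rw [if_pos hc, if_pos (key.1 hc)]
  · rw [if_neg hc, if_neg fun e => hc (key.2 e)]

theorem exists_pt_lower (S : Strip) {i j c : Fin S.m}
    (h : S.proj ((j : ℝ) + 1) = S.proj ((i : ℝ) + 2)) {z : ℤ} (hz : S.proj (z : ℝ) = S.pt c) :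
    ∃ c', S.proj (lower ((i : ZMod S.p) + 1) z : ℝ) = S.pt c' := by
  rw [lower_eq S h hz]
  split_ifs with hc
  · subst hc
    refine ⟨i, ?_⟩
    obtain ⟨k, hk⟩ := S.exists_eq_add (hz.trans h)
    rw [Strip.pt, S.proj_eq]
    exact ⟨k, by push_cast; linarith⟩
  · exact ⟨c, hz⟩

/-! ### The invariant of isotopy classes -/

/-- The sets `Drop d` depend only on the isotopy class of `d`. -/
def dropClass (hS : S.Covered) : DiagramClass S → ℝ → Set ℝ :=
  Quot.lift Drop fun _ _ h => h.drop_eq hS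

theorem dropClass_mul_congr (hS : S.Covered) {d d' e e' : DiagramClass S}
    (h : dropClass hS d = dropClass hS e) (h' : dropClass hS d' = dropClass hS e') :
    dropClass hS (d * d') = dropClass hS (e * e') := by
  induction d using Quot.ind
  induction d' using Quot.ind
  induction e using Quot.ind
  induction e' using Quot.ind
  exact drop_comp_congr hS h h'

/-- The congruence of the classes with the same sets `Drop`. -/
def dropCon (hS : S.Covered) : Con (DiagramClass S) where
  r x y := dropClass hS x = dropClass hS y
  iseqv := ⟨fun _ => rfl, Eq.symm, Eq.trans⟩
  mul' := fun h h' => dropClass_mul_congr hS h h'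

/-- When the leftmost exit `u` of the lower factor is attained, all walks may be compared with those
through `u`, by monotonicity. -/
theorem dropClass_mul (hS : S.Covered) (d d' : DiagramClass S) {x u : ℝ}
    (h : dropClass hS d' x = Ici u) {v : Set ℝ} (h' : dropClass hS d u = v) {c : Fin S.m}
    (hu : S.proj u = S.pt c) : dropClass hS (d * d') x = v := by
  subst h'
  induction d using Quot.ind
  induction d' using Quot.ind
  rename_i d d'
  change Drop d' x = Ici u at h
  change Drop (d.comp d') x = Drop d u
  ext e
  rw [mem_drop_comp]
  constructor
  · rintro ⟨z, hz, he⟩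
    have : z ∈ Drop d' x := ⟨z, le_rfl, hz⟩
    rw [h] at this
    exact drop_subset_of_le d hS this hu he
  · intro he
    have : u ∈ Drop d' x := by rw [h]; exact self_mem_Ici
    obtain ⟨z, hz, hw⟩ := this
    have : z ∈ Drop d' x := ⟨z, le_rfl, hw⟩
    rw [h] at this
    obtain rfl := le_antisymm hz this
    exact ⟨z, hw, he⟩

/-- All strands being vertical, a walk takes countably many values, so it is constant. -/
theorem dropClass_one (hS : S.Covered) {z : ℤ} {c : Fin S.m} (hz : S.proj (z : ℝ) = S.pt c) :
    dropClass hS 1 z = Ici (z : ℝ) := by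
  change Drop (Diagram.one S) z = _
  have hs : ∀ c' (y : I), (Diagram.one S).strand c' y = S.pt c' := fun _ _ => rfl
  apply subset_antisymm
  · rintro e ⟨e', he, P, hP, hP0, hP1, hPs⟩
    refine le_trans ?_ he
    by_contra hlt
    have hcount : (P '' Icc 0 1).Countable := by
      refine (countable_range fun q : Fin S.m × ℤ => ((q.1 : ℝ) + 1 + q.2 * S.p)).mono ?_
      rintro _ ⟨y, hy, rfl⟩
      obtain ⟨c', hc'⟩ := hPs y hy
      obtain ⟨k, hk⟩ := S.exists_eq_add (hc'.trans (hs c' y))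
      exact ⟨(c', k), hk.symm⟩
    have := hcount.isTotallyDisconnected _ subset_rfl (isPreconnected_Icc.image P hP)
      ⟨0, ⟨le_rfl, zero_le_one⟩, rfl⟩ ⟨1, ⟨zero_le_one, le_rfl⟩, rfl⟩
    rw [hP0, hP1] at this
    exact hlt this.le
  · intro e he
    exact ⟨z, he, fun _ => z, continuousOn_const, rfl, rfl, fun y _ => ⟨c, hz⟩⟩

/-- Generators of diagrams exchanging the marked points `i c` and `j c` act on the integers by
`lower`. -/
theorem dropClass_prod (hS : S.Covered) {ι : Type} (i j : ι → Fin S.m) (hij : ∀ q, i q ≠ j q)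
    (h : ∀ q, S.proj ((j q : ℝ) + 1) = S.proj ((i q : ℝ) + 2)) (w : List ι) {z : ℤ} {c : Fin S.m}
    (hz : S.proj (z : ℝ) = S.pt c) :
    dropClass hS (w.map fun q => (Diagram.elem S (i q) (j q) (hij q) (h q)).cls).prod z =
        Ici (lowerWord (fun q => (i q : ZMod S.p) + 1) w z : ℝ) ∧
      ∃ c', S.proj (lowerWord (fun q => (i q : ZMod S.p) + 1) w z : ℝ) = S.pt c' := by
  induction w with
  | nil => exact ⟨dropClass_one hS hz, c, hz⟩
  | cons q w ih =>
    obtain ⟨h1, c', hc'⟩ := ih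
    rw [lowerWord_cons]
    refine ⟨?_, exists_pt_lower S (h q) hc'⟩
    rw [List.map_cons, List.prod_cons]
    refine dropClass_mul hS _ _ h1 ?_ hc'
    rw [lower_eq S (h q) hc']
    exact drop_elem S (hij q) (h q) hc'

end

/-! ### Words with equivalent diagrams are equal -/

theorem linear_relations (n : ℕ) : HKRelations (p := 0) (fun i : Fin n => PresentedMonoid.of (LRel n) i)
    (fun i => ((Fin.castSucc i : Fin (n + 1)) : ZMod 0) + 1) := by
  have hv : ∀ i : Fin n, (((Fin.castSucc i : Fin (n + 1)) : ℕ) : ZMod 0) = ((i : ℕ) : ℤ) := fun i => rfl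
  have snd : ∀ a b, LRel n a b → PresentedMonoid.mk (LRel n) a = PresentedMonoid.mk (LRel n) b :=
    fun a b h => Quotient.sound (ConGen.Rel.of _ _ h)
  have hnext : ∀ i j : Fin n, (((Fin.castSucc j : Fin (n + 1)) : ℕ) : ZMod 0) + 1 =
      (((Fin.castSucc i : Fin (n + 1)) : ℕ) : ZMod 0) + 1 + 1 → (j : ℕ) = i + 1 := by
    intro i j h
    have h' : ((j : ℕ) : ℤ) + 1 = (i : ℕ) + 1 + 1 := h
    omega
  refine ⟨fun i j h => ?_, fun i => snd _ _ (.idem i), fun i j h => ?_, fun i j h => ?_,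
    fun i j h1 h2 h3 => ?_⟩
  · have h' : ((i : ℕ) : ℤ) + 1 = (j : ℕ) + 1 := h
    exact Fin.ext (by omega)
  · exact (snd _ _ (.braid i j (hnext i j h))).trans (snd _ _ (.kiselman i j (hnext i j h)))
  · exact snd _ _ (.kiselman i j (hnext i j h))
  · have e1 : (i : ℕ) ≠ j := fun e => h1 (by simp only [e, hv])
    have e2 : (j : ℕ) ≠ i + 1 := fun e => h2 (by simp only [hv, e]; push_cast; rfl)
    have e3 : (i : ℕ) ≠ j + 1 := fun e => h3 (by simp only [hv, e]; push_cast; rfl)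
    rcases lt_or_gt_of_ne e1 with h | h
    · exact (snd _ _ (.comm j i (by omega))).symm
    · exact snd _ _ (.comm i j (by omega))

theorem circular_relations (n : ℕ) :
    HKRelations (p := n) (fun i : Fin n => PresentedMonoid.of (CRel n) i)
      (fun i => ((i : ℕ) : ZMod n) + 1) := by
  have snd : ∀ a b, CRel n a b → PresentedMonoid.mk (CRel n) a = PresentedMonoid.mk (CRel n) b :=
    fun a b h => Quotient.sound (ConGen.Rel.of _ _ h)
  have hnext : ∀ i j : Fin n, ((j : ℕ) : ZMod n) + 1 = ((i : ℕ) : ZMod n) + 1 + 1 ↔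
      (j : ℕ) = (i + 1) % n := by
    intro i j
    rw [add_left_inj, ← Nat.cast_succ, ZMod.natCast_eq_natCast_iff', Nat.mod_eq_of_lt j.2]
  refine ⟨fun i j h => ?_, fun i => snd _ _ (.idem i), fun i j h => ?_, fun i j h => ?_,
    fun i j h1 h2 h3 => ?_⟩
  · have h' : ((i : ℕ) : ZMod n) = ((j : ℕ) : ZMod n) := add_right_cancel h
    rw [ZMod.natCast_eq_natCast_iff', Nat.mod_eq_of_lt j.2, Nat.mod_eq_of_lt i.2] at h'
    exact Fin.ext h'
  · have h' := (hnext i j).1 h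
    exact (snd _ _ (.braid i j h')).trans (snd _ _ (.kiselman i j h'))
  · exact snd _ _ (.kiselman i j ((hnext i j).1 h))
  · have e1 : (i : ℕ) ≠ j := fun e => h1 (by rw [e])
    have e2 : (j : ℕ) ≠ (i + 1) % n := fun e => h2 ((hnext i j).2 e)
    have e3 : (i : ℕ) ≠ (j + 1) % n := fun e => h3 ((hnext j i).2 e)
    have hi := i.2
    have hj := j.2
    have key : ∀ a b : ℕ, a < n → b < n → b < a → b ≠ (a + 1) % n → a ≠ (b + 1) % n →
        b + 1 < a ∧ a + 1 < b + n := by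
      intro a b ha hb hba h1 h2
      rw [Nat.mod_eq_of_lt (by omega : b + 1 < n)] at h2
      refine ⟨by omega, ?_⟩
      by_contra hc
      have : a + 1 = n := by omega
      rw [this, Nat.mod_self] at h1
      omega
    rcases lt_or_gt_of_ne e1 with h | h
    · obtain ⟨k1, k2⟩ := key j i hj hi h e3 e2
      exact (snd _ _ (.comm j i k1 k2)).symm
    · obtain ⟨k1, k2⟩ := key i j hi hj h e2 e3
      exact snd _ _ (.comm i j k1 k2)

theorem plane_proj_next (n : ℕ) (i : Fin n) :
    (plane n).proj ((((Fin.succ i : Fin (n + 1)) : ℕ) : ℝ) + 1) =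
      (plane n).proj ((((Fin.castSucc i : Fin (n + 1)) : ℕ) : ℝ) + 2) := by
  change (((Fin.succ i : Fin (n + 1)) : ℕ) : ℝ) + 1 = ((Fin.castSucc i : Fin (n + 1)) : ℕ) + 2
  simp only [Fin.val_succ, Fin.val_castSucc]
  push_cast
  ring

theorem cylinder_ne_next {n : ℕ} (hn : 2 ≤ n) (i : Fin n) :
    i ≠ (⟨((i : ℕ) + 1) % n, Nat.mod_lt _ (by omega)⟩ : Fin n) := by
  intro h
  have h' : (i : ℕ) = ((i : ℕ) + 1) % n := congrArg Fin.val h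
  have hi : (i : ℕ) < n := i.2
  rcases Nat.lt_or_ge ((i : ℕ) + 1) n with hl | hl
  · rw [Nat.mod_eq_of_lt hl] at h'
    omega
  · have : (i : ℕ) + 1 = n := by omega
    rw [this, Nat.mod_self] at h'
    omega

theorem cylinder_proj_next {n : ℕ} (hn : 2 ≤ n) (i : Fin n) :
    (cylinder n).proj
      ((((⟨((i : ℕ) + 1) % n, Nat.mod_lt _ (by omega)⟩ : Fin n) : ℕ) : ℝ) + 1) =
      (cylinder n).proj (((i : ℕ) : ℝ) + 2) := by
  rw [(cylinder n).proj_eq]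
  refine ⟨-((((i : ℕ) + 1) / n : ℕ) : ℤ), ?_⟩
  have h' : (((((i : ℕ) + 1) % n : ℕ) : ℝ) + (n : ℝ) * ((((i : ℕ) + 1) / n : ℕ) : ℝ)) =
      ((i : ℕ) : ℝ) + 1 := by exact_mod_cast Nat.mod_add_div ((i : ℕ) + 1) n
  change ((((i : ℕ) + 1) % n : ℕ) : ℝ) + 1 - (((i : ℕ) : ℝ) + 2) =
    ((-((((i : ℕ) + 1) / n : ℕ) : ℤ) : ℤ) : ℝ) * (n : ℝ)
  rw [Int.cast_neg, Int.cast_natCast]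
  linarith

/-- The moves preserve `Drop`, so the congruence they generate lies below `dropCon`, and the
leftmost exits give the action of both words on the marked points. -/
theorem linear_prod_eq_of_moves (n : ℕ) (w w' : List (Fin n))
    (h : linearMoves n (w.map fun i => (planeElem n i).cls).prod
      (w'.map fun i => (planeElem n i).cls).prod) :
    (w.map fun i => PresentedMonoid.of (LRel n) i).prod =
      (w'.map fun i => PresentedMonoid.of (LRel n) i).prod := by
  have hS := plane_covered n
  have hcon : linearMoves n ≤ dropCon hS := Con.conGen_le.2 (by
    rintro _ _ ⟨d, d', rfl, rfl, hm⟩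
    exact hm.drop_eq hS)
  have hdrop : dropClass hS _ = dropClass hS _ := hcon h
  have hp := fun w z c hz => dropClass_prod hS (fun i : Fin n => (Fin.castSucc i : Fin (n + 1)))
    (fun i => (Fin.succ i : Fin (n + 1))) (fun i => (Fin.castSucc_lt_succ (i := i)).ne) (plane_proj_next n) w (z := z) (c := c) hz
  refine (linear_relations n).faithful (by exact one_ne_zero (α := ℤ)) w w' fun z => ?_
  by_cases hz : ∃ c : Fin (n + 1), z = (c : ℕ) + 1
  · obtain ⟨c, hc⟩ := hz
    have hz' : (plane n).proj (z : ℝ) = (plane n).pt c := by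
      change (z : ℝ) = ((c : ℕ) : ℝ) + 1
      rw [hc]; push_cast; rfl
    have h1 := (hp w z c hz').1
    have h2 := (hp w' z c hz').1
    have h3 := h1.symm.trans ((congrFun hdrop z).trans h2)
    exact Int.cast_injective (Ici_injective h3)
  · have fix : ∀ w : List (Fin n),
        lowerWord (p := 0) (fun i => ((Fin.castSucc i : Fin (n + 1)) : ZMod 0) + 1) w z = z := by
      intro w
      induction w with
      | nil => rfl
      | cons i w ih =>
        rw [lowerWord_cons, ih]
        refine if_neg fun h => hz ⟨Fin.succ i, ?_⟩
        have h' : z = ((i : ℕ) : ℤ) + 1 + 1 := h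
        rw [h', Fin.val_succ]
        push_cast
        rfl
    exact (fix w).trans (fix w').symm

theorem circular_prod_eq_of_moves (n : ℕ) (hn : 3 ≤ n) (hn' : 2 ≤ n) (w w' : List (Fin n))
    {u u' : cylinderMonoid n hn'}
    (hu : (u : DiagramClass (cylinder n)) = (w.map fun i => (cylinderElem n hn' i).cls).prod)
    (hu' : (u' : DiagramClass (cylinder n)) = (w'.map fun i => (cylinderElem n hn' i).cls).prod)
    (h : circularMoves n hn' u u') :
    (w.map fun i => PresentedMonoid.of (CRel n) i).prod =
      (w'.map fun i => PresentedMonoid.of (CRel n) i).prod := by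
  have hS := cylinder_covered n
  have hcon : circularMoves n hn' ≤ (dropCon hS).comap (cylinderMonoid n hn').subtype
      (map_mul _) := Con.conGen_le.2 (by
    rintro x y ⟨d, d', hd, hd', hm⟩
    change dropClass hS (x : DiagramClass (cylinder n)) = dropClass hS (y : DiagramClass _)
    rw [← hd, ← hd']
    exact hm.drop_eq hS)
  have hdrop : dropClass hS (u : DiagramClass (cylinder n)) = dropClass hS (u' : DiagramClass _) :=
    hcon h
  rw [hu, hu'] at hdrop
  have hp := fun w z c hz => dropClass_prod hS (fun i : Fin n => i)
    (fun i => (⟨((i : ℕ) + 1) % n, Nat.mod_lt _ (by omega)⟩ : Fin n)) (cylinder_ne_next hn')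
    (cylinder_proj_next hn') w (z := z) (c := c) hz
  have : Fact (1 < n) := ⟨by omega⟩
  refine (circular_relations n).faithful one_ne_zero w w' fun z => ?_
  have hz : ∃ c : Fin n, (cylinder n).proj (z : ℝ) = (cylinder n).pt c := by
    have hpos : (0 : ℤ) < n := by omega
    have h0 := Int.emod_nonneg (z - 1) hpos.ne'
    have h1 := Int.emod_lt_of_pos (z - 1) hpos
    -- The marked point numbered `c` has abscissa `c + 1`, hence the shift by one before reduction.
    refine ⟨⟨((z - 1) % n).toNat, by omega⟩, ?_⟩
    refine Eq.trans ?_ ((cylinder n).pt_eq _).symm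
    refine ((cylinder n).proj_intCast_eq_iff _ _).2 (Eq.symm ?_)
    refine (ZMod.intCast_eq_intCast_iff_dvd_sub _ _ n).2 ⟨(z - 1) / n, ?_⟩
    have := Int.emod_add_mul_ediv (z - 1) n
    simp only [Int.toNat_of_nonneg h0]
    linarith
  obtain ⟨c, hz⟩ := hz
  have h1 := (hp w z c hz).1
  have h2 := (hp w' z c hz).1
  have h3 := h1.symm.trans ((congrFun hdrop z).trans h2)
  exact Int.cast_injective (Ici_injective h3)

/-! ### Diagrams exchanging several pairs of neighbours -/

theorem isScale_id : IsScale id where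
  cont := continuous_id
  zero := rfl
  one := rfl
  mono := monotone_id
  inj := fun _ _ h _ _ => h

theorem isotopic_of_strand_eq {S : Strip} {d d' : Diagram S}
    (h : ∀ i y, d'.strand i y = d.strand i y) : Isotopic d d' :=
  isotopic_rescale d d' id isScale_id h

theorem cls_eq {S : Strip} {d d' : Diagram S} (h : Isotopic d d') : d.cls = d'.cls := Quot.sound h

theorem isScale_dbl : IsScale dbl where
  cont := continuous_dbl
  zero := Subtype.ext (by rw [dbl_val (by norm_num)]; simp)
  one := by simp [dbl]
  mono := fun y z h => monotone_projIcc _ (by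
    have : (y : ℝ) ≤ z := h
    linarith)
  inj := by
    have key : ∀ y, dbl y < 1 → (y : ℝ) ≤ 1 / 2 := by
      intro y hy
      by_contra h
      refine hy.ne ?_
      rw [dbl, projIcc_of_right_le]
      · rfl
      · linarith
    intro y z h _ h1
    have h2 := congrArg Subtype.val h
    rw [dbl_val (key y h1), dbl_val (key z (h ▸ h1))] at h2
    exact Subtype.ext (by linarith)

theorem isScale_dblSub : IsScale dblSub where
  cont := continuous_dblSub
  zero := by
    rw [dblSub, projIcc_of_le_left]
    · rfl
    · simp
  one := Subtype.ext (by rw [dblSub_val (by norm_num)]; norm_num)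
  mono := fun y z h => monotone_projIcc _ (by
    have : (y : ℝ) ≤ z := h
    linarith)
  inj := by
    have key : ∀ y, 0 < dblSub y → 1 / 2 ≤ (y : ℝ) := by
      intro y hy
      by_contra h
      refine hy.ne' ?_
      rw [dblSub, projIcc_of_le_left]
      · rfl
      · linarith
    intro y z h h0 _
    have h2 := congrArg Subtype.val h
    rw [dblSub_val (key y h0), dblSub_val (key z (h ▸ h0))] at h2
    exact Subtype.ext (by linarith)

theorem dbl_eq_one {y : I} (h : 1 / 2 ≤ (y : ℝ)) : dbl y = 1 := by
  rw [dbl, projIcc_of_right_le]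
  · rfl
  · linarith

theorem dblSub_eq_zero {y : I} (h : (y : ℝ) ≤ 1 / 2) : dblSub y = 0 := by
  rw [dblSub, projIcc_of_le_left]
  · rfl
  · linarith

theorem IsScale.lt_of_lt {φ : I → I} (h : IsScale φ) {y z : I} (hyz : y < z)
    (hc : (0 < φ y ∧ φ y < 1) ∨ (0 < φ z ∧ φ z < 1)) : φ y < φ z := by
  refine lt_of_le_of_ne (h.mono hyz.le) fun he => hyz.ne ?_
  rcases hc with hc | hc
  · exact h.inj _ _ he hc.1 hc.2
  · exact h.inj _ _ he (he ▸ hc.1) (he ▸ hc.2)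

/-- The height at which the interpolated scale takes an interior value is unique. It is continuous
in `t` because its graph is closed and projections along the compact interval are closed. -/
theorem IsScale.exists_inverse {φ : I → I} (h : IsScale φ) {c : I} (h0 : 0 < c) (h1 : c < 1) :
    ∃ f : I → I, Continuous f ∧ ∀ t y, HKDiagram.interp φ t y = c ↔ f t = y := by
  choose f hf using fun t => (h.interp t).surj c
  have key : ∀ t y, HKDiagram.interp φ t y = c ↔ f t = y := fun t y =>
    ⟨fun e => (h.interp t).inj _ _ ((hf t).trans e.symm) (by rwa [hf]) (by rwa [hf]),
      fun e => e ▸ hf t⟩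
  refine ⟨f, continuous_iff_isClosed.2 fun C hC => ?_, key⟩
  have hcl : IsClosed {q : I × I | HKDiagram.interp φ q.1 q.2 = c ∧ q.2 ∈ C} :=
    (isClosed_singleton.preimage (continuous_interp h.cont)).inter (hC.preimage continuous_snd)
  convert isClosedMap_fst_of_compactSpace _ hcl using 1
  ext t
  constructor
  · intro ht
    exact ⟨(t, f t), ⟨hf t, ht⟩, rfl⟩
  · rintro ⟨⟨t', y⟩, ⟨e1, e2⟩, rfl⟩
    have : f t' = y := (key t' y).1 e1
    rw [mem_preimage, this]
    exact e2

/-! ### Simultaneous exchanges of neighbours -/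

/-- The permutation `τ` exchanges some disjoint pairs of neighbours, the point `c` being moved by
`δ c`. -/
structure Strip.Swaps (S : Strip) (τ : Equiv.Perm (Fin S.m)) (δ : Fin S.m → ℤ) : Prop where
  target : ∀ c : Fin S.m, S.proj ((c : ℝ) + 1 + δ c) = S.pt (τ c)
  anti : ∀ c, δ (τ c) = -δ c
  bound : ∀ c, δ c = 0 ∨ δ c = 1 ∨ δ c = -1

/-- One scale for each strand, the same for two strands which are exchanged by `τ`. -/
structure IsScaleFamily {m : ℕ} (τ : Equiv.Perm (Fin m)) (φ : Fin m → I → I) : Prop where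
  scale : ∀ c, IsScale (φ c)
  inv : ∀ c, φ (τ c) = φ c

/-- The abscissa of the strand `c`, read on the line. -/
noncomputable def swapLift {m : ℕ} (δ : Fin m → ℤ) (φ : Fin m → I → I) (c : Fin m) (y : I) : ℝ :=
  (c : ℝ) + 1 + δ c * φ c y

section

variable {S : Strip} {τ : Equiv.Perm (Fin S.m)} {δ : Fin S.m → ℤ} {φ : Fin S.m → I → I}

theorem Strip.Swaps.apply_apply (h : S.Swaps τ δ) (c : Fin S.m) : τ (τ c) = c := by
  refine pt_injective S ?_
  obtain ⟨k, hk⟩ := S.exists_eq_add (h.target c)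
  rw [← h.target, h.anti, Strip.pt, S.proj_eq]
  refine ⟨-k, ?_⟩
  push_cast
  linarith

/-- Strands start and end at lattice points and move by at most one step. A meeting that is not at
the middle of an exchange would force two lower endpoints, or two upper endpoints, to coincide, or
displacements to be incompatible. -/
theorem Strip.Swaps.eq_of_proj_eq (h : S.Swaps τ δ) (hφ : IsScaleFamily τ φ) {c c' : Fin S.m}
    (hc : c ≠ c') {y : I} (he : S.proj (swapLift δ φ c y) = S.proj (swapLift δ φ c' y)) :
    τ c = c' ∧ δ c ≠ 0 ∧ (φ c y : ℝ) = 1 / 2 := by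
  obtain ⟨k, hk⟩ := (S.proj_eq _ _).1 he
  obtain ⟨q, hq⟩ := S.exists_eq_add (h.target c)
  obtain ⟨q', hq'⟩ := S.exists_eq_add (h.target c')
  have h00 : ∀ k : ℤ, (c : ℝ) - c' ≠ k * S.p := fun k e =>
    hc (pt_injective S ((S.proj_eq _ _).2 ⟨k, by linarith⟩))
  have h11 : ∀ k : ℤ, (c : ℝ) + δ c - (c' + δ c') ≠ k * S.p := fun k e =>
    hc (τ.injective (pt_injective S (by
      rw [← h.target, ← h.target]
      exact (S.proj_eq _ _).2 ⟨k, by linarith⟩)))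
  have h10 : ∀ k : ℤ, (c : ℝ) + δ c - c' = k * S.p → τ c = c' := fun k e =>
    pt_injective S (by
      rw [← h.target]
      exact (S.proj_eq _ _).2 ⟨k, by linarith⟩)
  have h01 : ∀ k : ℤ, (c : ℝ) - (c' + δ c') = k * S.p → τ c = c' := fun k e => by
    rw [← h.apply_apply c']
    congr 1
    refine pt_injective S ?_
    rw [← h.target]
    exact (S.proj_eq _ _).2 ⟨k, by linarith⟩
  have hu0 := (φ c y).2.1
  have hu1 := (φ c y).2.2
  have hv0 := (φ c' y).2.1
  have hv1 := (φ c' y).2.2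
  have hφ' : τ c = c' → (φ c' y : ℝ) = φ c y := fun e => by rw [← e, hφ.inv]
  have hδ' : τ c = c' → δ c' = -δ c := fun e => by rw [← e, h.anti]
  have bound : ∀ N : ℤ, ((N : ℝ) ≤ 2 → -2 ≤ (N : ℝ) → N = 0 ∨ N = 1 ∨ N = -1 ∨ N = 2 ∨ N = -2) := by
    intro N h1 h2
    have h1' : N ≤ 2 := by exact_mod_cast h1
    have h2' : -2 ≤ N := by exact_mod_cast h2
    omega
  unfold swapLift at hk
  generalize (φ c y : ℝ) = u at *
  generalize (φ c' y : ℝ) = v at *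
  -- The difference of the displacements is an integer of absolute value at most `2`, so finitely
  -- many cases remain.
  have hN : (((k * S.p - c + c' : ℤ)) : ℝ) = δ c * u - δ c' * v := by push_cast; linarith
  generalize hNdef : (k * S.p - c + c' : ℤ) = N at hN
  have hNr : (N : ℝ) = k * S.p - c + c' := by rw [← hNdef]; push_cast; ring
  rcases h.bound c with e | e | e <;> rcases h.bound c' with e' | e' | e' <;>
    rw [e, e'] at hN <;> rw [e, e'] at h11 <;> rw [e] at h10 <;> rw [e'] at h01 <;>
    rw [e, e'] at hδ' <;> push_cast at hN h11 h10 h01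
  all_goals
    rcases bound N (by linarith) (by linarith) with h0 | h0 | h0 | h0 | h0 <;> rw [h0] at hN hNr <;>
      push_cast at hN hNr
  -- In order: numerically impossible; equal lower endpoints; equal upper endpoints; a lower
  -- endpoint equal to an upper one although the displacements are not opposite; the genuine
  -- crossing, where equal scales force the value `1 / 2`.
  all_goals first
    | (exfalso; linarith)
    | exact absurd (by linarith) (h00 k)
    | exact absurd (by linarith) (h11 k)
    | (have := hδ' (h10 k (by linarith)); omega)
    | (have := hδ' (h01 k (by linarith)); omega)
    | (have := h10 k (by linarith)
       exact ⟨this, by omega, by have := hφ' this; linarith⟩)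

/-- The diagram exchanging some disjoint pairs of neighbours, the height of the strand `c` being
read on the scale `φ c`. -/
noncomputable def Diagram.swaps (h : S.Swaps τ δ) (hφ : IsScaleFamily τ φ) : Diagram S where
  perm := τ
  strand := fun c =>
    { toFun := fun y => S.proj (swapLift δ φ c y)
      continuous_toFun := S.continuous_proj.comp (by
        have := (hφ.scale c).cont
        unfold swapLift
        fun_prop)
      source' := by simp [swapLift, (hφ.scale c).zero, Strip.pt]
      target' := by simp [swapLift, (hφ.scale c).one, h.target] }
  finite_double := by
    intro c c' hc
    refine Finite.of_finite_image (f := φ c)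
      ((finite_singleton (⟨1 / 2, by norm_num, by norm_num⟩ : I)).subset ?_) ?_
    · rintro _ ⟨y, hy, rfl⟩
      exact Subtype.ext (h.eq_of_proj_eq hφ hc hy).2.2
    · intro y hy z _ hyz
      have := (h.eq_of_proj_eq hφ hc hy).2.2
      exact (hφ.scale c).inj _ _ hyz (Subtype.coe_lt_coe.1 (by rw [this]; norm_num))
        (Subtype.coe_lt_coe.1 (by rw [this]; norm_num))
  no_triple := by
    rintro c c' c'' h1 h2 h3 y ⟨e1, e2⟩
    exact h2 ((h.eq_of_proj_eq hφ h1 e1).1.symm.trans (h.eq_of_proj_eq hφ h3 (e1.trans e2)).1)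
  crosses := by
    have key : ∀ (c : Fin S.m) (y : I), δ c = 1 → (φ c y : ℝ) = 1 / 2 →
        Crosses S (fun y => S.proj (swapLift δ φ c y)) (fun y => S.proj (swapLift δ φ (τ c) y)) y := by
      intro c y hc hy
      have hcont := (hφ.scale c).cont
      obtain ⟨q, hq⟩ := S.exists_eq_add (h.target c)
      have hb : 0 < φ c y ∧ φ c y < 1 := ⟨Subtype.coe_lt_coe.1 (by rw [hy]; norm_num),
        Subtype.coe_lt_coe.1 (by rw [hy]; norm_num)⟩
      refine ⟨fun z => (c : ℝ) + 1 + φ c z, fun z => (c : ℝ) + 2 - φ c z, by fun_prop, by fun_prop,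
        by simp only [hy]; ring, Filter.Eventually.of_forall fun z => ⟨?_, ?_⟩, Or.inl ⟨?_, ?_⟩⟩
      · simp [swapLift, hc]
      · rw [S.proj_eq]
        refine ⟨q, ?_⟩
        simp only [swapLift, hφ.inv, h.anti, hc] at hq ⊢
        push_cast at hq ⊢
        linarith
      · filter_upwards [self_mem_nhdsWithin] with z (hz : z < y)
        have hz' : (φ c z : ℝ) < φ c y := (hφ.scale c).lt_of_lt hz (.inr hb)
        linarith
      · filter_upwards [self_mem_nhdsWithin] with z (hz : y < z)
        have hz' : (φ c y : ℝ) < φ c z := (hφ.scale c).lt_of_lt hz (.inl hb)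
        linarith
    intro c c' hc y e
    obtain ⟨rfl, h0, hy⟩ := h.eq_of_proj_eq hφ hc e
    rcases h.bound c with h1 | h1 | h1
    · exact absurd h1 h0
    · exact key c y h1 hy
    · have := key (τ c) y (by rw [h.anti, h1]; rfl) (by rw [hφ.inv, hy])
      rw [h.apply_apply] at this
      exact this.symm

theorem swaps_strand (h : S.Swaps τ δ) (hφ : IsScaleFamily τ φ) (c : Fin S.m) (y : I) :
    (Diagram.swaps h hφ).strand c y = S.proj (swapLift δ φ c y) := rfl

theorem isScaleFamily_id (τ : Equiv.Perm (Fin S.m)) : IsScaleFamily τ fun _ => id :=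
  ⟨fun _ => isScale_id, fun _ => rfl⟩

theorem IsScaleFamily.interp (hφ : IsScaleFamily τ φ) (t : I) :
    IsScaleFamily τ fun c => HKDiagram.interp (φ c) t :=
  ⟨fun c => (hφ.scale c).interp t, fun c => by rw [hφ.inv]⟩

/-- Interpolate every scale with the identity. Exchanged strands share their scale, so they meet
exactly once, where it equals `1 / 2`, and this height varies continuously. -/
theorem isotopic_swaps (h : S.Swaps τ δ) (hφ : IsScaleFamily τ φ) :
    Isotopic (Diagram.swaps h (isScaleFamily_id τ)) (Diagram.swaps h hφ) := by
  refine ⟨fun t => Diagram.swaps h (hφ.interp t), fun _ => rfl, fun c => ?_, fun c y => ?_,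
    fun c y => ?_, fun c c' hc => ?_⟩
  · refine S.continuous_proj.comp ?_
    exact continuous_const.add (continuous_const.mul
      (continuous_subtype_val.comp (continuous_interp (hφ.scale c).cont)))
  · change S.proj _ = S.proj _
    simp [swapLift, HKDiagram.interp]
  · change S.proj _ = S.proj _
    simp [swapLift, HKDiagram.interp]
  · by_cases hcc : τ c = c' ∧ δ c ≠ 0
    · obtain ⟨rfl, h0⟩ := hcc
      have hhalf : (0 : I) < ⟨1 / 2, by norm_num, by norm_num⟩ ∧
          (⟨1 / 2, by norm_num, by norm_num⟩ : I) < 1 :=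
        ⟨Subtype.coe_lt_coe.1 (by norm_num), Subtype.coe_lt_coe.1 (by norm_num)⟩
      obtain ⟨f, hf, hfi⟩ := (hφ.scale c).exists_inverse hhalf.1 hhalf.2
      refine ⟨Unit, inferInstance, fun _ => f, fun _ => hf, fun t => ⟨fun _ _ _ => rfl, ?_⟩⟩
      ext y
      simp only [range_const, mem_singleton_iff, mem_ofPred_eq, swaps_strand]
      rw [eq_comm, ← hfi]
      constructor
      · intro hy
        have hy' : (interp (φ c) t y : ℝ) = 1 / 2 := congrArg Subtype.val hy
        obtain ⟨q, hq⟩ := S.exists_eq_add (h.target c)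
        rw [S.proj_eq]
        refine ⟨q, ?_⟩
        simp only [swapLift, hφ.inv, h.anti, hy']
        push_cast
        linarith
      · intro hy
        exact Subtype.ext (h.eq_of_proj_eq (hφ.interp t) hc hy).2.2
    · refine ⟨Empty, inferInstance, fun a => a.elim, fun a => a.elim,
        fun t => ⟨fun a => a.elim, ?_⟩⟩
      ext y
      simp only [range_eq_empty, mem_empty_iff_false, mem_ofPred_eq, false_iff]
      intro hy
      have := h.eq_of_proj_eq (hφ.interp t) hc hy
      exact hcc ⟨this.1, this.2.1⟩

/-- The diagram exchanging all the pairs at the same height. -/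
noncomputable def Strip.Swaps.diagram (h : S.Swaps τ δ) : Diagram S :=
  Diagram.swaps h (isScaleFamily_id τ)

/-- The displacements which remain when one pair is forgotten. -/
def dropPair {m : ℕ} (δ : Fin m → ℤ) (i j c : Fin m) : ℤ := if c = i ∨ c = j then 0 else δ c

theorem Strip.Swaps.drop (h : S.Swaps τ δ) {i j : Fin S.m} (hij : τ i = j) :
    S.Swaps (τ * Equiv.swap i j) (dropPair δ i j) where
  target := by
    have hji : τ j = i := by rw [← hij, h.apply_apply]
    intro c
    rw [Equiv.Perm.mul_apply, dropPair]
    by_cases h1 : c = i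
    · rw [h1, Equiv.swap_apply_left, hji, if_pos (.inl rfl)]
      simp [Strip.pt]
    by_cases h2 : c = j
    · rw [h2, Equiv.swap_apply_right, hij, if_pos (.inr rfl)]
      simp [Strip.pt]
    rw [Equiv.swap_apply_of_ne_of_ne h1 h2, if_neg (by tauto), h.target]
  anti := by
    have hji : τ j = i := by rw [← hij, h.apply_apply]
    intro c
    rw [Equiv.Perm.mul_apply, dropPair, dropPair]
    by_cases h1 : c = i
    · rw [h1, Equiv.swap_apply_left, hji, if_pos (.inl rfl)]
      rfl
    by_cases h2 : c = j
    · rw [h2, Equiv.swap_apply_right, hij, if_pos (.inr rfl)]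
      rfl
    have h3 : τ c ≠ i := fun e => h2 (τ.injective (e.trans hji.symm))
    have h4 : τ c ≠ j := fun e => h1 (τ.injective (e.trans hij.symm))
    rw [Equiv.swap_apply_of_ne_of_ne h1 h2, if_neg (by tauto), if_neg (by tauto), h.anti]
  bound := by
    intro c
    unfold dropPair
    split_ifs
    · exact .inl rfl
    · exact h.bound c

/-- The pairs can be slid vertically independently of each other: the scale `dbl` performs the
chosen exchange in the lower half, and `dblSub` delays the others to the upper half. -/
theorem Strip.Swaps.cls_eq_mul (h : S.Swaps τ δ) {i j : Fin S.m} (hτ : τ i = j) (hi : δ i = 1)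
    (hij : i ≠ j) (hp : S.proj ((j : ℝ) + 1) = S.proj ((i : ℝ) + 2)) :
    h.diagram.cls = (h.drop hτ).diagram.cls * (Diagram.elem S i j hij hp).cls := by
  have hτj : τ j = i := by rw [← hτ, h.apply_apply]
  have hj : δ j = -1 := by rw [← hτ, h.anti, hi]
  have hφ : IsScaleFamily τ fun c => if c = i ∨ c = j then dbl else dblSub := by
    refine ⟨fun c => ?_, fun c => ?_⟩
    · split_ifs
      · exact isScale_dbl
      · exact isScale_dblSub
    · have : (τ c = i ∨ τ c = j) ↔ (c = i ∨ c = j) := by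
        constructor
        · rintro (e | e)
          · exact .inr (τ.injective (e.trans hτj.symm))
          · exact .inl (τ.injective (e.trans hτ.symm))
        · rintro (e | e)
          · exact .inr (by rw [e, hτ])
          · exact .inl (by rw [e, hτj])
      simp only [this]
  refine (cls_eq (isotopic_swaps h hφ)).trans (cls_eq (isotopic_of_strand_eq fun c y => ?_))
  rw [swaps_strand]
  have hlow : ∀ y : I, (y : ℝ) ≤ 1 / 2 → (dbl y : ℝ) = 2 * y := fun y => dbl_val
  rcases le_total (y : ℝ) (1 / 2) with hy | hy
  · rw [comp_low _ _ _ hy]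
    change S.proj (elemLift i j c (dbl y)) = S.proj _
    congr 1
    simp only [elemLift, swapLift]
    by_cases h1 : c = i
    · subst h1
      simp [hi]
    by_cases h2 : c = j
    · subst h2
      simp [h1, hj]
      ring
    · simp [h1, h2, dblSub_eq_zero hy]
  · rw [comp_high _ _ _ hy]
    change S.proj (swapLift (dropPair δ i j) _ (Equiv.swap i j c) (dblSub y)) = S.proj _
    simp only [swapLift, dropPair]
    by_cases h1 : c = i
    · subst h1
      simp only [Equiv.swap_apply_left, true_or, or_true, if_true, dbl_eq_one hy, hi]
      push_cast
      rw [zero_mul, add_zero, hp]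
      congr 1
      simp
      ring
    by_cases h2 : c = j
    · subst h2
      simp only [Equiv.swap_apply_right, true_or, or_true, if_true, dbl_eq_one hy, hj]
      obtain ⟨q, hq⟩ := S.exists_eq_add hp
      rw [S.proj_eq]
      refine ⟨-q, ?_⟩
      push_cast
      simp
      linarith
    · simp [h1, h2, Equiv.swap_apply_of_ne_of_ne h1 h2]

end

/-! ### The relations between elementary diagrams -/

section

variable {S : Strip}

theorem Strip.Swaps.cls_eq_elem {τ : Equiv.Perm (Fin S.m)} {δ : Fin S.m → ℤ} (h : S.Swaps τ δ)
    {i j : Fin S.m} (hi : δ i = 1) (hj : δ j = -1) (h0 : ∀ c, c ≠ i → c ≠ j → δ c = 0)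
    (hij : i ≠ j) (hp : S.proj ((j : ℝ) + 1) = S.proj ((i : ℝ) + 2)) :
    h.diagram.cls = (Diagram.elem S i j hij hp).cls := by
  refine cls_eq (isotopic_of_strand_eq fun c y => ?_)
  change S.proj (elemLift i j c y) = S.proj (swapLift δ (fun _ => id) c y)
  congr 1
  simp only [elemLift, swapLift]
  by_cases h1 : c = i
  · subst h1
    simp [hi]
  by_cases h2 : c = j
  · subst h2
    simp [h1, hj]
    ring
  · simp [h1, h2, h0 c h1 h2]

/-- Both products are isotopic to the diagram that exchanges the two disjoint pairs at the same
height; one extracts either pair first. -/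
theorem cls_elem_comm {i i' j j' : Fin S.m} (hi : i ≠ i')
    (hip : S.proj ((i' : ℝ) + 1) = S.proj ((i : ℝ) + 2)) (hj : j ≠ j')
    (hjp : S.proj ((j' : ℝ) + 1) = S.proj ((j : ℝ) + 2)) (h1 : i ≠ j) (h2 : i ≠ j') (h3 : i' ≠ j)
    (h4 : i' ≠ j') :
    (Diagram.elem S i i' hi hip).cls * (Diagram.elem S j j' hj hjp).cls =
      (Diagram.elem S j j' hj hjp).cls * (Diagram.elem S i i' hi hip).cls := by
  obtain ⟨k, hk⟩ := S.exists_eq_add hip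
  obtain ⟨k', hk'⟩ := S.exists_eq_add hjp
  obtain ⟨δ, hδ⟩ : ∃ δ : Fin S.m → ℤ, δ = fun c =>
      if c = i then 1 else if c = i' then -1 else if c = j then 1 else if c = j' then -1 else 0 :=
    ⟨_, rfl⟩
  have di : δ i = 1 := by simp [hδ]
  have di' : δ i' = -1 := by simp [hδ, hi.symm]
  have dj : δ j = 1 := by simp [hδ, h1.symm, h3.symm]
  have dj' : δ j' = -1 := by simp [hδ, h2.symm, h4.symm, hj.symm]
  have d0 : ∀ c, c ≠ i → c ≠ i' → c ≠ j → c ≠ j' → δ c = 0 := fun c a1 a2 a3 a4 => by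
    simp [hδ, a1, a2, a3, a4]
  let τ := Equiv.swap i i' * Equiv.swap j j'
  have ti : τ i = i' := by
    simp [τ, Equiv.swap_apply_of_ne_of_ne h1 h2]
  have ti' : τ i' = i := by
    simp [τ, Equiv.swap_apply_of_ne_of_ne h3 h4]
  have tj : τ j = j' := by
    simp [τ, Equiv.swap_apply_of_ne_of_ne h2.symm h4.symm]
  have tj' : τ j' = j := by
    simp [τ, Equiv.swap_apply_of_ne_of_ne h1.symm h3.symm]
  have t0 : ∀ c, c ≠ i → c ≠ i' → c ≠ j → c ≠ j' → τ c = c := fun c a1 a2 a3 a4 => by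
    simp [τ, Equiv.swap_apply_of_ne_of_ne, *]
  clear_value τ
  clear hδ
  have cases5 : ∀ c, c = i ∨ c = i' ∨ c = j ∨ c = j' ∨ (c ≠ i ∧ c ≠ i' ∧ c ≠ j ∧ c ≠ j') := by
    intro c; tauto
  have hs : S.Swaps τ δ := by
    refine ⟨fun c => ?_, fun c => ?_, fun c => ?_⟩
    · rcases cases5 c with rfl | rfl | rfl | rfl | ⟨a1, a2, a3, a4⟩
      · rw [ti, di, Strip.pt, hip]; push_cast; congr 1; ring
      · rw [ti', di', Strip.pt, S.proj_eq]; exact ⟨k, by push_cast; linarith⟩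
      · rw [tj, dj, Strip.pt, hjp]; push_cast; congr 1; ring
      · rw [tj', dj', Strip.pt, S.proj_eq]; exact ⟨k', by push_cast; linarith⟩
      · rw [t0 c a1 a2 a3 a4, d0 c a1 a2 a3 a4, Strip.pt]; simp
    · rcases cases5 c with rfl | rfl | rfl | rfl | ⟨a1, a2, a3, a4⟩
      · rw [ti, di, di']
      · rw [ti', di, di']; rfl
      · rw [tj, dj, dj']
      · rw [tj', dj, dj']; rfl
      · rw [t0 c a1 a2 a3 a4, d0 c a1 a2 a3 a4]; rfl
    · rcases cases5 c with rfl | rfl | rfl | rfl | ⟨a1, a2, a3, a4⟩ <;> simp [*]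
  have e1 := hs.cls_eq_mul ti di hi hip
  have e2 := hs.cls_eq_mul tj dj hj hjp
  rw [(hs.drop ti).cls_eq_elem (i := j) (j := j') (by simp [dropPair, h1.symm, h3.symm, dj])
    (by simp [dropPair, h2.symm, h4.symm, dj']) (fun c a3 a4 => by
      unfold dropPair
      split_ifs with h
      · rfl
      · rw [not_or] at h
        exact d0 c h.1 h.2 a3 a4) hj hjp] at e1
  rw [(hs.drop tj).cls_eq_elem (i := i) (j := i') (by simp [dropPair, h1, h2, di])
    (by simp [dropPair, h3, h4, di']) (fun c a1 a2 => by
      unfold dropPair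
      split_ifs with h
      · rfl
      · rw [not_or] at h
        exact d0 c a1 a2 h.1 h.2) hi hip] at e2
  exact e2.symm.trans e1

/-! ### Diagrams confined to a box of full height -/

/-- The strands `s 0, …, s (k - 1)` of the diagram `d` are the curves `F 0, …, F (k - 1)`, read on
the line, which go from the points `b, …, b + k - 1` to the same points, permuted by `ρ`; the other
strands are vertical. The double points are described by `X`. -/
structure InBox (d : Diagram S) {k : ℕ} (s : Fin k ↪ Fin S.m) (b : ℤ) (F : Fin k → I → ℝ)
    (ρ : Equiv.Perm (Fin k)) (X : Fin k → Fin k → ℝ → Prop) : Prop where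
  cont : ∀ c, Continuous (F c)
  lb : ∀ c y, b ≤ F c y
  ub : ∀ c y, F c y ≤ b + k - 1
  lift : ∀ c y, S.proj (F c y) = d.strand (s c) y
  zero : ∀ c, F c 0 = b + c
  one : ∀ c, F c 1 = b + ρ c
  out : ∀ i, i ∉ range s → ∀ y, d.strand i y = S.pt i
  cross : ∀ c c', c ≠ c' → ∀ y, F c y = F c' y ↔ X c c' y
  pos : ∀ c c' y, X c c' y → 0 < y ∧ y < 1

theorem InBox.perm {d : Diagram S} {k : ℕ} {s : Fin k ↪ Fin S.m} {b : ℤ} {F : Fin k → I → ℝ}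
    {ρ : Equiv.Perm (Fin k)} {X : Fin k → Fin k → ℝ → Prop} (h : InBox d s b F ρ X)
    (c : Fin k) : d.perm (s c) = s (ρ c) := by
  refine pt_injective S ?_
  rw [← Path.target (d.strand (s c)), ← h.lift, h.one, ← h.zero, h.lift, Path.source]

theorem InBox.perm_out {d : Diagram S} {k : ℕ} {s : Fin k ↪ Fin S.m} {b : ℤ} {F : Fin k → I → ℝ}
    {ρ : Equiv.Perm (Fin k)} {X : Fin k → Fin k → ℝ → Prop} (h : InBox d s b F ρ X)
    {i : Fin S.m} (hi : i ∉ range s) : d.perm i = i :=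
  pt_injective S ((d.strand i).target.symm.trans (h.out i hi 1))

theorem InBox.comp {d e : Diagram S} {k : ℕ} {s : Fin k ↪ Fin S.m} {b : ℤ} {F G : Fin k → I → ℝ}
    {ρ θ : Equiv.Perm (Fin k)} {X Y : Fin k → Fin k → ℝ → Prop} (h : InBox d s b F ρ X)
    (h' : InBox e s b G θ Y) : InBox (d.comp e) s b
      (fun c y => if (y : ℝ) ≤ 1 / 2 then G c (dbl y) else F (θ c) (dblSub y)) (ρ * θ)
      (fun c c' y => Y c c' (2 * y) ∨ X (θ c) (θ c') (2 * y - 1)) where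
  cont := by
    intro c
    refine Continuous.if_le ((h'.cont c).comp continuous_dbl)
      ((h.cont _).comp continuous_dblSub) (by fun_prop) continuous_const fun y hy => ?_
    rw [dbl_eq_one hy.ge, dblSub_eq_zero hy.le, h'.one, h.zero]
  lb := by
    intro c y
    split_ifs
    · exact h'.lb _ _
    · exact h.lb _ _
  ub := by
    intro c y
    split_ifs
    · exact h'.ub _ _
    · exact h.ub _ _
  lift := by
    intro c y
    split_ifs with hy
    · rw [comp_low _ _ _ hy, h'.lift]
    · rw [comp_high _ _ _ (not_le.1 hy).le, h'.perm, h.lift]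
  zero := by
    intro c
    simp [isScale_dbl.zero, h'.zero]
  one := by
    intro c
    rw [if_neg (by norm_num), isScale_dblSub.one, h.one]
    rfl
  out := by
    intro i hi y
    rcases le_total (y : ℝ) (1 / 2) with hy | hy
    · rw [comp_low _ _ _ hy, h'.out i hi]
    · rw [comp_high _ _ _ hy, h'.perm_out hi, h.out i hi]
  cross := by
    intro c c' hc y
    split_ifs with hy
    -- Crossing parameters lie strictly between `0` and `1`, so in each half only the alternative of
    -- that half can hold.
    · rw [h'.cross c c' hc, dbl_val hy, or_iff_left]
      intro hX
      linarith [(h.pos _ _ _ hX).1]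
    · rw [h.cross _ _ (θ.injective.ne hc), dblSub_val (not_le.1 hy).le, or_iff_right]
      intro hX
      linarith [(h'.pos _ _ _ hX).2]
  pos := by
    rintro c c' y (hX | hX)
    · have := h'.pos _ _ _ hX
      constructor <;> linarith
    · have := h.pos _ _ _ hX
      constructor <;> linarith

theorem inBox_elem {k : ℕ} (s : Fin k ↪ Fin S.m) (b : ℤ)
    (hs : ∀ c : Fin k, S.pt (s c) = S.proj (b + c)) {q q' : Fin k} (hq : (q' : ℕ) = q + 1)
    (hij : s q ≠ s q') (hp : S.proj ((s q' : ℝ) + 1) = S.proj ((s q : ℝ) + 2)) :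
    InBox (Diagram.elem S (s q) (s q') hij hp) s b (fun c y => b - 1 + elemLift q q' c y)
      (Equiv.swap q q')
      (fun c c' y => y = 1 / 2 ∧ ((c = q ∧ c' = q') ∨ (c = q' ∧ c' = q))) := by
  have hqq : q' ≠ q := fun e => by rw [e] at hq; omega
  have hqr : (q' : ℝ) = q + 1 := by exact_mod_cast hq
  have hk : (q : ℝ) + 2 ≤ k := by
    have : (q : ℕ) + 2 ≤ k := by omega
    exact_mod_cast this
  have hc1 : ∀ c : Fin k, (c : ℝ) + 1 ≤ k := fun c => by exact_mod_cast c.2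
  have hc0 : ∀ c : Fin k, (0 : ℝ) ≤ c := fun c => by positivity
  refine ⟨fun c => ?_, fun c y => ?_, fun c y => ?_, fun c y => ?_, fun c => ?_, fun c => ?_,
    fun i hi y => ?_, fun c c' hc y => ?_, fun c c' y h => by rw [h.1]; norm_num⟩
  · unfold elemLift
    split_ifs <;> fun_prop
  · have := y.2.1
    have := y.2.2
    have := hc0 c
    have := hc0 q
    unfold elemLift
    split_ifs <;> linarith
  · have := y.2.1
    have := y.2.2
    have := hc1 c
    unfold elemLift
    split_ifs <;> linarith
  · change _ = S.proj (elemLift (s q) (s q') (s c) y)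
    obtain ⟨n, hn⟩ := S.exists_eq_add (hs c)
    rw [S.proj_eq]
    unfold elemLift
    by_cases h1 : c = q
    · subst h1
      refine ⟨-n, ?_⟩
      simp only [if_true]
      push_cast
      linarith
    by_cases h2 : c = q'
    · subst h2
      refine ⟨-n, ?_⟩
      simp only [h1, if_false, if_true, s.injective.eq_iff]
      push_cast
      linarith
    · refine ⟨-n, ?_⟩
      simp only [h1, h2, if_false, s.injective.eq_iff]
      push_cast
      linarith
  · change b - 1 + elemLift q q' c 0 = _
    rw [elemLift_zero]
    ring
  · change b - 1 + elemLift q q' c 1 = _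
    unfold elemLift
    by_cases h1 : c = q
    · rw [if_pos h1, h1, Equiv.swap_apply_left, hqr]
      ring
    by_cases h2 : c = q'
    · rw [if_neg h1, if_pos h2, h2, Equiv.swap_apply_right, hqr]
      ring
    · rw [if_neg h1, if_neg h2, Equiv.swap_apply_of_ne_of_ne h1 h2]
      ring
  · change S.proj (elemLift (s q) (s q') i y) = _
    rw [elemLift, if_neg fun e => hi ⟨q, e.symm⟩, if_neg fun e => hi ⟨q', e.symm⟩, Strip.pt]
  · obtain ⟨m, rfl⟩ : ∃ m, k = m + 1 := ⟨k - 1, by omega⟩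
    rw [add_right_inj]
    constructor
    -- Inside the box the lifted curves are compared on the line, so the planar case, with no
    -- period, applies.
    · exact elemLift_eq (plane m) (i := (q : Fin (m + 1))) (j := (q' : Fin (m + 1)))
        (by change (q' : ℝ) + 1 = q + 2; linarith) hc y.2.1 y.2.2
    · rintro ⟨hy, ⟨rfl, rfl⟩ | ⟨rfl, rfl⟩⟩ <;> simp only [elemLift, if_true, if_neg hqq, hy] <;>
        linarith

/-- A margin of `1 / 4` keeps the arcs off the sides of the box and lets in no further marked point,
since these are integers. -/
theorem InBox.boxPicture {d : Diagram S} {k : ℕ} {s : Fin k ↪ Fin S.m} {b : ℤ} {F : Fin k → I → ℝ}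
    {ρ : Equiv.Perm (Fin k)} {X : Fin k → Fin k → ℝ → Prop} (h : InBox d s b F ρ X)
    (hs : ∀ c : Fin k, S.pt (s c) = S.proj (b + c)) (w : List (Fin k × Fin k))
    (t : Fin w.length → ℝ) (ht : StrictMono t) (ht0 : ∀ q, 0 < t q ∧ t q < 1)
    (hX : ∀ c c', c < c' → ∀ y, X c c' y ↔ ∃ q, w.get q = (c, c') ∧ t q = y) :
    BoxPicture d (b - 1 / 4) (b + k - 1 + 1 / 4) 0 1 s w := by
  refine ⟨fun i hi y _ => ?_, F, fun c => (h.cont c).continuousOn, fun c y _ => ⟨⟨?_, ?_⟩, h.lift c y⟩,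
    fun c c' hc => ?_, fun q => ⟨t q, (ht0 q).1.le, (ht0 q).2.le⟩, fun q q' hq => ht hq,
    fun q => ht0 q, fun c c' hc y _ => ?_⟩
  · rw [h.out i hi]
    rintro ⟨x, hx, e⟩
    obtain ⟨m, hm⟩ := S.exists_eq_add e
    obtain ⟨z, hz⟩ : ∃ z : ℤ, z = i + 1 + m * S.p - b := ⟨_, rfl⟩
    have hzr : (z : ℝ) = x - b := by rw [hz, hm]; push_cast; ring
    have h0 : -1 < z := by
      have : (-1 : ℝ) < z := by linarith [hx.1]
      exact_mod_cast this
    have h1 : z < k := by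
      have : (z : ℝ) < k := by linarith [hx.2]
      exact_mod_cast this
    refine hi ⟨⟨z.toNat, by omega⟩, pt_injective S ?_⟩
    rw [hs, ← e]
    congr 1
    have : ((z.toNat : ℤ) : ℝ) = z := by rw [Int.toNat_of_nonneg (by omega)]
    simp only
    rw [← Int.cast_natCast, this, hzr]
    ring
  · linarith [h.lb c y]
  · linarith [h.ub c y]
  · simp only [h.zero]
    have : (c : ℝ) < c' := by exact_mod_cast hc
    linarith
  · rw [h.cross c c' hc.ne, hX c c' hc]
    simp only [Subtype.ext_iff]

theorem InBox.localMove {d d' : Diagram S} {k : ℕ} {s : Fin k ↪ Fin S.m} {b : ℤ}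
    {F F' : Fin k → I → ℝ} {ρ ρ' : Equiv.Perm (Fin k)} {X X' : Fin k → Fin k → ℝ → Prop}
    (h : InBox d s b F ρ X) (h' : InBox d' s b F' ρ' X')
    (hs : ∀ c : Fin k, S.pt (s c) = S.proj (b + c)) (hk : S.p = 0 ∨ k ≤ S.p)
    {w w' : List (Fin k × Fin k)} (hw : MovePictures k w w')
    (t : Fin w.length → ℝ) (ht : StrictMono t) (ht0 : ∀ q, 0 < t q ∧ t q < 1)
    (hX : ∀ c c', c < c' → ∀ y, X c c' y ↔ ∃ q, w.get q = (c, c') ∧ t q = y)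
    (t' : Fin w'.length → ℝ) (ht' : StrictMono t') (ht0' : ∀ q, 0 < t' q ∧ t' q < 1)
    (hX' : ∀ c c', c < c' → ∀ y, X' c c' y ↔ ∃ q, w'.get q = (c, c') ∧ t' q = y) :
    LocalMove d d' := by
  have hk0 : 1 ≤ k := by cases hw <;> norm_num
  have hk1 : (1 : ℝ) ≤ k := by exact_mod_cast hk0
  -- The box has width `k - 1 / 2`, less than a positive period, so it embeds. The permutation `ρ⁻¹
  -- * ρ'` pairs the strands of the two diagrams with the same upper endpoint.
  refine ⟨k, w, w', hw, b - 1 / 4, b + k - 1 + 1 / 4, 0, 1, s, ρ⁻¹ * ρ', by linarith, zero_lt_one,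
    ?_, h.boxPicture hs w t ht ht0 hX, h'.boxPicture hs w' t' ht' ht0' hX', fun i hi y => ?_,
    fun i y hy => ?_, fun c y hy => ?_⟩
  · intro x hx x' hx' e
    obtain ⟨m, hm⟩ := (S.proj_eq _ _).1 e
    rcases hk with hk | hk
    · rw [hk] at hm
      push_cast at hm
      linarith
    have hkr : (k : ℝ) ≤ S.p := by exact_mod_cast hk
    have h1 : m < 1 := by
      by_contra hc
      have : (1 : ℝ) ≤ m := by exact_mod_cast not_lt.1 hc
      nlinarith [hx.2, hx'.1]
    have h2 : -1 < m := by
      by_contra hc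
      have : (m : ℝ) ≤ -1 := by exact_mod_cast not_lt.1 hc
      nlinarith [hx.1, hx'.2]
    have h3 : m = 0 := by omega
    rw [h3] at hm
    push_cast at hm
    linarith
  · rw [h.out i hi, h'.out i hi]
  · rw [le_antisymm hy bot_le, Path.source, Path.source]
  · obtain rfl : y = 1 := le_antisymm le_top hy
    rw [Path.target, Path.target, h'.perm, h.perm]
    simp

end

/-! ### The local moves between products of elementary diagrams -/

section

variable {S : Strip}

theorem localMove_two {i j : Fin S.m} (hij : i ≠ j)
    (hp : S.proj ((j : ℝ) + 1) = S.proj ((i : ℝ) + 2)) (hS : S.p = 0 ∨ 2 ≤ S.p) :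
    LocalMove ((Diagram.elem S i j hij hp).comp (Diagram.elem S i j hij hp))
      (Diagram.elem S i j hij hp) := by
  let s : Fin 2 ↪ Fin S.m := ⟨![i, j], by
    intro a b h
    fin_cases a <;> fin_cases b <;> simp_all [eq_comm]⟩
  have hs : ∀ c : Fin 2, S.pt (s c) = S.proj (((i : ℤ) + 1 : ℤ) + c) := by
    intro c
    fin_cases c
    · change S.proj ((i : ℝ) + 1) = S.proj ((((i : ℕ) : ℤ) + 1 : ℤ) + ((0 : ℕ) : ℝ))
      push_cast
      rw [add_zero]
    · change S.proj ((j : ℝ) + 1) = S.proj ((((i : ℕ) : ℤ) + 1 : ℤ) + ((1 : ℕ) : ℝ))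
      rw [hp]
      congr 1
      push_cast
      ring
  have hb := inBox_elem s _ hs (q := 0) (q' := 1) rfl hij hp
  refine (hb.comp hb).localMove hb hs hS .two ![1 / 4, 3 / 4] ?_ ?_ ?_ ![1 / 2] ?_ ?_ ?_
  · intro a b h
    fin_cases a <;> fin_cases b <;> simp at h ⊢; norm_num
  · intro a
    fin_cases a <;> norm_num
  · intro c c' hc y
    change _ ↔ ∃ q : Fin 2, _
    rw [Fin.exists_fin_two]
    fin_cases c <;> fin_cases c' <;> simp at hc ⊢
    constructor
    · rintro (h | h)
      · left; linarith
      · right; linarith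
    · rintro (h | h)
      · left; linarith
      · right; linarith
  · intro a b h
    fin_cases a; fin_cases b; simp at h
  · intro a
    fin_cases a; norm_num
  · intro c c' hc y
    change _ ↔ ∃ q : Fin 1, _
    fin_cases c <;> fin_cases c' <;> simp at hc ⊢
    rw [eq_comm]

/-- The strands `i`, `j` and `l`. -/
def embThree {m : ℕ} {i j l : Fin m} (hij : i ≠ j) (hjl : j ≠ l) (hil : i ≠ l) : Fin 3 ↪ Fin m :=
  ⟨![i, j, l], by
    intro a b h
    fin_cases a <;> fin_cases b <;> simp_all [eq_comm]⟩

theorem pt_embThree {i j l : Fin S.m} (hij : i ≠ j) (hjl : j ≠ l) (hil : i ≠ l)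
    (hp : S.proj ((j : ℝ) + 1) = S.proj ((i : ℝ) + 2))
    (hp' : S.proj ((l : ℝ) + 1) = S.proj ((j : ℝ) + 2)) (c : Fin 3) :
    S.pt (embThree hij hjl hil c) = S.proj (((i : ℤ) + 1 : ℤ) + c) := by
  obtain ⟨k, hk⟩ := S.exists_eq_add hp
  obtain ⟨k', hk'⟩ := S.exists_eq_add hp'
  fin_cases c
  · change S.proj ((i : ℝ) + 1) = _
    simp
  · change S.proj ((j : ℝ) + 1) = _
    rw [hp]
    congr 1
    simp
    ring
  · change S.proj ((l : ℝ) + 1) = _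
    rw [S.proj_eq]
    refine ⟨k + k', ?_⟩
    simp
    linarith

theorem localMove_three {i j l : Fin S.m} (hij : i ≠ j) (hjl : j ≠ l) (hil : i ≠ l)
    (hp : S.proj ((j : ℝ) + 1) = S.proj ((i : ℝ) + 2))
    (hp' : S.proj ((l : ℝ) + 1) = S.proj ((j : ℝ) + 2)) (hS : S.p = 0 ∨ 3 ≤ S.p) :
    LocalMove (((Diagram.elem S i j hij hp).comp (Diagram.elem S j l hjl hp')).comp
        (Diagram.elem S i j hij hp))
      (((Diagram.elem S j l hjl hp').comp (Diagram.elem S i j hij hp)).comp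
        (Diagram.elem S j l hjl hp')) := by
  have hs := pt_embThree hij hjl hil hp hp'
  have hx := inBox_elem (embThree hij hjl hil) _ hs (q := 0) (q' := 1) rfl hij hp
  have hy := inBox_elem (embThree hij hjl hil) _ hs (q := 1) (q' := 2) rfl hjl hp'
  -- The bottom factor fills the lower half of the product, the other two a quarter each: the
  -- crossings are at heights `1 / 4`, `5 / 8` and `7 / 8`.
  refine ((hx.comp hy).comp hx).localMove ((hy.comp hx).comp hy) hs hS .three
    ![1 / 4, 5 / 8, 7 / 8] ?_ ?_ ?_ ![1 / 4, 5 / 8, 7 / 8] ?_ ?_ ?_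
  · intro a b h
    fin_cases a <;> fin_cases b <;> simp at h ⊢ <;> norm_num
  · intro a
    fin_cases a <;> norm_num
  · intro c c' hc y
    change _ ↔ ∃ q : Fin 3, _
    rw [Fin.exists_fin_succ, Fin.exists_fin_two]
    fin_cases c <;> fin_cases c' <;> simp [Equiv.swap_apply_def] at hc ⊢
    all_goals exact ⟨fun h => by linarith, fun h => by linarith⟩
  · intro a b h
    fin_cases a <;> fin_cases b <;> simp at h ⊢ <;> norm_num
  · intro a
    fin_cases a <;> norm_num
  · intro c c' hc y
    change _ ↔ ∃ q : Fin 3, _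
    rw [Fin.exists_fin_succ, Fin.exists_fin_two]
    fin_cases c <;> fin_cases c' <;> simp [Equiv.swap_apply_def] at hc ⊢
    all_goals exact ⟨fun h => by linarith, fun h => by linarith⟩

theorem localMove_kiselman {i j l : Fin S.m} (hij : i ≠ j) (hjl : j ≠ l) (hil : i ≠ l)
    (hp : S.proj ((j : ℝ) + 1) = S.proj ((i : ℝ) + 2))
    (hp' : S.proj ((l : ℝ) + 1) = S.proj ((j : ℝ) + 2)) (hS : S.p = 0 ∨ 3 ≤ S.p) :
    LocalMove (((Diagram.elem S j l hjl hp').comp (Diagram.elem S i j hij hp)).comp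
        (Diagram.elem S j l hjl hp'))
      ((Diagram.elem S i j hij hp).comp (Diagram.elem S j l hjl hp')) := by
  have hs := pt_embThree hij hjl hil hp hp'
  have hx := inBox_elem (embThree hij hjl hil) _ hs (q := 0) (q' := 1) rfl hij hp
  have hy := inBox_elem (embThree hij hjl hil) _ hs (q := 1) (q' := 2) rfl hjl hp'
  refine ((hy.comp hx).comp hy).localMove (hx.comp hy) hs hS .kiselman
    ![1 / 4, 5 / 8, 7 / 8] ?_ ?_ ?_ ![1 / 4, 3 / 4] ?_ ?_ ?_
  · intro a b h
    fin_cases a <;> fin_cases b <;> simp at h ⊢ <;> norm_num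
  · intro a
    fin_cases a <;> norm_num
  · intro c c' hc y
    change _ ↔ ∃ q : Fin 3, _
    rw [Fin.exists_fin_succ, Fin.exists_fin_two]
    fin_cases c <;> fin_cases c' <;> simp [Equiv.swap_apply_def] at hc ⊢
    all_goals exact ⟨fun h => by linarith, fun h => by linarith⟩
  · intro a b h
    fin_cases a <;> fin_cases b <;> simp at h ⊢; norm_num
  · intro a
    fin_cases a <;> norm_num
  · intro c c' hc y
    change _ ↔ ∃ q : Fin 2, _
    rw [Fin.exists_fin_two]
    fin_cases c <;> fin_cases c' <;> simp [Equiv.swap_apply_def] at hc ⊢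
    all_goals exact ⟨fun h => by linarith, fun h => by linarith⟩

theorem elem_congr {i j i' j' : Fin S.m} (hij : i ≠ j)
    (hp : S.proj ((j : ℝ) + 1) = S.proj ((i : ℝ) + 2)) (hij' : i' ≠ j')
    (hp' : S.proj ((j' : ℝ) + 1) = S.proj ((i' : ℝ) + 2)) (hi : i = i') (hj : j = j') :
    Diagram.elem S i j hij hp = Diagram.elem S i' j' hij' hp' := by
  subst hi hj
  rfl

end

/-! ### The isomorphisms -/

theorem exists_word {M ι : Type} [Monoid M] (f : ι → M) {x : M}
    (hx : x ∈ Submonoid.closure (range f)) : ∃ w : List ι, x = (w.map f).prod := by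
  rw [← FreeMonoid.mrange_lift] at hx
  obtain ⟨w, rfl⟩ := hx
  exact ⟨FreeMonoid.toList w, FreeMonoid.lift_apply f w⟩

theorem exists_word_presentedMonoid {ι : Type} (r : FreeMonoid ι → FreeMonoid ι → Prop)
    (x : PresentedMonoid r) : ∃ w : List ι, x = (w.map (PresentedMonoid.of r)).prod :=
  exists_word _ (by rw [PresentedMonoid.closure_range_of]; trivial)

theorem linear_isomorphism (n : ℕ)
    (hsurj : Submonoid.closure (range fun i => (planeElem n i).cls) = ⊤) :
    ∃ ε : LinearHK n ≃* LinearDiagHK n,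
      ∀ i : Fin n, ε (PresentedMonoid.of (LRel n) i) = linearGen n i := by
  have hp : (plane n).p = 0 := rfl
  have move : ∀ d d' : Diagram (plane n), LocalMove d d' →
      ((d.cls : DiagramClass (plane n)) : LinearDiagHK n) = (d'.cls : DiagramClass (plane n)) :=
    fun d d' h => (Con.eq _).2 (ConGen.Rel.of _ _ ⟨d, d', rfl, rfl, h⟩)
  have hne : ∀ i : Fin n, (Fin.castSucc i : Fin (n + 1)) ≠ Fin.succ i :=
    fun i => (Fin.castSucc_lt_succ (i := i)).ne
  have hrel : ∀ a b, LRel n a b →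
      FreeMonoid.lift (linearGen n) a = FreeMonoid.lift (linearGen n) b := by
    -- The move lemmas need the two elementary diagrams to share their middle strand literally, so
    -- the next generator is rewritten with `Fin.succ i` as its left index.
    have next : ∀ i j : Fin n, (j : ℕ) = i + 1 →
        ∃ (h : (Fin.succ i : Fin (n + 1)) ≠ Fin.succ j)
          (h' : (plane n).proj (((Fin.succ j : Fin (n + 1)) : ℕ) + 1) =
            (plane n).proj (((Fin.succ i : Fin (n + 1)) : ℕ) + 2)),
          planeElem n j = Diagram.elem (plane n) (Fin.succ i : Fin (n + 1)) (Fin.succ j : Fin (n + 1))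
            h h' ∧ (Fin.castSucc i : Fin (n + 1)) ≠ Fin.succ j := by
      intro i j h
      have hji : (Fin.castSucc j : Fin (n + 1)) = Fin.succ i := Fin.ext (by simp [h])
      have h1 := hne j
      have h2 := plane_proj_next n j
      have h3 : planeElem n j = Diagram.elem (plane n) _ _ h1 h2 := rfl
      refine ⟨hji ▸ h1, hji ▸ h2, h3.trans (elem_congr _ _ _ _ hji rfl), fun e => ?_⟩
      have e' := congrArg (Fin.val (n := n + 1)) e
      simp at e'
      omega
    rintro _ _ (i | ⟨i, j, h⟩ | ⟨i, j, h⟩ | ⟨i, j, h⟩)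
    · simp only [map_mul, FreeMonoid.lift_eval_of]
      exact move _ _ (localMove_two (S := plane n) (hne i) (plane_proj_next n i) (.inl hp))
    · simp only [map_mul, FreeMonoid.lift_eval_of]
      refine congrArg (Con.mk' (linearMoves n)) (cls_elem_comm (S := plane n) (hne i)
        (plane_proj_next n i) (hne j) (plane_proj_next n j) ?_ ?_ ?_ ?_)
      all_goals
        refine fun e => ?_
        have e' := congrArg (Fin.val (n := n + 1)) e
        simp at e'
        omega
    · obtain ⟨h1, h2, h3, h4⟩ := next i j h
      simp only [map_mul, FreeMonoid.lift_eval_of, linearGen, h3]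
      exact move _ _ (localMove_three (S := plane n) (hne i) h1 h4 (plane_proj_next n i) h2 (.inl hp))
    · obtain ⟨h1, h2, h3, h4⟩ := next i j h
      simp only [map_mul, FreeMonoid.lift_eval_of, linearGen, h3]
      exact move _ _ (localMove_kiselman (S := plane n) (hne i) h1 h4 (plane_proj_next n i) h2
        (.inl hp))
  let ε : LinearHK n →* LinearDiagHK n := PresentedMonoid.lift (linearGen n) hrel
  have hε : ∀ i, ε (PresentedMonoid.of (LRel n) i) = linearGen n i := fun i =>
    PresentedMonoid.lift_of _ _
  have hword : ∀ w : List (Fin n), ε (w.map (PresentedMonoid.of (LRel n))).prod =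
      Con.mk' (linearMoves n) (w.map fun i => (planeElem n i).cls).prod := by
    intro w
    rw [map_list_prod, map_list_prod, List.map_map, List.map_map]
    congr 2
  have bij : Function.Bijective ε := by
    constructor
    · intro x y h
      obtain ⟨w, rfl⟩ := exists_word_presentedMonoid _ x
      obtain ⟨w', rfl⟩ := exists_word_presentedMonoid _ y
      rw [hword, hword] at h
      exact linear_prod_eq_of_moves n w w' ((Con.eq _).1 h)
    · intro y
      obtain ⟨y, rfl⟩ := Con.mk'_surjective y
      obtain ⟨w, rfl⟩ := exists_word (fun i => (planeElem n i).cls) (x := y) (by rw [hsurj]; trivial)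
      exact ⟨_, hword w⟩
  exact ⟨MulEquiv.ofBijective ε bij, hε⟩

theorem circular_isomorphism (n : ℕ) (hn : 3 ≤ n) (hn' : 2 ≤ n) :
    ∃ ε : CircularHK n ≃* CircularDiagHK n hn',
      ∀ i : Fin n, ε (PresentedMonoid.of (CRel n) i) = circularGen n hn' i := by
  have hpos : 0 < n := by omega
  have hp : (cylinder n).p = 0 ∨ 3 ≤ (cylinder n).p := .inr hn
  have hp' : (cylinder n).p = 0 ∨ 2 ≤ (cylinder n).p := .inr hn'
  let g : Fin n → cylinderMonoid n hn' := fun i =>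
    ⟨(cylinderElem n hn' i).cls, Submonoid.subset_closure ⟨i, rfl⟩⟩
  have move : ∀ (x y : cylinderMonoid n hn') (d d' : Diagram (cylinder n)),
      d.cls = (x : DiagramClass (cylinder n)) → d'.cls = (y : DiagramClass (cylinder n)) →
      LocalMove d d' → (x : CircularDiagHK n hn') = (y : CircularDiagHK n hn') :=
    fun x y d d' hx hy h => (Con.eq _).2 (ConGen.Rel.of _ _ ⟨d, d', hx, hy, h⟩)
  have next : ∀ i : Fin n, ((i : ℕ) + 1) % n = if (i : ℕ) + 1 = n then 0 else (i : ℕ) + 1 := by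
    intro i
    split_ifs with h
    · rw [h, Nat.mod_self]
    · exact Nat.mod_eq_of_lt (by omega)
  -- Three consecutive marked points of the circle are distinct because `3 ≤ n`.
  have hil : ∀ i : Fin n, i ≠ (⟨(((i : ℕ) + 1) % n + 1) % n, Nat.mod_lt _ (by omega)⟩ : Fin n) := by
    intro i e
    have e' := congrArg Fin.val e
    have h1 := next i
    have h2 := next ⟨((i : ℕ) + 1) % n, Nat.mod_lt _ (by omega)⟩
    simp only at e' h2
    rw [h2] at e'
    split_ifs at * <;> omega
  have hrel : ∀ a b, CRel n a b →
      FreeMonoid.lift (circularGen n hn') a = FreeMonoid.lift (circularGen n hn') b := by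
    rintro _ _ (i | ⟨i, j, h, h'⟩ | ⟨i, j, h⟩ | ⟨i, j, h⟩)
    · simp only [map_mul, FreeMonoid.lift_eval_of]
      exact move (g i * g i) (g i) _ _ rfl rfl
        (localMove_two (S := cylinder n) (cylinder_ne_next hn' i) (cylinder_proj_next hn' i) hp')
    · simp only [map_mul, FreeMonoid.lift_eval_of]
      refine congrArg (Con.mk' (circularMoves n hn')) (a₁ := g i * g j) (a₂ := g j * g i)
        (Subtype.ext ?_)
      have hi := next i
      have hj := next j
      have hi' := i.2
      have key : (i : ℕ) ≠ j ∧ (i : ℕ) ≠ ((j : ℕ) + 1) % n ∧ ((i : ℕ) + 1) % n ≠ j ∧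
          ((i : ℕ) + 1) % n ≠ ((j : ℕ) + 1) % n := by
        rw [hi, hj]
        split_ifs <;> omega
      exact cls_elem_comm (S := cylinder n) (cylinder_ne_next hn' i)
        (cylinder_proj_next hn' i) (cylinder_ne_next hn' j) (cylinder_proj_next hn' j)
        (fun e => key.1 (congrArg (Fin.val (n := n)) e))
        (fun e => key.2.1 (congrArg (Fin.val (n := n)) e))
        (fun e => key.2.2.1 (congrArg (Fin.val (n := n)) e))
        (fun e => key.2.2.2 (congrArg (Fin.val (n := n)) e))
    · obtain rfl : j = ⟨((i : ℕ) + 1) % n, Nat.mod_lt _ hpos⟩ := Fin.ext h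
      simp only [map_mul, FreeMonoid.lift_eval_of]
      exact move (g i * g _ * g i) (g _ * g i * g _) _ _ rfl rfl
        (localMove_three (S := cylinder n) (cylinder_ne_next hn' i) (cylinder_ne_next hn' _) (hil i)
          (cylinder_proj_next hn' i) (cylinder_proj_next hn' _) hp)
    · obtain rfl : j = ⟨((i : ℕ) + 1) % n, Nat.mod_lt _ hpos⟩ := Fin.ext h
      simp only [map_mul, FreeMonoid.lift_eval_of]
      exact move (g _ * g i * g _) (g i * g _) _ _ rfl rfl
        (localMove_kiselman (S := cylinder n) (cylinder_ne_next hn' i) (cylinder_ne_next hn' _)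
          (hil i) (cylinder_proj_next hn' i) (cylinder_proj_next hn' _) hp)
  let ε : CircularHK n →* CircularDiagHK n hn' := PresentedMonoid.lift (circularGen n hn') hrel
  have hε : ∀ i, ε (PresentedMonoid.of (CRel n) i) = circularGen n hn' i := fun i =>
    PresentedMonoid.lift_of _ _
  have hword : ∀ w : List (Fin n), ε (w.map (PresentedMonoid.of (CRel n))).prod =
      Con.mk' (circularMoves n hn') (w.map g).prod := by
    intro w
    rw [map_list_prod, map_list_prod, List.map_map, List.map_map]
    congr 2
  have hg : ∀ w : List (Fin n), ((w.map g).prod : DiagramClass (cylinder n)) =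
      (w.map fun i => (cylinderElem n hn' i).cls).prod := by
    intro w
    rw [Submonoid.coe_list_prod, List.map_map]
    rfl
  have bij : Function.Bijective ε := by
    constructor
    · intro x y h
      obtain ⟨w, rfl⟩ := exists_word_presentedMonoid _ x
      obtain ⟨w', rfl⟩ := exists_word_presentedMonoid _ y
      rw [hword, hword] at h
      exact circular_prod_eq_of_moves n hn hn' w w' (hg w) (hg w') ((Con.eq _).1 h)
    · intro y
      obtain ⟨⟨y, hy⟩, rfl⟩ := Con.mk'_surjective y
      obtain ⟨w, rfl⟩ := exists_word _ hy
      refine ⟨_, (hword w).trans (congrArg _ (Subtype.ext (hg w)))⟩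
  exact ⟨MulEquiv.ofBijective ε bij, hε⟩

/-! ### Planar diagrams and the order of their strands -/

theorem lerp_lt_lerp_iff {a b a' b' t : ℝ} (h0 : 0 ≤ t) (h1 : t ≤ 1) (h : a < b ↔ a' < b')
    (h' : b < a ↔ b' < a') : (1 - t) * a + t * a' < (1 - t) * b + t * b' ↔ a < b := by
  rcases lt_trichotomy a b with hab | hab | hab
  · have := h.1 hab
    refine iff_of_true ?_ hab
    rcases h0.eq_or_lt with rfl | h0
    · linarith
    · nlinarith
  · have : a' = b' := le_antisymm (not_lt.1 fun e => (h'.2 e).ne' hab) (not_lt.1 fun e => (h.2 e).ne hab)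
    subst hab this
    simp
  · have := h'.1 hab
    refine iff_of_false (not_lt.2 ?_) hab.not_gt
    nlinarith

theorem eq_iff_of_lt_iff {a b a' b' : ℝ} (h : a < b ↔ a' < b') (h' : b < a ↔ b' < a') :
    a = b ↔ a' = b' := by
  rw [le_antisymm_iff, le_antisymm_iff, ← not_lt, ← not_lt, ← not_lt, ← not_lt, h, h']

section

variable {n : ℕ}

/-- The abscissa of the strand `i` of a planar diagram at the height `y`. -/
def Diagram.abscissa (d : Diagram (plane n)) (i : Fin (n + 1)) (y : I) : ℝ := d.strand i y

theorem Diagram.continuous_abscissa (d : Diagram (plane n)) (i : Fin (n + 1)) :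
    Continuous (d.abscissa i) := (d.strand i).continuous

theorem Diagram.abscissa_zero (d : Diagram (plane n)) (i : Fin (n + 1)) :
    d.abscissa i 0 = i + 1 := (d.strand i).source

theorem Diagram.abscissa_one (d : Diagram (plane n)) (i : Fin (n + 1)) :
    d.abscissa i 1 = (d.perm i : Fin (n + 1)) + 1 := (d.strand i).target

theorem Diagram.abscissa_exchange (d : Diagram (plane n)) {i j : Fin (n + 1)} (hij : i ≠ j) {y : I}
    (h : d.abscissa i y = d.abscissa j y) :
    ((∀ᶠ z in 𝓝[<] y, d.abscissa i z < d.abscissa j z) ∧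
      (∀ᶠ z in 𝓝[>] y, d.abscissa j z < d.abscissa i z)) ∨
    ((∀ᶠ z in 𝓝[<] y, d.abscissa j z < d.abscissa i z) ∧
      (∀ᶠ z in 𝓝[>] y, d.abscissa i z < d.abscissa j z)) := by
  obtain ⟨F, G, -, -, -, hl, hc⟩ := d.crosses i j hij y h
  have hF : ∀ᶠ z in 𝓝 y, F z = d.abscissa i z ∧ G z = d.abscissa j z := hl
  have hF' := nhdsWithin_le_nhds (s := Iio y) hF
  have hF'' := nhdsWithin_le_nhds (s := Ioi y) hF
  rcases hc with ⟨h1, h2⟩ | ⟨h1, h2⟩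
  · refine .inl ⟨?_, ?_⟩
    · filter_upwards [h1, hF'] with z hz e
      rwa [← e.1, ← e.2]
    · filter_upwards [h2, hF''] with z hz e
      rwa [← e.1, ← e.2]
  · refine .inr ⟨?_, ?_⟩
    · filter_upwards [h1, hF'] with z hz e
      rwa [← e.1, ← e.2]
    · filter_upwards [h2, hF''] with z hz e
      rwa [← e.1, ← e.2]

/-- The planar diagram with the strands `f i`, which are ordered at each height in the same way as
those of `d`. -/
def Diagram.reshape (d : Diagram (plane n)) (f : Fin (n + 1) → I → ℝ) (hf : ∀ i, Continuous (f i))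
    (h0 : ∀ i, f i 0 = i + 1) (h1 : ∀ i, f i 1 = (d.perm i : Fin (n + 1)) + 1)
    (hlt : ∀ i j y, f i y < f j y ↔ d.abscissa i y < d.abscissa j y) : Diagram (plane n) where
  perm := d.perm
  strand := fun i =>
    { toFun := f i
      continuous_toFun := hf i
      source' := h0 i
      target' := h1 i }
  finite_double := fun i j hij => (d.finite_double i j hij).subset fun y hy =>
    (eq_iff_of_lt_iff (hlt i j y) (hlt j i y)).1 hy
  no_triple := fun i j k h h' h'' y hy => d.no_triple i j k h h' h'' y
    ⟨(eq_iff_of_lt_iff (hlt i j y) (hlt j i y)).1 hy.1,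
      (eq_iff_of_lt_iff (hlt j k y) (hlt k j y)).1 hy.2⟩
  crosses := by
    intro i j hij y hy
    have key := (eq_iff_of_lt_iff (hlt i j y) (hlt j i y)).1 hy
    refine ⟨f i, f j, (hf i).continuousAt, (hf j).continuousAt, hy,
      Filter.Eventually.of_forall fun z => ⟨rfl, rfl⟩, ?_⟩
    exact (d.abscissa_exchange hij key).imp
      (fun h => ⟨h.1.mono fun z => (hlt i j z).2, h.2.mono fun z => (hlt j i z).2⟩)
      (fun h => ⟨h.1.mono fun z => (hlt j i z).2, h.2.mono fun z => (hlt i j z).2⟩)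

/-- The composite of one permutation with the inverse of the other is strictly monotone and
surjective, hence the identity. -/
theorem perm_eq_of_lt_iff {m : ℕ} {τ θ : Equiv.Perm (Fin m)} (h : ∀ i j, τ i < τ j ↔ θ i < θ j) :
    τ = θ := by
  have h1 : StrictMono fun c => τ (θ.symm c) := fun a b hab => by
    rw [h]
    simpa using hab
  have h2 : (fun c => τ (θ.symm c)) = id := (h1.range_inj strictMono_id).1 (by
    rw [range_id]
    exact (τ.surjective.comp θ.symm.surjective).range_eq)
  ext i
  have := congrFun h2 (θ i)
  simp only [Equiv.symm_apply_apply, id] at this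
  rw [this]

theorem Diagram.perm_lt_iff (d : Diagram (plane n)) (i j : Fin (n + 1)) :
    (d.perm i : Fin (n + 1)) < d.perm j ↔ d.abscissa i 1 < d.abscissa j 1 := by
  rw [d.abscissa_one, d.abscissa_one, add_lt_add_iff_right, Nat.cast_lt]
  rfl

/-- Linear interpolation between strands keeps their order at every height, so the double points
stay at constant heights. -/
theorem isotopic_of_lt_iff {d d' : Diagram (plane n)}
    (h : ∀ i j y, d.abscissa i y < d.abscissa j y ↔ d'.abscissa i y < d'.abscissa j y) :
    Isotopic d d' := by
  have hperm : d.perm = d'.perm := perm_eq_of_lt_iff (m := n + 1) fun i j => by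
    exact (d.perm_lt_iff i j).trans ((h i j 1).trans (d'.perm_lt_iff i j).symm)
  have hlt : ∀ (t : I) i j y, (1 - t : ℝ) * d.abscissa i y + t * d'.abscissa i y <
      (1 - t : ℝ) * d.abscissa j y + t * d'.abscissa j y ↔ d.abscissa i y < d.abscissa j y :=
    fun t i j y => lerp_lt_lerp_iff t.2.1 t.2.2 (h i j y) (h j i y)
  refine ⟨fun t => d.reshape (fun i y => (1 - t : ℝ) * d.abscissa i y + t * d'.abscissa i y)
    (fun i => ?_) (fun i => ?_) (fun i => ?_) (hlt t), fun _ => rfl, fun i => ?_, fun i y => ?_,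
    fun i y => ?_, fun i j hij => ?_⟩
  · have := d.continuous_abscissa i
    have := d'.continuous_abscissa i
    fun_prop
  · rw [d.abscissa_zero, d'.abscissa_zero]
    ring
  · rw [d.abscissa_one, d'.abscissa_one, hperm]
    ring
  · have h1 := d.continuous_abscissa i
    have h2 := d'.continuous_abscissa i
    change Continuous fun q : I × I => (1 - q.1 : ℝ) * d.abscissa i q.2 + q.1 * d'.abscissa i q.2
    fun_prop
  · change (1 - ((0 : I) : ℝ)) * d.abscissa i y + ((0 : I) : ℝ) * d'.abscissa i y = d.abscissa i y
    simp
  · change (1 - ((1 : I) : ℝ)) * d.abscissa i y + ((1 : I) : ℝ) * d'.abscissa i y = d'.abscissa i y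
    simp
  · refine ⟨{y : I // d.strand i y = d.strand j y}, (d.finite_double i j hij).to_subtype,
      fun a _ => a.1, fun _ => continuous_const, fun t => ⟨Subtype.val_injective, ?_⟩⟩
    refine Subtype.range_val.trans ?_
    ext y
    exact (eq_iff_of_lt_iff (hlt t i j y) (hlt t j i y)).symm

theorem Diagram.lt_iff_of_free (d : Diagram (plane n)) {s : Set I} (hs : IsPreconnected s)
    (hfree : ∀ z ∈ s, z ∉ d.heights) {y z : I} (hy : y ∈ s) (hz : z ∈ s) (i j : Fin (n + 1)) :
    d.abscissa i y < d.abscissa j y ↔ d.abscissa i z < d.abscissa j z := by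
  rcases eq_or_ne i j with rfl | hij
  · simp
  have hne : ∀ x ∈ s, d.abscissa i x ≠ d.abscissa j x := fun x hx e => hfree x hx ⟨i, j, hij, e⟩
  exact ⟨lt_of_continuousOn_ne hs (d.continuous_abscissa i).continuousOn
      (d.continuous_abscissa j).continuousOn hne hy hz,
    lt_of_continuousOn_ne hs (d.continuous_abscissa i).continuousOn
      (d.continuous_abscissa j).continuousOn hne hz hy⟩

/-- Near a height without double points, the strands can be moved to the marked points. -/
theorem Diagram.exists_pinch (d : Diagram (plane n)) {a : I} (h0 : 0 < a) (h1 : a < 1)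
    (ha : a ∉ d.heights) : ∃ (e : Diagram (plane n)) (θ : Equiv.Perm (Fin (n + 1))),
      Isotopic d e ∧ e.heights = d.heights ∧ ∀ i, e.strand i a = (plane n).pt (θ i) := by
  obtain ⟨l, hl, hfl⟩ := exists_free_left d.finite_heights h0
  obtain ⟨r, hr, hfr⟩ := exists_free_right d.finite_heights h1
  have hfree : ∀ z ∈ Ioo l r, z ∉ d.heights := by
    intro z hz
    rcases lt_trichotomy z a with h | rfl | h
    · exact hfl z ⟨hz.1, h⟩
    · exact ha
    · exact hfr z ⟨h, hz.2⟩
  -- A Urysohn function supported near `a` with value `1` at `a`: it bends each strand towards the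
  -- marked point given by its rank at the height `a`. The order is constant on `(l, r)`, so it is
  -- preserved.
  obtain ⟨lam, hout, hin, hI⟩ := exists_continuous_zero_one_of_isClosed
    (isOpen_Ioo (a := l) (b := r)).isClosed_compl (isClosed_singleton (x := a))
    (disjoint_singleton_right.2 fun h => h ⟨hl, hr⟩)
  have hinj : Function.Injective fun i => d.abscissa i a := fun i j e => by
    by_contra hij
    exact ha ⟨i, j, hij, e⟩
  let ρ := Tuple.sort fun i => d.abscissa i a
  have hmono : StrictMono fun i => d.abscissa (ρ i) a :=
    (Tuple.monotone_sort fun i => d.abscissa i a).strictMono_of_injective (hinj.comp ρ.injective)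
  have hθ : ∀ i j, d.abscissa i a < d.abscissa j a ↔ ρ.symm i < ρ.symm j := fun i j => by
    have := hmono.lt_iff_lt (a := ρ.symm i) (b := ρ.symm j)
    simpa using this
  have hz : ∀ y, y ∉ Ioo l r → lam y = 0 := fun y hy => hout hy
  have hθ' : ∀ i j, d.abscissa i a < d.abscissa j a ↔ ((ρ.symm i : ℝ) + 1 < ρ.symm j + 1) :=
    fun i j => by rw [hθ, add_lt_add_iff_right, Nat.cast_lt, Fin.lt_def]
  have hlt : ∀ i j y, (1 - lam y) * d.abscissa i y + lam y * ((ρ.symm i : ℝ) + 1) <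
      (1 - lam y) * d.abscissa j y + lam y * ((ρ.symm j : ℝ) + 1) ↔
        d.abscissa i y < d.abscissa j y := by
    intro i j y
    by_cases hy : y ∈ Ioo l r
    · have hs := fun i j => d.lt_iff_of_free isPreconnected_Ioo hfree hy ⟨hl, hr⟩ i j
      exact lerp_lt_lerp_iff (hI y).1 (hI y).2 ((hs i j).trans (hθ' i j)) ((hs j i).trans (hθ' j i))
    · rw [hz y hy]
      simp
  have z0 : lam 0 = 0 := hz 0 fun h => not_lt.2 bot_le h.1
  have z1 : lam 1 = 0 := hz 1 fun h => not_lt.2 le_top h.2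
  let e := d.reshape (fun i y => (1 - lam y) * d.abscissa i y + lam y * ((ρ.symm i : ℝ) + 1))
    (fun i => by
      have := d.continuous_abscissa i
      fun_prop) (fun i => by rw [z0, d.abscissa_zero]; ring)
    (fun i => by rw [z1, d.abscissa_one]; ring) hlt
  have he : ∀ i j y, e.abscissa i y < e.abscissa j y ↔ d.abscissa i y < d.abscissa j y := hlt
  refine ⟨e, ρ.symm, isotopic_of_lt_iff fun i j y => (he i j y).symm, ?_, fun i => ?_⟩
  · ext y
    refine exists_congr fun i => exists_congr fun j => and_congr_right fun _ => ?_
    exact eq_iff_of_lt_iff (he i j y) (he j i y)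
  · change (1 - lam a) * d.abscissa i a + lam a * ((ρ.symm i : ℝ) + 1) = (ρ.symm i : ℝ) + 1
    have : lam a = 1 := hin rfl
    rw [this]
    ring

end

/-! ### Cutting a diagram -/

/-- The affine map of the unit interval onto `[a, b]`. -/
noncomputable def segmentMap {a b : I} (h : a < b) (y : I) : I :=
  ⟨a + (b - a) * y, by
    have h' : (a : ℝ) < b := h
    have := a.2.1
    have := b.2.2
    have := y.2.1
    have := y.2.2
    constructor <;> nlinarith⟩

theorem continuous_segmentMap {a b : I} (h : a < b) : Continuous (segmentMap h) := by
  unfold segmentMap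
  fun_prop

theorem strictMono_segmentMap {a b : I} (h : a < b) : StrictMono (segmentMap h) := by
  intro y z hyz
  have h' : (a : ℝ) < b := h
  have hyz' : (y : ℝ) < z := hyz
  refine Subtype.coe_lt_coe.1 ?_
  change (a : ℝ) + (b - a) * y < a + (b - a) * z
  nlinarith

theorem segmentMap_mem {a b : I} (h : a < b) (y : I) : segmentMap h y ∈ Icc a b := by
  have h' : (a : ℝ) < b := h
  have := y.2.1
  have := y.2.2
  constructor
  · refine Subtype.coe_le_coe.1 ?_
    change (a : ℝ) ≤ a + (b - a) * y
    nlinarith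
  · refine Subtype.coe_le_coe.1 ?_
    change (a : ℝ) + (b - a) * y ≤ b
    nlinarith

section

variable {S : Strip}

/-- The part of the diagram `d` which lies between two heights `a` and `b`, at which the strands go
through the marked points. -/
noncomputable def Diagram.segment (d : Diagram S) {a b : I} (h : a < b) {α β : Equiv.Perm (Fin S.m)}
    (hα : ∀ i, d.strand i a = S.pt (α i)) (hβ : ∀ i, d.strand i b = S.pt (β i)) : Diagram S where
  perm := β * α⁻¹
  strand := fun i =>
    { toFun := fun y => d.strand (α⁻¹ i) (segmentMap h y)
      continuous_toFun := (d.strand _).continuous.comp (continuous_segmentMap h)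
      source' := by
        have : segmentMap h 0 = a := Subtype.ext (by simp [segmentMap])
        rw [this, hα]
        simp
      target' := by
        have : segmentMap h 1 = b := Subtype.ext (by simp [segmentMap])
        rw [this, hβ]
        simp }
  finite_double := fun i j hij =>
    Finite.of_finite_image ((d.finite_double _ _ (α⁻¹.injective.ne hij)).subset (by
      rintro _ ⟨y, hy, rfl⟩
      exact hy)) (strictMono_segmentMap h).injective.injOn
  no_triple := fun i j k h1 h2 h3 y hy => d.no_triple _ _ _ (α⁻¹.injective.ne h1)
    (α⁻¹.injective.ne h2) (α⁻¹.injective.ne h3) _ hy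
  crosses := fun i j hij y hy => (d.crosses _ _ (α⁻¹.injective.ne hij) _ hy).comp
    (continuous_segmentMap h).continuousAt
    (Filter.eventually_of_mem self_mem_nhdsWithin fun _ hz => strictMono_segmentMap h hz)
    (Filter.eventually_of_mem self_mem_nhdsWithin fun _ hz => strictMono_segmentMap h hz)
    (Filter.Eventually.of_forall fun _ => rfl) (Filter.Eventually.of_forall fun _ => rfl)

theorem Diagram.ncard_heights_segment_lt (d : Diagram S) {a b : I} (h : a < b)
    {α β : Equiv.Perm (Fin S.m)} (hα : ∀ i, d.strand i a = S.pt (α i))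
    (hβ : ∀ i, d.strand i b = S.pt (β i)) {y : I} (hy : y ∈ d.heights) (hy' : y ∉ Icc a b) :
    (d.segment h hα hβ).heights.ncard < d.heights.ncard := by
  rw [← ncard_image_of_injective _ (strictMono_segmentMap h).injective]
  refine ncard_lt_ncard ((ssubset_iff_of_subset ?_).2 ⟨y, hy, ?_⟩) d.finite_heights
  · rintro _ ⟨z, ⟨i, j, hij, e⟩, rfl⟩
    exact ⟨_, _, α⁻¹.injective.ne hij, e⟩
  · rintro ⟨z, -, rfl⟩
    exact hy' (segmentMap_mem h z)

/-- The scale which sends `1 / 2` to `a`. -/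
noncomputable def cutScale (a y : I) : I :=
  ⟨a * dbl y + (1 - a) * dblSub y, by
    have := a.2.1
    have := a.2.2
    have := (dbl y).2.1
    have := (dbl y).2.2
    have := (dblSub y).2.1
    have := (dblSub y).2.2
    constructor <;> nlinarith⟩

theorem isScale_cutScale {a : I} (h0 : 0 < a) (h1 : a < 1) : IsScale (cutScale a) := by
  have h0' : (0 : ℝ) < a := h0
  have h1' : (a : ℝ) < 1 := h1
  have hm : StrictMono (cutScale a) := by
    intro y z hyz
    have hyz' : (y : ℝ) < z := hyz
    have m1 : (dbl y : ℝ) ≤ dbl z := isScale_dbl.mono hyz.le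
    have m2 : (dblSub y : ℝ) ≤ dblSub z := isScale_dblSub.mono hyz.le
    refine Subtype.coe_lt_coe.1 ?_
    change (a : ℝ) * dbl y + (1 - a) * dblSub y < a * dbl z + (1 - a) * dblSub z
    rcases lt_or_ge (y : ℝ) (1 / 2) with hy | hy
    · have : (dbl y : ℝ) < dbl z := by
        rcases le_total (z : ℝ) (1 / 2) with hz | hz
        · rw [dbl_val hy.le, dbl_val hz]
          linarith
        · rw [dbl_val hy.le, dbl_eq_one hz]
          change 2 * (y : ℝ) < 1
          linarith
      nlinarith
    · have : (dblSub y : ℝ) < dblSub z := by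
        rw [dblSub_val hy, dblSub_val (by linarith)]
        linarith
      nlinarith
  refine ⟨?_, ?_, ?_, hm.monotone, fun y z e _ _ => hm.injective e⟩
  · have := continuous_dbl
    have := continuous_dblSub
    unfold cutScale
    fun_prop
  · exact Subtype.ext (by simp [cutScale, isScale_dbl.zero, isScale_dblSub.zero])
  · exact Subtype.ext (by simp [cutScale, isScale_dbl.one, isScale_dblSub.one])

/-- The product of the two pieces is the diagram itself, up to the scale which moves `1 / 2` to the
cutting height. -/
theorem Diagram.cls_eq_mul_segment (d : Diagram S) {a : I} (h0 : 0 < a) (h1 : a < 1)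
    {θ : Equiv.Perm (Fin S.m)} (hθ : ∀ i, d.strand i a = S.pt (θ i)) :
    d.cls = (d.segment h1 hθ (β := d.perm) fun i => (d.strand i).target).cls *
      (d.segment h0 (α := 1) (fun i => (d.strand i).source) hθ).cls := by
  refine cls_eq (isotopic_rescale _ _ _ (isScale_cutScale h0 h1) fun i y => ?_)
  rcases le_total (y : ℝ) (1 / 2) with hy | hy
  · rw [comp_low _ _ _ hy]
    change d.strand ((1 : Equiv.Perm (Fin S.m))⁻¹ i) _ = _
    rw [inv_one, Equiv.Perm.one_apply]
    congr 1
    refine Subtype.ext ?_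
    simp [segmentMap, cutScale, dblSub_eq_zero hy]
  · rw [comp_high _ _ _ hy]
    change d.strand (θ⁻¹ ((θ * 1⁻¹) i)) _ = _
    have : θ⁻¹ ((θ * 1⁻¹) i) = i := by simp
    rw [this]
    congr 1
    refine Subtype.ext ?_
    simp [segmentMap, cutScale, dbl_eq_one hy]

end

/-! ### Generation by the elementary diagrams -/

/-- Induction on the number of exchanged pairs, extracting one elementary diagram at a time; in the
plane the partner of a strand moving right is the next marked point. -/
theorem swaps_mem_closure {n : ℕ} {τ : Equiv.Perm (Fin (plane n).m)} {δ : Fin (plane n).m → ℤ}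
    (h : (plane n).Swaps τ δ) :
    h.diagram.cls ∈ Submonoid.closure (range fun i => (planeElem n i).cls) := by
  obtain ⟨N, hN⟩ : ∃ N, {c | δ c = 1}.ncard = N := ⟨_, rfl⟩
  induction N using Nat.strong_induction_on generalizing τ δ with
  | _ N ih =>
    by_cases hδ : ∃ i, δ i = 1
    · obtain ⟨i, hi⟩ := hδ
      have ht : ((i : ℕ) : ℝ) + 1 + δ i = ((τ i : Fin (n + 1)) : ℕ) + 1 := h.target i
      have ht' : ((τ i : Fin (n + 1)) : ℕ) = (i : ℕ) + 1 := by
        have : (((τ i : Fin (n + 1)) : ℕ) : ℝ) = (i : ℕ) + 1 := by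
          rw [hi] at ht
          push_cast at ht
          linarith
        exact_mod_cast this
      have hin : (i : ℕ) < n := by
        have := (τ i).2
        change _ < n + 1 at this
        omega
      obtain ⟨q, rfl⟩ : ∃ q : Fin n, i = (Fin.castSucc q : Fin (n + 1)) :=
        ⟨⟨i, hin⟩, Fin.ext rfl⟩
      have hq : τ (Fin.castSucc q : Fin (n + 1)) = (Fin.succ q : Fin (n + 1)) :=
        Fin.ext (by simpa using ht')
      rw [h.cls_eq_mul hq hi (Fin.castSucc_lt_succ (i := q)).ne (plane_proj_next n q)]
      refine mul_mem (ih _ ?_ (h.drop hq) rfl) (Submonoid.subset_closure ⟨q, rfl⟩)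
      rw [← hN]
      refine ncard_lt_ncard ((ssubset_iff_of_subset fun c hc => ?_).2
        ⟨(Fin.castSucc q : Fin (n + 1)), hi, ?_⟩) (toFinite _)
      · by_contra hc'
        simp only [mem_ofPred_eq, dropPair] at hc hc'
        split_ifs at hc
        · omega
        · exact hc' hc
      · intro hc
        have hc' : dropPair δ (Fin.castSucc q : Fin (n + 1)) (Fin.succ q : Fin (n + 1))
          (Fin.castSucc q : Fin (n + 1)) = 1 := hc
        have h0 : dropPair δ (Fin.castSucc q : Fin (n + 1)) (Fin.succ q : Fin (n + 1))
          (Fin.castSucc q : Fin (n + 1)) = 0 := if_pos (.inl rfl)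
        exact zero_ne_one (h0.symm.trans hc')
    · have h0 : ∀ c, δ c = 0 := by
        intro c
        rcases h.bound c with e | e | e
        · exact e
        · exact absurd ⟨c, e⟩ hδ
        · exact absurd ⟨τ c, by rw [h.anti, e]; rfl⟩ hδ
      have : h.diagram.cls = 1 := (cls_eq (isotopic_of_strand_eq fun c y => by
        change (plane n).proj (swapLift δ (fun _ => id) c y) = (plane n).pt c
        rw [swapLift, h0]
        simp [Strip.pt])).symm
      rw [this]
      exact one_mem _

/-! ### Diagrams with at most one height of double points -/

/-- A scale which sends `a` to `1 / 2`. -/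
noncomputable def halfScale {a : I} (h0 : 0 < a) (h1 : a < 1) (y : I) : I :=
  ⟨y * (1 - a) / (y * (1 - a) + a * (1 - y)), by
    have h0' : (0 : ℝ) < a := h0
    have h1' : (a : ℝ) < 1 := h1
    have b0 : 0 ≤ (y : ℝ) * (1 - a) := mul_nonneg y.2.1 (by linarith)
    have b1 : 0 ≤ (a : ℝ) * (1 - y) := mul_nonneg h0'.le (by linarith [y.2.2])
    exact ⟨by positivity, div_le_one_of_le₀ (by linarith) (by linarith)⟩⟩

theorem halfScale_spec {a : I} (h0 : 0 < a) (h1 : a < 1) :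
    IsScale (halfScale h0 h1) ∧ StrictMono (halfScale h0 h1) ∧ (halfScale h0 h1 a : ℝ) = 1 / 2 := by
  have h0' : (0 : ℝ) < a := h0
  have h1' : (a : ℝ) < 1 := h1
  have pos : ∀ y : I, 0 < (y : ℝ) * (1 - a) + a * (1 - y) := by
    intro y
    rcases y.2.1.eq_or_lt with e | e
    · rw [← e]; linarith
    · have b0 : 0 < (y : ℝ) * (1 - a) := mul_pos e (by linarith)
      have b1 : 0 ≤ (a : ℝ) * (1 - y) := mul_nonneg h0'.le (by linarith [y.2.2])
      linarith
  have hm : StrictMono (halfScale h0 h1) := by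
    intro y z hyz
    have hyz' : (y : ℝ) < z := hyz
    refine Subtype.coe_lt_coe.1 ?_
    change (y : ℝ) * (1 - a) / _ < (z : ℝ) * (1 - a) / _
    rw [div_lt_div_iff₀ (pos y) (pos z)]
    have : 0 < (z - y : ℝ) * (a * (1 - a)) := mul_pos (by linarith) (mul_pos h0' (by linarith))
    linarith
  refine ⟨⟨?_, ?_, ?_, hm.monotone, fun y z e _ _ => hm.injective e⟩, hm, ?_⟩
  · refine Continuous.subtype_mk (Continuous.div (by fun_prop) (by fun_prop) fun y => (pos y).ne') _
  · exact Subtype.ext (by simp [halfScale])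
  · refine Subtype.ext ?_
    change (1 : ℝ) * (1 - a) / (1 * (1 - a) + a * (1 - 1)) = 1
    have : (1 : ℝ) - a ≠ 0 := by linarith
    rw [sub_self, mul_zero, add_zero, one_mul, div_self this]
  · change (a : ℝ) * (1 - a) / (a * (1 - a) + a * (1 - a)) = 1 / 2
    have : (1 : ℝ) - a ≠ 0 := by linarith
    have : (a : ℝ) ≠ 0 := h0'.ne'
    field_simp
    ring

/-- With no triple point, the strands meeting at `a` form disjoint pairs, and they can only be
neighbours. So the strands are ordered at every height as in a simultaneous exchange, rescaled to
take place at `a`. -/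
theorem mem_closure_of_heights_subset {n : ℕ} (d : Diagram (plane n)) {a : I} (h0 : 0 < a) (h1 : a < 1)
    (ha : d.heights ⊆ {a}) :
    d.cls ∈ Submonoid.closure (range fun i => (planeElem n i).cls) := by
  classical
  have hone : ∀ {y}, y ≠ a → y ∉ d.heights := fun hy h => hy (ha h)
  have zero_lt : ∀ i j : Fin (n + 1), d.abscissa i 0 < d.abscissa j 0 ↔ i < j := fun i j => by
    rw [d.abscissa_zero, d.abscissa_zero, add_lt_add_iff_right, Nat.cast_lt, Fin.lt_def]
  obtain ⟨x, hx⟩ : ∃ x : Fin (n + 1) → ℝ, x = fun i => d.abscissa i a := ⟨_, rfl⟩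
  have hxa : ∀ i, d.abscissa i a = x i := fun i => by rw [hx]
  have far : ∀ {i j}, x i ≠ x j → ∀ y, d.abscissa i y < d.abscissa j y ↔ i < j := by
    intro i j hij y
    have hne : ∀ z ∈ (univ : Set I), d.abscissa i z ≠ d.abscissa j z := by
      intro z _ e
      have hza : z = a := ha ⟨i, j, fun e' => hij (by rw [e']), e⟩
      rw [hza, hxa, hxa] at e
      exact hij e
    rw [← zero_lt]
    exact ⟨lt_of_continuousOn_ne isPreconnected_univ (d.continuous_abscissa i).continuousOn
        (d.continuous_abscissa j).continuousOn hne trivial trivial,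
      lt_of_continuousOn_ne isPreconnected_univ (d.continuous_abscissa i).continuousOn
        (d.continuous_abscissa j).continuousOn hne trivial trivial⟩
  have hxlt : ∀ {i j}, x i ≠ x j → (x i < x j ↔ i < j) := fun {i j} h => by
    rw [← hxa, ← hxa]
    exact far h a
  have below : ∀ i j, ∀ y < a, d.abscissa i y < d.abscissa j y ↔ i < j := fun i j y hy =>
    (d.lt_iff_of_free isPreconnected_Iio (fun z (hz : z < a) => hone hz.ne) hy h0 i j).trans
      (zero_lt i j)
  have above : ∀ {i j}, i < j → x i = x j → ∀ y > a, d.abscissa j y < d.abscissa i y := by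
    intro i j hij he y hy
    have n1 : (𝓝[<] a).NeBot := nhdsLT_neBot_of_exists_lt ⟨0, h0⟩
    have n2 : (𝓝[>] a).NeBot := nhdsGT_neBot_of_exists_gt ⟨1, h1⟩
    rcases d.abscissa_exchange hij.ne (by rw [hxa, hxa, he]) with ⟨-, h⟩ | ⟨h, -⟩
    · obtain ⟨z, hz, hz'⟩ := (h.and self_mem_nhdsWithin).exists
      exact (d.lt_iff_of_free isPreconnected_Ioi (fun z (hz : a < z) => hone hz.ne') hz' hy j i).1 hz
    · obtain ⟨z, hz, hz'⟩ := (h.and self_mem_nhdsWithin).exists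
      exact absurd ((below j i z hz').1 hz) hij.not_gt
  have triple : ∀ {i j k}, i ≠ j → j ≠ k → x i = x j → x j = x k → i = k := by
    intro i j k hij hjk e e'
    by_contra hik
    refine d.no_triple i j k hij hjk hik a ⟨?_, ?_⟩
    · exact (hxa i).trans (e.trans (hxa j).symm)
    · exact (hxa j).trans (e'.trans (hxa k).symm)
  -- The partner of a strand at the height `a`; a strand with no double point is its own partner.
  obtain ⟨p, hp⟩ : ∃ p : Fin (n + 1) → Fin (n + 1), ∀ i, x (p i) = x i ∧
      ∀ j, j ≠ i → x j = x i → p i = j := by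
    refine ⟨fun i => if h : ∃ j, j ≠ i ∧ x j = x i then h.choose else i, fun i => ?_⟩
    by_cases h : ∃ j, j ≠ i ∧ x j = x i
    · simp only [dif_pos h]
      refine ⟨h.choose_spec.2, fun j hj e => ?_⟩
      exact triple h.choose_spec.1 hj.symm h.choose_spec.2 e.symm
    · simp only [dif_neg h]
      exact ⟨trivial, fun j hj e => absurd ⟨j, hj, e⟩ h⟩
  have hinv : Function.Involutive p := by
    intro i
    by_cases h : p i = i
    · rw [h, h]
    · exact (hp (p i)).2 i (Ne.symm h) (hp i).1.symm
  -- A strand starting between two partners never meets them, so at `a` it would be strictly between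
  -- two equal abscissas.
  have adj : ∀ {i j : Fin (n + 1)}, i < j → x i = x j → (j : ℕ) = i + 1 := by
    intro i j hij e
    by_contra hne
    have hij' : (i : ℕ) < j := hij
    obtain ⟨k, hk⟩ : ∃ k : Fin (n + 1), (k : ℕ) = i + 1 := ⟨⟨i + 1, by omega⟩, rfl⟩
    have hik : i < k := Fin.lt_def.2 (by omega)
    have hkj : k < j := Fin.lt_def.2 (by omega)
    have nik : x i ≠ x k := fun e' => hkj.ne (triple hik.ne' hij.ne e'.symm e)
    have := (hxlt nik).2 hik
    have := (hxlt (e ▸ nik.symm)).2 hkj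
    linarith
  have hsw : (plane n).Swaps (hinv.toPerm p : Equiv.Perm (Fin (n + 1)))
      (fun i : Fin (n + 1) => ((p i : ℕ) : ℤ) - (i : ℕ)) := by
    refine ⟨fun (c : Fin (n + 1)) => ?_, fun (c : Fin (n + 1)) => ?_, fun (c : Fin (n + 1)) => ?_⟩
    · change ((c : ℕ) : ℝ) + 1 + (((p c : ℕ) : ℤ) - ((c : ℕ) : ℤ) : ℤ) = ((p c : ℕ) : ℝ) + 1
      push_cast
      ring
    · change ((p (p c) : ℕ) : ℤ) - (p c : ℕ) = -(((p c : ℕ) : ℤ) - (c : ℕ))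
      rw [hinv]
      ring
    · rcases lt_trichotomy (p c) c with h | h | h
      · have := adj h (hp c).1
        omega
      · rw [h]
        omega
      · have := adj h (hp c).1.symm
        omega
  obtain ⟨s1, s2, s3⟩ := halfScale_spec h0 h1
  have hφ : IsScaleFamily (hinv.toPerm p : Equiv.Perm (Fin (plane n).m))
    fun _ => halfScale h0 h1 := ⟨fun _ => s1, fun _ => rfl⟩
  have hcls : d.cls = hsw.diagram.cls := by
    refine (cls_eq (isotopic_of_lt_iff fun i j y => ?_)).trans (cls_eq (isotopic_swaps hsw hφ)).symm
    have he : ∀ i, (Diagram.swaps hsw hφ).abscissa i y =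
        (1 - halfScale h0 h1 y : ℝ) * i + halfScale h0 h1 y * p i + 1 := by
      intro i
      change ((i : ℕ) : ℝ) + 1 + (((p i : ℕ) : ℤ) - ((i : ℕ) : ℤ) : ℤ) * halfScale h0 h1 y = _
      push_cast
      ring
    have hcast : ∀ i j : Fin (n + 1), (i : ℝ) < j ↔ i < j := fun i j => by
      rw [Nat.cast_lt, Fin.lt_def]
    rw [he, he, add_lt_add_iff_right]
    by_cases hij : x i = x j
    · rcases eq_or_ne i j with rfl | hne
      · simp
      rw [(hp i).2 j hne.symm hij.symm, (hp j).2 i hne hij]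
      have hsc : ∀ {y z}, y < z → (halfScale h0 h1 y : ℝ) < halfScale h0 h1 z := fun h => s2 h
      generalize hu : halfScale h0 h1 = u at *
      rcases lt_trichotomy y a with hy | rfl | hy
      · rw [below i j y hy, ← hcast]
        have := hsc hy
        constructor <;> intro h <;> nlinarith
      · rw [hxa, hxa, hij, s3]
        simp
        linarith
      · have := hsc hy
        have hup : d.abscissa i y < d.abscissa j y ↔ j < i := by
          rcases lt_or_gt_of_ne hne with h | h
          · exact iff_of_false (above h hij y hy).not_gt h.not_gt
          · exact iff_of_true (above h hij.symm y hy) h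
        rw [hup, ← hcast]
        constructor <;> intro h <;> nlinarith
    · rw [far hij, ← hcast]
      have key : ∀ i j, x i ≠ x j → ((i : ℝ) < j ↔ (p i : ℝ) < p j) := fun i j h => by
        rw [hcast, hcast, ← hxlt h, ← hxlt (by rwa [(hp i).1, (hp j).1]), (hp i).1, (hp j).1]
      exact (lerp_lt_lerp_iff (halfScale h0 h1 y).2.1 (halfScale h0 h1 y).2.2 (key i j hij)
        (key j i (Ne.symm hij))).symm
  rw [hcls]
  exact swaps_mem_closure hsw

/-- Strong induction on the number of heights of double points. Cutting between two of them leaves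
at least one out of each piece. -/
theorem closure_planeElem (n : ℕ) :
    Submonoid.closure (range fun i => (planeElem n i).cls) = ⊤ := by
  refine top_unique ?_
  rintro ⟨d⟩ -
  change d.cls ∈ _
  obtain ⟨N, hN⟩ : ∃ N, d.heights.ncard = N := ⟨_, rfl⟩
  induction N using Nat.strong_induction_on generalizing d with
  | _ N ih =>
    have hpos : ∀ y ∈ d.heights, 0 < y ∧ y < 1 := fun y ⟨i, j, hij, e⟩ => d.pos_of_eq hij e
    by_cases hs : d.heights.Subsingleton
    · rcases hs.eq_empty_or_singleton with e | ⟨a, e⟩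
      -- Without double points any interior height will do.
      · exact mem_closure_of_heights_subset d (a := ⟨1 / 2, by norm_num, by norm_num⟩)
          (Subtype.coe_lt_coe.1 (by norm_num)) (Subtype.coe_lt_coe.1 (by norm_num))
          (by rw [e]; exact empty_subset _)
      · have := hpos a (by rw [e]; rfl)
        exact mem_closure_of_heights_subset d this.1 this.2 e.subset
    · rw [not_subsingleton_iff] at hs
      obtain ⟨y, hy, z, hz, hyz⟩ := hs.exists_lt
      obtain ⟨r, hr, hfree⟩ := exists_free_right d.finite_heights (hpos y hy).2
      obtain ⟨a, ha, ha'⟩ := exists_between (lt_min hyz hr)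
      have ha0 : 0 < a := (hpos y hy).1.trans ha
      have ha1 : a < 1 := (ha'.trans_le (min_le_left _ _)).trans (hpos z hz).2
      -- Pieces are diagrams only if the strands go through the marked points at the cut, hence the
      -- preliminary pinching, which keeps the heights of the double points.
      obtain ⟨e, θ, he, hh, hθ⟩ := d.exists_pinch ha0 ha1
        (hfree a ⟨ha, ha'.trans_le (min_le_right _ _)⟩)
      rw [cls_eq he, e.cls_eq_mul_segment ha0 ha1 hθ]
      rw [← hh] at hy hz hN
      refine mul_mem (ih _ ?_ _ rfl) (ih _ ?_ _ rfl)
      · rw [← hN]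
        exact e.ncard_heights_segment_lt _ _ _ hy fun h => ha.not_ge h.1
      · rw [← hN]
        exact e.ncard_heights_segment_lt _ _ _ hz fun h =>
          (ha'.trans_le (min_le_left _ _)).not_ge h.2

end HKDiagram

theorem mainTheorem5 :
    (∀ n : ℕ, ∃ ε : HKDiagram.LinearHK n ≃* HKDiagram.LinearDiagHK n,
      ∀ i : Fin n, ε (PresentedMonoid.of (HKDiagram.LRel n) i) = HKDiagram.linearGen n i) ∧
    (∀ (n : ℕ) (hn : 3 ≤ n),
      ∃ ε : HKDiagram.CircularHK n ≃* HKDiagram.CircularDiagHK n (le_trans (by norm_num) hn),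
        ∀ i : Fin n, ε (PresentedMonoid.of (HKDiagram.CRel n) i) =
          HKDiagram.circularGen n (le_trans (by norm_num) hn) i) :=
  ⟨fun n => HKDiagram.linear_isomorphism n (HKDiagram.closure_planeElem n),
    fun n hn => HKDiagram.circular_isomorphism n hn (le_trans (by norm_num) hn)⟩
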